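/- Let $\gamma>\alpha>\beta\ge 1$ be real numbers and let $f(u)=\exp\{-e^{1/u}\}$ for $u>0$, $f(0)=0$. For $r_0>0$ and $c\ge 0$ consider the problem $$ (P_c)\qquad \begin{cases} r^{-(\gamma-1)}\left(r^{\alpha}|u'|^{\beta-1}u'\right)'=\dfrac{1}{f(u)} & \text{for } 0<r<r_0,\\ u(r)>0 & \text{for } 0<r<r_0,\\ u(0)=c, \end{cases} $$ where a solution is a function $u\in C^2(0,r_0)\cap C[0,r_0)$. Then there exists $r_0>0$ such that $(P_0)$ has a unique solution $u^*$ and, for every $a>0$, $(P_a)$ has a unique solution, denoted $u(\,\cdot\,,a)$ (the regular solution). Furthermore, $$ u^*(r)=\frac{1+o(1)}{\log(|\log r|)}\quad\text{as } r\to 0^+, $$ and: (i) $u(\,\cdot\,,a)\to u^*$ in $C^2_{\rm loc}(0,r_0)\cap C_{\rm loc}[0,r_0)$ as $a\to 0^+$, that is, $u(\,\cdot\,,a)$ and its first and second derivatives converge uniformly on each compact subset of $(0,r_0)$, and $u(\,\cdot\,,a)$ converges uniformly on each compact subset of $[0,r_0)$; (ii) if $4\gamma>(\alpha-\beta)(\beta+4)$,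 then for every $\rho\in(0,r_0)$ the number of points $r\in(0,\rho)$ with $u(r,a)=u^*(r)$ (a value in $\{0,1,2,\dots\}\cup\{\infty\}$) tends to $\infty$ as $a\to 0^+$. -/

import Mathlib

open Set Filter Topology

/-- The nonlinearity `f(u) = exp(-e^{1/u})` for `u > 0`, extended by `0` elsewhere. -/
noncomputable def ruptureNonlinearity (u : ℝ) : ℝ :=
  if 0 < u then Real.exp (-Real.exp (1 / u)) else 0

/-- `u ∈ C²(0,r₀) ∩ C[0,r₀)` solves, with initial value `c`,
`r^{-(γ-1)} (r^α |u'|^{β-1} u')' = 1 / f(u)` and `u > 0` on `(0,r₀)`, `u(0) = c`.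
The value `c = 0` gives the singular problem, and `c = a > 0` the regular one. -/
structure IsRadialSolution (α β γ : ℝ) (f : ℝ → ℝ) (r₀ c : ℝ) (u : ℝ → ℝ) : Prop where
  contDiffOn : ContDiffOn ℝ 2 u (Ioo 0 r₀)
  continuousOn : ContinuousOn u (Ico 0 r₀)
  flux_differentiable : ∀ r ∈ Ioo 0 r₀,
    DifferentiableAt ℝ (fun s : ℝ => s ^ α * |deriv u s| ^ (β - 1) * deriv u s) r
  equation : ∀ r ∈ Ioo 0 r₀,
    r ^ (-(γ - 1)) * deriv (fun s : ℝ => s ^ α * |deriv u s| ^ (β - 1) * deriv u s) r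
      = 1 / f (u r)
  pos : ∀ r ∈ Ioo 0 r₀, 0 < u r
  initial : u 0 = c

/-- `u` is a solution on `[0,r₀)`, and every solution on `[0,r₀)` agrees with it there. -/
def IsUniqueRadialSolution (α β γ : ℝ) (f : ℝ → ℝ) (r₀ c : ℝ) (u : ℝ → ℝ) : Prop :=
  IsRadialSolution α β γ f r₀ c u ∧
    ∀ v : ℝ → ℝ, IsRadialSolution α β γ f r₀ c v → EqOn v u (Ico 0 r₀)

/-- `u(·,a) → w` in `C(I)` locally, as `a → 0⁺`: uniformly on each compact subset of `I`. -/
def TendstoCLoc (I : Set ℝ) (u : ℝ → ℝ → ℝ) (w : ℝ → ℝ) : Prop :=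
  ∀ K ⊆ I, IsCompact K → TendstoUniformlyOn u w (𝓝[>] 0) K

/-- `u(·,a) → w` in `C²(I)` locally, as `a → 0⁺` (for `I` open): the derivatives of order
`0, 1, 2` converge uniformly on each compact subset of `I`. -/
def TendstoC2Loc (I : Set ℝ) (u : ℝ → ℝ → ℝ) (w : ℝ → ℝ) : Prop :=
  ∀ k ≤ 2, TendstoCLoc I (fun a => iteratedDeriv k (u a)) (iteratedDeriv k w)

/-- The zero number of `h` on `I`, that is the number of zeros of `h` in `I`,
with value `⊤` when there are infinitely many. -/
noncomputable def zeroNumber (I : Set ℝ) (h : ℝ → ℝ) : ℕ∞ :=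
  {r ∈ I | h r = 0}.encard

/-!
Put `δ = α - β`, `κ = γ - δ`, `t = -log r` and `y = exp (1/u)`, so that `1 / f(u) = e^y`. The flux
`r^α |u'|^{β-1} u'` has to be positive, since otherwise `u` would be unbounded near `0`, and with
`y' = κ e^φ` and a second variable `s` (the logarithm of the ratio of the two terms that balance for
the singular solution) the equation becomes, as a system in `t`,
`s' = κ (e^φ - 1) + δ (e^s - 1)`, `φ' = δ/β (1 - e^s) + κ e^φ (1/y + 2/(y log y))`.
When `y` is large this is a small perturbation of an autonomous system with the single equilibrium
`0`, which is a source as `t → ∞`, that is, an attractor as `r` increases. Its linearization is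
`z' = κ f`, `f' = δ f - (δ/β) z`, a spiral exactly if `δ² < 4 κ δ / β`, which is
`4 γ > (α - β) (β + 4)`.

Trajectories that exist for all large `t` satisfy a priori bounds, because they would blow up
otherwise; hence every trajectory along which `y` becomes large enough visits a fixed compact set
at a late time (`IsLogTrajectory.exists_phi_ge`, `IsLogTrajectory.exists_mem_box`). Going backwards
in `t` from there, a strict Lyapunov function keeps it near the equilibrium
(`exists_forall_near_equilibrium`). The difference of two such trajectories solves the linearized
system up to a small relative error, so that it decays exponentially backwards in `t`
(`IsNearLinear.exists_forall_exp_decay`), and in the spiral case its angle turns at a rate bounded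
below (`IsNearLinear.exists_forall_exists_eq_zero`).

Regular solutions are the fixed points of a Volterra operator
(`exists_isUniqueRadialSolution_of_pos`). By the exponential decay they form a Cauchy family as
`a → 0⁺`; the limit is the singular solution (`TrajectoryComparison.exists_limit`), which is unique
for the same reason (`TrajectoryComparison.eq_of_tendsto`), and the convergence includes
derivatives. Near the equilibrium `y` is comparable with `t`, which gives the asymptotics of
`u = 1 / log y`. Finally the time interval on which `u(·, a)` and the singular solution are both
near the equilibrium becomes infinitely long as `a → 0⁺`, and in the spiral case each piece of it
of a fixed length contains an intersection.
-/

/-! ### Trajectories in logarithmic variables: a priori bounds -/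

/-- The coefficient `1/y + 2/(y log y)`, the logarithmic derivative of `y log² y`. -/
noncomputable def logDrift (y : ℝ) : ℝ := 1 / y + 2 / (y * Real.log y)

/-- A solution of the radial equation on `(0, e^{-t₀})` written in the variable `t = -log r`:
`y = exp (1/u)`, `y' = κ e^φ`, and `s` is the logarithm of the ratio of the two terms that balance
for the singular solution. Here `δ = α - β` and `κ = γ - δ`. The relation `rel` makes the system
for `(y, φ, s)` two-dimensional; all three derivatives are recorded for convenience. -/
structure IsLogTrajectory (β δ κ t₀ : ℝ) (y φ s : ℝ → ℝ) : Prop where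
  one_lt : ∀ t, t₀ < t → 1 < y t
  rel : ∀ t, t₀ < t → s t = y t - κ * t - β * (φ t + Real.log κ) + β * Real.log (y t)
    + 2 * β * Real.log (Real.log (y t)) - Real.log δ
  hasDerivAt_y : ∀ t, t₀ < t → HasDerivAt y (κ * Real.exp (φ t)) t
  hasDerivAt_s : ∀ t, t₀ < t →
    HasDerivAt s (κ * (Real.exp (φ t) - 1) + δ * (Real.exp (s t) - 1)) t
  hasDerivAt_phi : ∀ t, t₀ < t →
    HasDerivAt φ (δ / β * (1 - Real.exp (s t)) + κ * Real.exp (φ t) * logDrift (y t)) t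

lemma logDrift_pos {y : ℝ} (hy : 1 < y) : 0 < logDrift y := by
  have := Real.log_pos hy
  unfold logDrift; positivity

lemma logDrift_le {y : ℝ} (hy : Real.exp 1 ≤ y) : logDrift y ≤ 3 / y := by
  have h0 : 0 < y := (Real.exp_pos 1).trans_le hy
  have h1 : 1 ≤ Real.log y := by rwa [Real.le_log_iff_exp_le h0]
  have : 2 / (y * Real.log y) ≤ 2 / y :=
    div_le_div_of_nonneg_left (by norm_num) h0 (by nlinarith)
  unfold logDrift
  calc 1 / y + 2 / (y * Real.log y) ≤ 1 / y + 2 / y := by linarith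
    _ = 3 / y := by ring

lemma monotoneOn_Ici_of_hasDerivAt {t₁ : ℝ} {f f' : ℝ → ℝ}
    (hd : ∀ t, t₁ ≤ t → HasDerivAt f (f' t) t) (h0 : ∀ t, t₁ ≤ t → 0 ≤ f' t) :
    MonotoneOn f (Ici t₁) := by
  refine monotoneOn_of_hasDerivWithinAt_nonneg (f' := f') (convex_Ici t₁)
    (fun t ht => (hd t ht).continuousAt.continuousWithinAt) ?_ ?_
  · intro t ht
    rw [interior_Ici] at ht
    exact (hd t ht.le).hasDerivWithinAt
  · intro t ht
    rw [interior_Ici] at ht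
    exact h0 t ht.le

lemma monotoneOn_Icc_of_hasDerivAt {a b : ℝ} {f f' : ℝ → ℝ}
    (hd : ∀ t ∈ Icc a b, HasDerivAt f (f' t) t) (h0 : ∀ t ∈ Icc a b, 0 ≤ f' t) :
    MonotoneOn f (Icc a b) := by
  refine monotoneOn_of_hasDerivWithinAt_nonneg (f' := f') (convex_Icc a b)
    (fun t ht => (hd t ht).continuousAt.continuousWithinAt) ?_ ?_
  · intro t ht
    exact (hd t (interior_subset ht)).hasDerivWithinAt
  · intro t ht
    exact h0 t (interior_subset ht)

/-- Linear growth: `f' ≥ k > 0` forces `f` to exceed every bound eventually. -/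
lemma exists_forall_lt_of_deriv_ge {t₁ k B : ℝ} {f f' : ℝ → ℝ} (hk : 0 < k)
    (hd : ∀ t, t₁ ≤ t → HasDerivAt f (f' t) t) (h0 : ∀ t, t₁ ≤ t → k ≤ f' t) :
    ∃ T, t₁ ≤ T ∧ ∀ t, T ≤ t → B < f t := by
  have hm : MonotoneOn (fun t => f t - k * t) (Ici t₁) := by
    refine monotoneOn_Ici_of_hasDerivAt (f' := fun t => f' t - k) (fun t ht => ?_) (fun t ht => ?_)
    · exact ((hd t ht).sub ((hasDerivAt_id t).const_mul k)).congr_deriv (by simp)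
    · linarith [h0 t ht]
  have h1 : t₁ ≤ t₁ + (|B - f t₁| + 1) / k := by
    have : 0 ≤ (|B - f t₁| + 1) / k := by positivity
    linarith
  refine ⟨t₁ + (|B - f t₁| + 1) / k, h1, fun t ht => ?_⟩
  have h2 := hm (mem_Ici.2 le_rfl) (mem_Ici.2 (h1.trans ht)) (h1.trans ht)
  have h3 : k * (t₁ + (|B - f t₁| + 1) / k) = k * t₁ + |B - f t₁| + 1 := by field_simp; ring
  have h4 := mul_le_mul_of_nonneg_left ht hk.le
  simp only [h3] at h2 h4
  linarith [le_abs_self (B - f t₁)]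

/-- If `h' ≥ A (h - m)` and `h` starts above `m`, then `h` tends to infinity. -/
lemma exists_forall_lt_of_deriv_ge_linear {t₁ A m B : ℝ} {h h' : ℝ → ℝ} (hA : 0 < A)
    (hd : ∀ t, t₁ ≤ t → HasDerivAt h (h' t) t) (h0 : ∀ t, t₁ ≤ t → A * (h t - m) ≤ h' t)
    (h1 : m < h t₁) : ∃ T, t₁ ≤ T ∧ ∀ t, T ≤ t → B < h t := by
  have hm : MonotoneOn (fun t => (h t - m) * Real.exp (-A * (t - t₁))) (Ici t₁) := by
    refine monotoneOn_Ici_of_hasDerivAt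
      (f' := fun t => (h' t - A * (h t - m)) * Real.exp (-A * (t - t₁)))
      (fun t ht => ?_) (fun t ht => ?_)
    · have e : HasDerivAt (fun t => Real.exp (-A * (t - t₁)))
          (Real.exp (-A * (t - t₁)) * (-A * 1)) t :=
        (((hasDerivAt_id t).sub_const t₁).const_mul (-A)).exp
      exact (((hd t ht).sub_const m).mul e).congr_deriv (by ring)
    · exact mul_nonneg (by linarith [h0 t ht]) (Real.exp_pos _).le
  refine exists_forall_lt_of_deriv_ge (k := A * (h t₁ - m)) (mul_pos hA (by linarith)) hd fun t ht => ?_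
  have h2 := hm (mem_Ici.2 le_rfl) (mem_Ici.2 ht) ht
  simp only [sub_self, mul_zero, Real.exp_zero, mul_one] at h2
  have h3 : Real.exp (-A * (t - t₁)) ≤ 1 := Real.exp_le_one_iff.2 (by nlinarith)
  have h4 : 0 < h t - m := by
    by_contra hneg
    nlinarith [Real.exp_pos (-A * (t - t₁))]
  have h5 : h t₁ - m ≤ h t - m := by nlinarith
  nlinarith [h0 t ht]

/-- A positive global function with `h' ≤ A (h - m)` cannot drop below `m`. -/
lemma le_of_deriv_le_linear {t₀ A m : ℝ} {h h' : ℝ → ℝ} (hA : 0 < A)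
    (hd : ∀ t, t₀ < t → HasDerivAt h (h' t) t) (h0 : ∀ t, t₀ < t → h' t ≤ A * (h t - m))
    (hpos : ∀ t, t₀ < t → 0 < h t) {t : ℝ} (ht : t₀ < t) : m ≤ h t := by
  by_contra! hlt
  obtain ⟨t', h1, h2⟩ := exists_forall_lt_of_deriv_ge_linear (t₁ := t) (A := A) (m := -m) (B := 0)
    (h := fun t => -h t) (h' := fun t => -h' t) hA (fun x hx => (hd x (ht.trans_le hx)).neg)
    (fun x hx => by nlinarith [h0 x (ht.trans_le hx)]) (by linarith)
  linarith [hpos t' (ht.trans_le h1), h2 t' le_rfl]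

namespace IsLogTrajectory

variable {β δ κ t₀ : ℝ} {y φ s : ℝ → ℝ}

lemma monotoneOn_y (h : IsLogTrajectory β δ κ t₀ y φ s) (hκ : 0 < κ) :
    MonotoneOn y (Ioi t₀) := by
  intro a ha b hb hab
  exact monotoneOn_Ici_of_hasDerivAt (fun t ht => h.hasDerivAt_y t (lt_of_lt_of_le ha ht))
    (fun t _ => by positivity) (mem_Ici.2 le_rfl) (mem_Ici.2 hab) hab

/-- A trajectory that lives for all time has `δ e^s ≤ κ + δ`, since otherwise `s` blows up. -/
lemma exp_s_le (h : IsLogTrajectory β δ κ t₀ y φ s) (hκ : 0 < κ) (hδ : 0 < δ) {t : ℝ}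
    (ht : t₀ < t) : δ * Real.exp (s t) ≤ κ + δ := by
  have key : δ / (κ + δ) ≤ Real.exp (-s t) := by
    refine le_of_deriv_le_linear (A := κ + δ) (h := fun t => Real.exp (-s t)) (by positivity)
      (fun t ht => (h.hasDerivAt_s t ht).neg.exp) (fun t ht => ?_) (fun t _ => Real.exp_pos _) ht
    have e : Real.exp (-s t) * Real.exp (s t) = 1 := by rw [← Real.exp_add]; simp
    have e2 : (κ + δ) * (Real.exp (-s t) - δ / (κ + δ)) = (κ + δ) * Real.exp (-s t) - δ := by
      field_simp
    rw [e2]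
    change Real.exp (-s t) * _ ≤ _
    have : 0 ≤ Real.exp (-s t) * (κ * Real.exp (φ t)) := by positivity
    nlinarith
  rw [Real.exp_neg, div_le_iff₀ (by positivity)] at key
  have := Real.exp_pos (s t)
  calc δ * Real.exp (s t) ≤ ((Real.exp (s t))⁻¹ * (κ + δ)) * Real.exp (s t) := by gcongr
    _ = κ + δ := by field_simp

lemma s_le (h : IsLogTrajectory β δ κ t₀ y φ s) (hκ : 0 < κ) (hδ : 0 < δ) {t : ℝ}
    (ht : t₀ < t) : s t ≤ Real.log ((κ + δ) / δ) := by
  rw [Real.le_log_iff_exp_le (by positivity), le_div_iff₀ hδ]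
  linarith [h.exp_s_le hκ hδ ht]

/-- The combination `φ + s/β` is bounded above along global trajectories, again because it would
blow up otherwise: its derivative is at least `κ/β (e^φ - 1)`. -/
lemma phi_add_le (h : IsLogTrajectory β δ κ t₀ y φ s) (hβ : 0 < β) (hκ : 0 < κ) (hδ : 0 < δ)
    {t : ℝ} (ht : t₀ < t) : φ t + s t / β ≤ Real.log ((κ + δ) / δ) / β := by
  set S := Real.log ((κ + δ) / δ) with hS
  have key : 1 ≤ Real.exp (-(φ t + s t / β - S / β)) := by
    refine le_of_deriv_le_linear (A := κ / β) (h := fun t => Real.exp (-(φ t + s t / β - S / β)))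
      (by positivity) (fun t ht => ((((h.hasDerivAt_phi t ht).add
        ((h.hasDerivAt_s t ht).div_const β)).sub_const (S / β)).neg).exp) (fun t ht => ?_)
      (fun t _ => Real.exp_pos _) ht
    set X := Real.exp (-(φ t + s t / β - S / β)) with hX
    have hX0 : 0 < X := Real.exp_pos _
    have h1 : 1 ≤ X * Real.exp (φ t) := by
      rw [hX, ← Real.exp_add]
      apply Real.one_le_exp
      have : s t / β ≤ S / β := by gcongr; exact h.s_le hκ hδ ht
      linarith
    have h2 : 0 ≤ κ * Real.exp (φ t) * logDrift (y t) := by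
      have := logDrift_pos (h.one_lt t ht); positivity
    have h3 : δ / β * (1 - Real.exp (s t)) + κ * Real.exp (φ t) * logDrift (y t)
        + (κ * (Real.exp (φ t) - 1) + δ * (Real.exp (s t) - 1)) / β
        = κ / β * (Real.exp (φ t) - 1) + κ * Real.exp (φ t) * logDrift (y t) := by
      field_simp; ring
    rw [h3]
    change X * _ ≤ κ / β * (X - 1)
    have h4 : 0 ≤ κ / β := by positivity
    nlinarith [mul_nonneg hX0.le h2, mul_nonneg h4 (sub_nonneg.2 h1)]
  have := Real.one_le_exp_iff.1 key
  linarith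

/-- While `e^s ≤ 1/2` the speed grows, and then `s` grows too: `s` has to come back. -/
lemma exists_neg_log_two_le (h : IsLogTrajectory β δ κ t₀ y φ s) (hβ : 0 < β) (hκ : 0 < κ)
    (hδ : 0 < δ) {t₁ : ℝ} (ht : t₀ < t₁) : ∃ t, t₁ ≤ t ∧ -Real.log 2 ≤ s t := by
  by_contra! hc
  have hs : ∀ t, t₁ ≤ t → Real.exp (s t) ≤ 1 / 2 := fun t h1 => by
    have := Real.exp_le_exp.2 (hc t h1).le
    rw [Real.exp_neg, Real.exp_log (by norm_num)] at this
    linarith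
  have hφ : ∀ t, t₁ ≤ t →
      δ / (2 * β) ≤ δ / β * (1 - Real.exp (s t)) + κ * Real.exp (φ t) * logDrift (y t) := by
    intro t h1
    have h2 : 0 ≤ κ * Real.exp (φ t) * logDrift (y t) := by
      have := logDrift_pos (h.one_lt t (ht.trans_le h1)); positivity
    have h3 : δ / β * (1 / 2) ≤ δ / β * (1 - Real.exp (s t)) := by
      gcongr; linarith [hs t h1]
    have h4 : δ / (2 * β) = δ / β * (1 / 2) := by field_simp
    linarith
  obtain ⟨t₂, h12, h2⟩ := exists_forall_lt_of_deriv_ge (B := (κ + δ + 1) / κ)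
    (show 0 < δ / (2 * β) by positivity)
    (fun t h1 => h.hasDerivAt_phi t (ht.trans_le h1)) hφ
  obtain ⟨t₃, h23, h3⟩ := exists_forall_lt_of_deriv_ge (B := 0) (f := s) (t₁ := t₂) one_pos
    (fun t h1 => h.hasDerivAt_s t (ht.trans_le (h12.trans h1))) (fun t h1 => by
      have h4 := h2 t h1
      have h5 := Real.add_one_le_exp (φ t)
      have h6 : κ * ((κ + δ + 1) / κ) ≤ κ * Real.exp (φ t) := by gcongr; linarith
      have h7 : κ * ((κ + δ + 1) / κ) = κ + δ + 1 := by field_simp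
      have := mul_pos hδ (Real.exp_pos (s t))
      linarith)
  have := hc t₃ (h12.trans h23)
  have := h3 t₃ le_rfl
  have := Real.log_pos one_lt_two
  linarith

lemma continuousOn_s (h : IsLogTrajectory β δ κ t₀ y φ s) : ContinuousOn s (Ioi t₀) :=
  fun t ht => (h.hasDerivAt_s t ht).continuousAt.continuousWithinAt

lemma continuousOn_phi (h : IsLogTrajectory β δ κ t₀ y φ s) : ContinuousOn φ (Ioi t₀) :=
  fun t ht => (h.hasDerivAt_phi t ht).continuousAt.continuousWithinAt

lemma continuousOn_y (h : IsLogTrajectory β δ κ t₀ y φ s) : ContinuousOn y (Ioi t₀) :=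
  fun t ht => (h.hasDerivAt_y t ht).continuousAt.continuousWithinAt

/-- After a time at which the speed is not small, there is a time at which `s` and `φ` both lie
in a fixed compact set. -/
lemma exists_mem_box (h : IsLogTrajectory β δ κ t₀ y φ s) (hβ : 0 < β) (hκ : 0 < κ)
    (hδ : 0 < δ) {t₁ φ₀ : ℝ} (ht : t₀ < t₁) (hφ₀ : φ₀ ≤ φ t₁) :
    ∃ t, t₁ ≤ t ∧ -Real.log 2 ≤ s t ∧ s t ≤ Real.log ((κ + δ) / δ) ∧ φ₀ ≤ φ t ∧
      φ t ≤ (Real.log ((κ + δ) / δ) + Real.log 2) / β := by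
  suffices ∃ t, t₁ ≤ t ∧ -Real.log 2 ≤ s t ∧ φ₀ ≤ φ t by
    obtain ⟨t, h1, h2, h3⟩ := this
    refine ⟨t, h1, h2, h.s_le hκ hδ (ht.trans_le h1), h3, ?_⟩
    have h4 := h.phi_add_le hβ hκ hδ (ht.trans_le h1)
    have h5 : -Real.log 2 / β ≤ s t / β := by gcongr
    rw [add_div]
    rw [neg_div] at h5
    linarith
  obtain ⟨t₂, h12, h2⟩ := h.exists_neg_log_two_le hβ hκ hδ ht
  -- the first time after `t₁` at which `s` is not below `-log 2`
  set A := Icc t₁ t₂ ∩ s ⁻¹' Ici (-Real.log 2) with hA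
  have hAc : IsClosed A :=
    (h.continuousOn_s.mono fun t h1 => ht.trans_le h1.1).preimage_isClosed_of_isClosed
      isClosed_Icc isClosed_Ici
  have hAn : A.Nonempty := ⟨t₂, ⟨h12, le_rfl⟩, h2⟩
  have hAb : BddBelow A := ⟨t₁, fun t h1 => h1.1.1⟩
  have hmem := hAc.csInf_mem hAn hAb
  set t' := sInf A
  refine ⟨t', hmem.1.1, hmem.2, hφ₀.trans ?_⟩
  have hlt : ∀ t, t₁ ≤ t → t < t' → s t < -Real.log 2 := by
    intro t h1 h3
    by_contra! hge
    exact absurd (csInf_le hAb ⟨⟨h1, h3.le.trans hmem.1.2⟩, hge⟩) (not_le.2 h3)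
  refine monotoneOn_of_hasDerivWithinAt_nonneg (convex_Icc t₁ t')
    (h.continuousOn_phi.mono fun t h1 => ht.trans_le h1.1)
    (fun t h1 => (h.hasDerivAt_phi t
      (ht.trans_le (interior_subset h1).1)).hasDerivWithinAt) (fun t h1 => ?_)
    (left_mem_Icc.2 hmem.1.1) (right_mem_Icc.2 hmem.1.1) hmem.1.1
  rw [interior_Icc] at h1
  have h2 : 0 ≤ κ * Real.exp (φ t) * logDrift (y t) := by
    have := logDrift_pos (h.one_lt t (ht.trans h1.1)); positivity
  have h3 : Real.exp (s t) ≤ 1 := Real.exp_le_one_iff.2 (by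
    linarith [hlt t h1.1.le h1.2, Real.log_pos one_lt_two])
  have h4 : 0 ≤ δ / β * (1 - Real.exp (s t)) := mul_nonneg (by positivity) (by linarith)
  linarith

end IsLogTrajectory

/-! ### Shadowing of the equilibrium -/

namespace IsLogTrajectory

variable {β δ κ t₀ : ℝ} {y φ s : ℝ → ℝ}

lemma y_add_log_eq (h : IsLogTrajectory β δ κ t₀ y φ s) {t : ℝ} (ht : t₀ < t) :
    y t + β * Real.log (y t) + 2 * β * Real.log (Real.log (y t))
      = κ * t + s t + β * (φ t + Real.log κ) + Real.log δ := by
  linarith [h.rel t ht]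

/-- If the speed stays below `κ/4` from `t₁` on, then it decays exponentially, and `y` is bounded.
Hence a trajectory along which `y` becomes large must reach the speed `κ/4` after `t₁`. -/
lemma exists_phi_ge (h : IsLogTrajectory β δ κ t₀ y φ s) (hβ : 0 < β) (hκ : 0 < κ) (hδ : 0 < δ)
    {t₁ : ℝ} (ht : t₀ < t₁)
    (hlarge : ∃ t, t₀ < t ∧ max (max (Real.exp 1) (3 * β))
      (κ * t₁ + Real.log ((κ + δ) / δ) + β * |Real.log κ| + |Real.log δ|) + β < y t) :
    ∃ t, t₁ ≤ t ∧ -Real.log 4 ≤ φ t := by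
  by_contra! hc
  obtain ⟨t₃, h03, h3⟩ := hlarge
  set Y := max (Real.exp 1) (3 * β) with hY
  set Z := κ * t₁ + Real.log ((κ + δ) / δ) + β * |Real.log κ| + |Real.log δ| with hZ
  have hp : ∀ t, t₁ ≤ t → Real.exp (φ t) ≤ 1 / 4 := fun t h1 => by
    have := Real.exp_le_exp.2 (hc t h1).le
    rw [Real.exp_neg, Real.exp_log (by norm_num)] at this
    linarith
  have hs : ∀ t, t₁ ≤ t → 3 / 4 * κ + δ ≤ δ * Real.exp (s t) := by
    intro t₂ h12
    by_contra! hlt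
    have e : ∀ t, Real.exp (-s t) * Real.exp (s t) = 1 := fun t => by rw [← Real.exp_add]; simp
    have hA : 0 < 3 / 4 * κ + δ := by positivity
    obtain ⟨T, hT, hT2⟩ := exists_forall_lt_of_deriv_ge_linear (t₁ := t₂) (A := 3 / 4 * κ + δ)
      (m := δ / (3 / 4 * κ + δ)) (B := 2) (h := fun t => Real.exp (-s t)) hA
      (fun t h1 => (h.hasDerivAt_s t (ht.trans_le (h12.trans h1))).neg.exp) (fun t h1 => by
        have e2 : (3 / 4 * κ + δ) * (Real.exp (-s t) - δ / (3 / 4 * κ + δ))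
          = (3 / 4 * κ + δ) * Real.exp (-s t) - δ := by field_simp
        rw [e2]
        change _ ≤ Real.exp (-s t) * _
        have h5 : Real.exp (-s t) * (κ * Real.exp (φ t)) ≤ Real.exp (-s t) * (κ * (1 / 4)) := by
          gcongr; exact hp t (h12.trans h1)
        have h6 : Real.exp (-s t) * -(κ * (Real.exp (φ t) - 1) + δ * (Real.exp (s t) - 1))
          = -(Real.exp (-s t) * (κ * Real.exp (φ t))) + (κ + δ) * Real.exp (-s t)
            - δ * (Real.exp (-s t) * Real.exp (s t)) := by ring
        rw [h6, e t]
        linarith) (by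
        rw [div_lt_iff₀ hA]
        calc δ = Real.exp (-s t₂) * (δ * Real.exp (s t₂)) := by
              rw [mul_left_comm, e]; ring
          _ < Real.exp (-s t₂) * (3 / 4 * κ + δ) := by
              have := Real.exp_pos (-s t₂); gcongr)
    obtain ⟨t, h1, h2⟩ := h.exists_neg_log_two_le hβ hκ hδ (ht.trans_le (h12.trans hT))
    have h4 := hT2 t h1
    have h5 : Real.exp (-s t) ≤ 2 := by
      rw [← Real.le_log_iff_exp_le (by norm_num)]; linarith
    linarith
  have hφ : ∀ t, t₁ ≤ t → Y ≤ y t →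
      δ / β * (1 - Real.exp (s t)) + κ * Real.exp (φ t) * logDrift (y t) ≤ -(κ / (2 * β)) := by
    intro t h1 h2
    have h4 : logDrift (y t) ≤ 1 / β := by
      refine (logDrift_le ((le_max_left _ _).trans h2)).trans ?_
      have h5 : 3 * β ≤ y t := (le_max_right _ _).trans h2
      have h6 : 0 < y t := by linarith
      rw [div_le_div_iff₀ h6 hβ]
      linarith
    have h5 : κ * Real.exp (φ t) * logDrift (y t) ≤ κ * (1 / 4) * (1 / β) := by
      have := logDrift_pos (h.one_lt t (ht.trans_le h1))
      gcongr; exact hp t h1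
    have h6 : δ / β * (1 - Real.exp (s t)) ≤ 1 / β * (-(3 / 4 * κ)) := by
      have : δ / β * (1 - Real.exp (s t)) = 1 / β * (δ - δ * Real.exp (s t)) := by ring
      rw [this]; gcongr; linarith [hs t h1]
    have h7 : -(κ / (2 * β)) = κ * (1 / 4) * (1 / β) + 1 / β * (-(3 / 4 * κ)) := by
      field_simp; ring
    linarith
  have hmono := h.monotoneOn_y hκ
  obtain ⟨t₂, h12, h2, h2'⟩ : ∃ t₂, t₁ ≤ t₂ ∧ Y ≤ y t₂ ∧ y t₂ ≤ max Y Z := by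
    rcases le_or_gt Y (y t₁) with h1 | h1
    · refine ⟨t₁, le_rfl, h1, le_max_of_le_right ?_⟩
      have h4 := h.y_add_log_eq ht
      have h5 : 0 ≤ Real.log (y t₁) := (Real.log_pos (h.one_lt t₁ ht)).le
      have h6 : 0 ≤ Real.log (Real.log (y t₁)) := by
        apply Real.log_nonneg
        rw [Real.le_log_iff_exp_le (by linarith [h.one_lt t₁ ht])]
        exact (le_max_left _ _).trans h1
      have h7 := h.s_le hκ hδ ht
      have h8 : φ t₁ ≤ 0 := by
        have := hc t₁ le_rfl
        have := Real.log_pos (show (1:ℝ) < 4 by norm_num)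
        linarith
      have h9 := le_abs_self (Real.log κ)
      have h10 := le_abs_self (Real.log δ)
      have h11 : 0 ≤ 2 * β * Real.log (Real.log (y t₁)) := by positivity
      have h12 : 0 ≤ β * Real.log (y t₁) := by positivity
      have h13 : β * (φ t₁ + Real.log κ) ≤ β * |Real.log κ| := by gcongr; linarith
      rw [hZ]; linarith
    · have h13 : t₁ ≤ t₃ := by
        by_contra! hlt
        have := hmono h03 ht hlt.le
        linarith [le_max_left Y Z]
      obtain ⟨t₂, h4, h5⟩ := intermediate_value_Icc h13
        (h.continuousOn_y.mono fun t h1 => ht.trans_le h1.1)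
        (show Y ∈ Icc (y t₁) (y t₃) from ⟨h1.le, by linarith [le_max_left Y Z]⟩)
      exact ⟨t₂, h4.1, h5.ge, h5.le.trans (le_max_left _ _)⟩
  have h02 : t₀ < t₂ := ht.trans_le h12
  -- `y + 2 β e^φ` decreases while the speed is small
  have hanti : MonotoneOn (fun t => -(y t + 2 * β * Real.exp (φ t))) (Ici t₂) := by
    refine monotoneOn_Ici_of_hasDerivAt (fun t h1 => ((h.hasDerivAt_y t (h02.trans_le h1)).add
      (((h.hasDerivAt_phi t (h02.trans_le h1)).exp).const_mul (2 * β))).neg) (fun t h1 => ?_)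
    have h4 := hφ t (h12.trans h1) (h2.trans (hmono h02 (h02.trans_le h1) h1))
    have h5 := mul_le_mul_of_nonneg_left h4
      (show 0 ≤ 2 * β * Real.exp (φ t) by positivity)
    have h6 : 2 * β * Real.exp (φ t) * -(κ / (2 * β)) = -(κ * Real.exp (φ t)) := by field_simp
    linarith
  have h4 := hanti (mem_Ici.2 le_rfl) (mem_Ici.2 (le_max_left t₂ t₃)) (le_max_left t₂ t₃)
  have h5 := hmono h03 (h02.trans_le (le_max_left t₂ t₃)) (le_max_right t₂ t₃)
  have h6 := hp t₂ h12
  have h7 := mul_pos (mul_pos two_pos hβ) (Real.exp_pos (φ (max t₂ t₃)))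
  have h8 : 2 * β * Real.exp (φ t₂) ≤ 2 * β * (1 / 4) := by gcongr
  simp only [] at h4
  linarith

/-- A bound on `s` and `φ` forces `y` to be large at large times. -/
lemma lt_y_of_abs_le (h : IsLogTrajectory β δ κ t₀ y φ s) (hβ : 0 < β)
    {t R Y : ℝ} (ht : t₀ < t) (hs : |s t| ≤ R) (hφ : |φ t| ≤ R)
    (hlarge : Y + β * Real.log Y + 2 * β * Real.log (Real.log Y) + R + β * (R + |Real.log κ|)
      + |Real.log δ| < κ * t) : Y < y t := by
  by_contra! hle
  have h1 := h.one_lt t ht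
  have h2 := Real.log_pos h1
  have h3 : Real.log (y t) ≤ Real.log Y := Real.log_le_log (by linarith) hle
  have h4 : Real.log (Real.log (y t)) ≤ Real.log (Real.log Y) := Real.log_le_log h2 h3
  have h5 := h.y_add_log_eq ht
  have h6 := (abs_le.1 hs).1
  have h7 : β * -(R + |Real.log κ|) ≤ β * (φ t + Real.log κ) := by
    gcongr; linarith [(abs_le.1 hφ).1, neg_abs_le (Real.log κ)]
  have h8 := neg_abs_le (Real.log δ)
  have h9 : β * Real.log (y t) ≤ β * Real.log Y := by gcongr
  have h10 : 2 * β * Real.log (Real.log (y t)) ≤ 2 * β * Real.log (Real.log Y) := by gcongr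
  linarith

end IsLogTrajectory

lemma exp_sub_one_bounds {R x : ℝ} (hx : |x| ≤ R) :
    Real.exp (-R) * x ^ 2 ≤ x * (Real.exp x - 1) ∧ x * (Real.exp x - 1) ≤ Real.exp R * x ^ 2 ∧
    Real.exp (-R) * |x| ≤ |Real.exp x - 1| ∧ |Real.exp x - 1| ≤ Real.exp R * |x| := by
  have hR : 0 ≤ R := (abs_nonneg x).trans hx
  have h1 := Real.add_one_le_exp x
  have h2 : 1 - x ≤ Real.exp (-x) := by linarith [Real.add_one_le_exp (-x)]
  have h3 : Real.exp x - 1 ≤ x * Real.exp x := by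
    have := mul_le_mul_of_nonneg_right h2 (Real.exp_pos x).le
    rw [← Real.exp_add] at this
    simp at this
    linarith
  have h4 : Real.exp x ≤ Real.exp R := Real.exp_le_exp.2 ((le_abs_self x).trans hx)
  have h5 : Real.exp (-R) ≤ Real.exp x := Real.exp_le_exp.2 (abs_le.1 hx).1
  have h6 : Real.exp (-R) ≤ 1 := Real.exp_le_one_iff.2 (by linarith)
  have h7 : 1 ≤ Real.exp R := Real.one_le_exp hR
  have key : Real.exp (-R) * |x| ≤ |Real.exp x - 1| ∧ |Real.exp x - 1| ≤ Real.exp R * |x| := by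
    rcases le_total 0 x with h0 | h0
    · rw [abs_of_nonneg h0, abs_of_nonneg (by linarith)]
      constructor <;> nlinarith
    · rw [abs_of_nonpos h0, abs_of_nonpos (by linarith [Real.exp_le_one_iff.2 h0])]
      constructor <;> nlinarith
  have e : x * (Real.exp x - 1) = |x| * |Real.exp x - 1| := by
    rw [← abs_mul, abs_of_nonneg]
    rcases le_total 0 x with h0 | h0
    · exact mul_nonneg h0 (by linarith)
    · exact mul_nonneg_of_nonpos_of_nonpos h0 (by linarith [Real.exp_le_one_iff.2 h0])
  refine ⟨?_, ?_, key⟩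
  · rw [e, ← sq_abs x]; nlinarith [abs_nonneg x]
  · rw [e, ← sq_abs x]; nlinarith [abs_nonneg x]

lemma exp_sub_self_bounds {R x : ℝ} (hx : |x| ≤ R) :
    Real.exp (-(2 * R)) / 4 * x ^ 2 ≤ Real.exp x - x - 1 ∧
      Real.exp x - x - 1 ≤ Real.exp R * x ^ 2 := by
  have hR : 0 ≤ R := (abs_nonneg x).trans hx
  constructor
  · have h1 : Real.exp x = Real.exp (x / 2) ^ 2 := by rw [← Real.exp_nat_mul]; ring_nf
    have h2 := Real.add_one_le_exp (x / 2)
    have h3 := (exp_sub_one_bounds (R := R) (x := x / 2) (by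
      rw [abs_div, abs_two]; linarith [abs_nonneg x])).2.2.1
    have h4 : (Real.exp (-R) * |x / 2|) ^ 2 ≤ |Real.exp (x / 2) - 1| ^ 2 := by gcongr
    rw [mul_pow, sq_abs, sq_abs, ← Real.exp_nat_mul] at h4
    have h5 : ((2 : ℕ) : ℝ) * -R = -(2 * R) := by push_cast; ring
    rw [h5] at h4
    nlinarith
  · refine le_trans ?_ (exp_sub_one_bounds hx).2.1
    have h2 : 1 - x ≤ Real.exp (-x) := by linarith [Real.add_one_le_exp (-x)]
    have := mul_le_mul_of_nonneg_right h2 (Real.exp_pos x).le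
    rw [← Real.exp_add] at this
    simp at this
    linarith

lemma abs_sub_one_le_exp_sub (x : ℝ) : |x| - 1 ≤ Real.exp x - x - 1 := by
  rcases le_total 0 x with h0 | h0
  · rw [abs_of_nonneg h0]
    nlinarith [Real.quadratic_le_exp_of_nonneg h0, sq_nonneg (x - 1)]
  · rw [abs_of_nonpos h0]; linarith [Real.exp_pos x]

/-- A strict Lyapunov function for the limit system `s' = κ (e^φ - 1) + δ (e^s - 1)`,
`φ' = δ/β (1 - e^s)`, whose only equilibrium is the origin. The first two terms form a Lyapunov
function; the cross term makes its growth strict away from the origin. -/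
noncomputable def balanceEnergy (β δ κ θ s φ : ℝ) : ℝ :=
  κ * (Real.exp φ - φ - 1) + δ / β * (Real.exp s - s - 1) + θ * (φ * s)

/-- The derivative of `balanceEnergy` along a trajectory, with `e = logDrift y`. -/
noncomputable def balanceEnergyRate (β δ κ θ s φ e : ℝ) : ℝ :=
  δ ^ 2 / β * (Real.exp s - 1) ^ 2 + κ * (Real.exp φ - 1) * (κ * Real.exp φ * e)
    + θ * (s * (δ / β * (1 - Real.exp s) + κ * Real.exp φ * e)
      + φ * (κ * (Real.exp φ - 1) + δ * (Real.exp s - 1)))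

lemma IsLogTrajectory.hasDerivAt_balanceEnergy {β δ κ t₀ : ℝ} {y φ s : ℝ → ℝ}
    (h : IsLogTrajectory β δ κ t₀ y φ s) (θ : ℝ) {t : ℝ} (ht : t₀ < t) :
    HasDerivAt (fun t => balanceEnergy β δ κ θ (s t) (φ t))
      (balanceEnergyRate β δ κ θ (s t) (φ t) (logDrift (y t))) t := by
  have h1 := h.hasDerivAt_s t ht
  have h2 := h.hasDerivAt_phi t ht
  unfold balanceEnergy
  refine ((((h2.exp.sub h2).sub_const 1).const_mul κ).add
    (((h1.exp.sub h1).sub_const 1).const_mul (δ / β)) |>.add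
    ((h2.mul h1).const_mul θ)).congr_deriv ?_
  unfold balanceEnergyRate
  ring

lemma balanceEnergy_le {β δ κ θ R s φ : ℝ} (hβ : 0 < β) (hδ : 0 < δ) (hκ : 0 < κ) (hθ : 0 ≤ θ)
    (hs : |s| ≤ R) (hφ : |φ| ≤ R) : balanceEnergy β δ κ θ s φ
      ≤ ((κ + δ / β) * Real.exp R + θ) * (s ^ 2 + φ ^ 2) := by
  have hdb : 0 < δ / β := by positivity
  have h1 := (exp_sub_self_bounds hs).2
  have h2 := (exp_sub_self_bounds hφ).2
  have h3 := mul_le_mul_of_nonneg_left h1 hdb.le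
  have h4 := mul_le_mul_of_nonneg_left h2 hκ.le
  have h5 : θ * (φ * s) ≤ θ * (s ^ 2 + φ ^ 2) := by
    gcongr; nlinarith [sq_nonneg (s - φ), sq_nonneg s, sq_nonneg φ]
  have h6 : 0 ≤ δ / β * (Real.exp R * φ ^ 2) := by positivity
  have h7 : 0 ≤ κ * (Real.exp R * s ^ 2) := by positivity
  unfold balanceEnergy
  linarith

lemma le_balanceEnergy {β δ κ θ R s φ : ℝ} (hθ : 0 ≤ θ) (hκ : 0 ≤ κ) (hdb : 0 ≤ δ / β)
    (hθ' : θ ≤ min κ (δ / β) * (Real.exp (-(2 * R)) / 4))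
    (hs : |s| ≤ R) (hφ : |φ| ≤ R) :
    min κ (δ / β) * (Real.exp (-(2 * R)) / 4) / 2 * (s ^ 2 + φ ^ 2)
      ≤ balanceEnergy β δ κ θ s φ := by
  have h1 := (exp_sub_self_bounds hs).1
  have h2 := (exp_sub_self_bounds hφ).1
  set q := Real.exp (-(2 * R)) / 4 with hq'
  have hq : 0 < q := by positivity
  have h3 : min κ (δ / β) * q * φ ^ 2 ≤ κ * (Real.exp φ - φ - 1) := by
    calc min κ (δ / β) * q * φ ^ 2 = min κ (δ / β) * (q * φ ^ 2) := by ring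
      _ ≤ κ * (q * φ ^ 2) := by gcongr; exact min_le_left _ _
      _ ≤ _ := by gcongr
  have h4 : min κ (δ / β) * q * s ^ 2 ≤ δ / β * (Real.exp s - s - 1) := by
    calc min κ (δ / β) * q * s ^ 2 = min κ (δ / β) * (q * s ^ 2) := by ring
      _ ≤ δ / β * (q * s ^ 2) := by gcongr; exact min_le_right _ _
      _ ≤ _ := by gcongr
  have h5 : -(θ * (s ^ 2 + φ ^ 2) / 2) ≤ θ * (φ * s) := by nlinarith [sq_nonneg (s + φ)]
  have h6 : θ * (s ^ 2 + φ ^ 2) ≤ min κ (δ / β) * q * (s ^ 2 + φ ^ 2) := by gcongr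
  unfold balanceEnergy
  linarith

lemma le_balanceEnergyRate {β δ κ θ R s φ e m M : ℝ} (hβ : 0 < β) (hδ : 0 < δ) (hκ : 0 < κ)
    (hθ0 : 0 < θ) (hm : m = Real.exp (-R)) (hM : M = Real.exp R)
    (hθ3 : θ * (δ / β * M + δ ^ 2 * M ^ 2 / (2 * κ * m)) ≤ δ ^ 2 / β * m ^ 2 / 2)
    (hs : |s| ≤ R) (hφ : |φ| ≤ R) (he : 0 ≤ e) :
    min (δ ^ 2 / β * m ^ 2 / 2) (θ * κ * m / 2) * (s ^ 2 + φ ^ 2)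
      - (κ * (M * R) * (κ * M) + θ * (R * (κ * M))) * e ≤ balanceEnergyRate β δ κ θ s φ e := by
  have hm0 : 0 < m := hm ▸ Real.exp_pos _
  have hM0 : 0 < M := hM ▸ Real.exp_pos _
  have hdb : 0 < δ / β := by positivity
  obtain ⟨-, hs2, hs3, hs4⟩ := exp_sub_one_bounds hs
  obtain ⟨hφ1, -, -, hφ4⟩ := exp_sub_one_bounds hφ
  have hφM : Real.exp φ ≤ M := hM ▸ Real.exp_le_exp.2 ((le_abs_self φ).trans hφ)
  rw [← hm] at hs3 hφ1
  rw [← hM] at hs2 hs4 hφ4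
  clear hm hM
  have e1 : -(κ * (M * R) * (κ * M) * e) ≤ κ * (Real.exp φ - 1) * (κ * Real.exp φ * e) := by
    have a0 : 0 ≤ κ * Real.exp φ * e := by positivity
    have : |κ * (Real.exp φ - 1) * (κ * Real.exp φ * e)| ≤ κ * (M * R) * (κ * M * e) := by
      rw [abs_mul, abs_mul, abs_of_pos hκ, abs_of_nonneg a0]
      have a1 : |Real.exp φ - 1| ≤ M * R := hφ4.trans (by gcongr)
      have a2 : κ * Real.exp φ * e ≤ κ * M * e := by gcongr
      have a3 : 0 ≤ M * R := (abs_nonneg _).trans a1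
      exact mul_le_mul (mul_le_mul_of_nonneg_left a1 hκ.le) a2 a0 (by positivity)
    have := neg_le_of_abs_le this
    linarith
  have e2 : -(θ * (R * (κ * M)) * e) ≤ θ * (s * (κ * Real.exp φ * e)) := by
    have a0 : 0 ≤ κ * Real.exp φ * e := by positivity
    have : |s * (κ * Real.exp φ * e)| ≤ R * (κ * M * e) := by
      rw [abs_mul, abs_of_nonneg a0]
      exact mul_le_mul hs (by gcongr) a0 ((abs_nonneg _).trans hs)
    have := mul_le_mul_of_nonneg_left (neg_le_of_abs_le this) hθ0.le
    linarith
  have e3 : δ ^ 2 / β * m ^ 2 * s ^ 2 ≤ δ ^ 2 / β * (Real.exp s - 1) ^ 2 := by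
    have : (m * |s|) ^ 2 ≤ |Real.exp s - 1| ^ 2 := by gcongr
    rw [mul_pow, sq_abs, sq_abs] at this
    rw [mul_assoc]; gcongr
  have e4 : -(θ * (δ / β * M) * s ^ 2) ≤ θ * (s * (δ / β * (1 - Real.exp s))) := by
    have := mul_le_mul_of_nonneg_left hs2 (mul_pos hθ0 hdb).le
    linarith
  have e5 : θ * κ * m * φ ^ 2 ≤ θ * (φ * (κ * (Real.exp φ - 1))) := by
    have := mul_le_mul_of_nonneg_left hφ1 (mul_pos hθ0 hκ).le
    linarith
  have e6 : -(θ * κ * m / 2 * φ ^ 2) - θ * (δ ^ 2 * M ^ 2 / (2 * κ * m)) * s ^ 2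
      ≤ θ * (φ * (δ * (Real.exp s - 1))) := by
    have a1 : |φ * (δ * (Real.exp s - 1))| ≤ |φ| * (δ * (M * |s|)) := by
      rw [abs_mul, abs_mul, abs_of_pos hδ]; gcongr
    have a2 : |φ| * (δ * (M * |s|)) ≤ κ * m / 2 * φ ^ 2
        + δ ^ 2 * M ^ 2 / (2 * κ * m) * s ^ 2 := by
      have a3 : κ * m / 2 * φ ^ 2 + δ ^ 2 * M ^ 2 / (2 * κ * m) * s ^ 2
          - |φ| * (δ * (M * |s|)) = (κ * m * |φ| - δ * M * |s|) ^ 2 / (2 * κ * m) := by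
        rw [← sq_abs φ, ← sq_abs s]; field_simp; ring
      have : 0 ≤ (κ * m * |φ| - δ * M * |s|) ^ 2 / (2 * κ * m) := by positivity
      linarith
    have := mul_le_mul_of_nonneg_left (neg_le_of_abs_le (a1.trans a2)) hθ0.le
    linarith
  have e7 : θ * (δ / β * M) * s ^ 2 + θ * (δ ^ 2 * M ^ 2 / (2 * κ * m)) * s ^ 2
      ≤ δ ^ 2 / β * m ^ 2 / 2 * s ^ 2 := by
    have := mul_le_mul_of_nonneg_right hθ3 (sq_nonneg s)
    linarith
  have a1 := mul_le_mul_of_nonneg_right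
    (min_le_left (δ ^ 2 / β * m ^ 2 / 2) (θ * κ * m / 2)) (sq_nonneg s)
  have a2 := mul_le_mul_of_nonneg_right
    (min_le_right (δ ^ 2 / β * m ^ 2 / 2) (θ * κ * m / 2)) (sq_nonneg φ)
  unfold balanceEnergyRate
  linarith

/-- For every compact box there are a larger box and a weight `θ` for which the energy traps
trajectories: a trajectory that ends in the small box stays, backwards in time, in the large one
as long as its energy does not increase much. -/
lemma exists_balanceEnergy_estimates {β δ κ : ℝ} (hβ : 0 < β) (hδ : 0 < δ) (hκ : 0 < κ)
    {R₀ : ℝ} (hR₀ : 0 < R₀) :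
    ∃ θ R K c C D : ℝ, R₀ < R ∧ 0 < K ∧ 0 < c ∧ 0 < C ∧ 0 < D ∧
      (∀ s φ, |s| ≤ R₀ → |φ| ≤ R₀ → balanceEnergy β δ κ θ s φ ≤ K) ∧
      (∀ s φ, |s| ≤ R → |φ| ≤ R → balanceEnergy β δ κ θ s φ ≤ K + 1 → |s| < R ∧ |φ| < R) ∧
      (∀ s φ, |s| ≤ R → |φ| ≤ R → D * (s ^ 2 + φ ^ 2) ≤ balanceEnergy β δ κ θ s φ) ∧
      (∀ s φ e, |s| ≤ R → |φ| ≤ R → 0 ≤ e →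
        c * balanceEnergy β δ κ θ s φ - C * e ≤ balanceEnergyRate β δ κ θ s φ e) := by
  set K := (κ + δ / β) * (Real.exp R₀ * R₀ ^ 2) + 1 with hK
  have hK0 : 0 < K := by positivity
  set R := R₀ + ((K + 2) / κ + (K + 2) * β / δ + 2) with hR
  have hRR : R₀ < R := by
    have : 0 < (K + 2) / κ + (K + 2) * β / δ + 2 := by positivity
    linarith
  have hR0 : 0 < R := hR₀.trans hRR
  set m := Real.exp (-R) with hm
  set M := Real.exp R with hM
  have hm0 : 0 < m := Real.exp_pos _
  have hM0 : 0 < M := Real.exp_pos _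
  set cl := min κ (δ / β) * (Real.exp (-(2 * R)) / 4) with hcl
  have hcl0 : 0 < cl := by
    have : 0 < min κ (δ / β) := lt_min hκ (by positivity)
    positivity
  set G := δ / β * M + δ ^ 2 * M ^ 2 / (2 * κ * m) with hG
  have hG0 : 0 < G := by positivity
  set θ := min (1 / R ^ 2) (min cl (δ ^ 2 / β * m ^ 2 / 2 / G)) with hθ
  have hθ0 : 0 < θ := lt_min (by positivity) (lt_min hcl0 (by positivity))
  have hθ1 : θ * R ^ 2 ≤ 1 := by
    have : θ ≤ 1 / R ^ 2 := min_le_left _ _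
    rwa [le_div_iff₀ (by positivity)] at this
  have hθ2 : θ ≤ cl := (min_le_right _ _).trans (min_le_left _ _)
  have hθ3 : θ * G ≤ δ ^ 2 / β * m ^ 2 / 2 := by
    have : θ ≤ δ ^ 2 / β * m ^ 2 / 2 / G := (min_le_right _ _).trans (min_le_right _ _)
    rwa [le_div_iff₀ hG0] at this
  have hcross : ∀ s φ r : ℝ, |s| ≤ r → |φ| ≤ r → r ≤ R → |θ * (φ * s)| ≤ 1 := by
    intro s φ r hs hφ hr
    rw [abs_mul, abs_mul, abs_of_pos hθ0]
    have h1 : |φ| * |s| ≤ R * R :=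
      mul_le_mul (hφ.trans hr) (hs.trans hr) (abs_nonneg _) hR0.le
    have h2 := mul_le_mul_of_nonneg_left h1 hθ0.le
    linarith only [h2, hθ1]
  have hdb : 0 < δ / β := by positivity
  set c₁ := min (δ ^ 2 / β * m ^ 2 / 2) (θ * κ * m / 2) with hc₁
  have hc₁0 : 0 < c₁ := lt_min (by positivity) (by positivity)
  set C₂ := (κ + δ / β) * M + θ with hC₂
  have hC₂0 : 0 < C₂ := by positivity
  clear_value θ R
  refine ⟨θ, R, K, c₁ / C₂, κ * (M * R) * (κ * M) + θ * (R * (κ * M)), cl / 2, hRR, hK0,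
    by positivity, by positivity, by positivity, ?_, ?_, ?_, ?_⟩
  · intro s φ hs hφ
    have h3 := hcross s φ R₀ hs hφ hRR.le
    have h1' := (exp_sub_self_bounds hs).2
    have h2' := (exp_sub_self_bounds hφ).2
    have h4 : s ^ 2 ≤ R₀ ^ 2 := sq_le_sq' (by linarith [(abs_le.1 hs).1]) (abs_le.1 hs).2
    have h5 : φ ^ 2 ≤ R₀ ^ 2 := sq_le_sq' (by linarith [(abs_le.1 hφ).1]) (abs_le.1 hφ).2
    have h6 : Real.exp s - s - 1 ≤ Real.exp R₀ * R₀ ^ 2 := h1'.trans (by gcongr)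
    have h7 : Real.exp φ - φ - 1 ≤ Real.exp R₀ * R₀ ^ 2 := h2'.trans (by gcongr)
    have h8 := mul_le_mul_of_nonneg_left h6 hdb.le
    have h9 := mul_le_mul_of_nonneg_left h7 hκ.le
    have h10 := le_of_abs_le h3
    unfold balanceEnergy
    clear_value K
    rw [hK]; linarith
  · intro s φ hs hφ hW
    clear_value K
    have h3 := neg_le_of_abs_le (hcross s φ R hs hφ le_rfl)
    have h4 := abs_sub_one_le_exp_sub s
    have h5 := abs_sub_one_le_exp_sub φ
    have h6 : 0 ≤ Real.exp s - s - 1 := by linarith [Real.add_one_le_exp s]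
    have h7 : 0 ≤ Real.exp φ - φ - 1 := by linarith [Real.add_one_le_exp φ]
    have h8 := mul_nonneg hdb.le h6
    have h9 := mul_nonneg hκ.le h7
    unfold balanceEnergy at hW
    have h10 : κ * (|φ| - 1) ≤ K + 2 := by
      have := mul_le_mul_of_nonneg_left h5 hκ.le
      linarith only [this, hW, h3, h8]
    have h11 : δ / β * (|s| - 1) ≤ K + 2 := by
      have := mul_le_mul_of_nonneg_left h4 hdb.le
      linarith only [this, hW, h3, h9]
    have h12 : |φ| - 1 ≤ (K + 2) / κ := by rw [le_div_iff₀ hκ]; linarith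
    have h13 : |s| - 1 ≤ (K + 2) * β / δ := by
      rw [le_div_iff₀ hδ]
      calc (|s| - 1) * δ = (δ / β * (|s| - 1)) * β := by field_simp
        _ ≤ (K + 2) * β := by gcongr
    have h14 : 0 < (K + 2) / κ := by positivity
    have h15 : 0 < (K + 2) * β / δ := by positivity
    constructor <;> linarith
  · exact fun s φ hs hφ => le_balanceEnergy hθ0.le hκ.le hdb.le hθ2 hs hφ
  · intro s φ e hs hφ he
    refine le_trans (sub_le_sub_right ?_ _)
      (le_balanceEnergyRate hβ hδ hκ hθ0 hm hM hθ3 hs hφ he)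
    calc c₁ / C₂ * balanceEnergy β δ κ θ s φ ≤ c₁ / C₂ * (C₂ * (s ^ 2 + φ ^ 2)) :=
          mul_le_mul_of_nonneg_left (balanceEnergy_le hβ hδ hκ hθ0.le hs hφ)
            (div_nonneg hc₁0.le hC₂0.le)
      _ = c₁ * (s ^ 2 + φ ^ 2) := by field_simp

/-- Backward trapping: if `F` grows at least like `c F - η` and the box `|s|, |φ| < R` can only be
left where `F > K + 1`, then a trajectory that is in the box with `F ≤ K` at time `t'` was in the
box at all earlier times, and `F` was exponentially small up to the error `η / c`. -/
lemma backward_trapping {t₀ t' R K c η : ℝ} {s φ F F' : ℝ → ℝ} (hc : 0 < c) (hK : 0 < K)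
    (hη : 0 ≤ η) (hηc : η / c ≤ 1)
    (hs : ContinuousOn s (Ioi t₀)) (hφ : ContinuousOn φ (Ioi t₀))
    (hF : ∀ t, t₀ < t → HasDerivAt F (F' t) t)
    (hgrow : ∀ t, t₀ < t → |s t| ≤ R → |φ t| ≤ R → c * F t - η ≤ F' t)
    (hexit : ∀ t, t₀ < t → |s t| ≤ R → |φ t| ≤ R → F t ≤ K + 1 → |s t| < R ∧ |φ t| < R)
    (hs' : |s t'| ≤ R) (hφ' : |φ t'| ≤ R) (hF' : F t' ≤ K) {t : ℝ} (ht : t₀ < t)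
    (htt' : t ≤ t') :
    |s t| ≤ R ∧ |φ t| ≤ R ∧ F t ≤ η / c + K * Real.exp (-c * (t' - t)) := by
  have est : ∀ a, t₀ < a → a ≤ t' → (∀ x ∈ Icc a t', |s x| ≤ R ∧ |φ x| ≤ R) →
      F a ≤ η / c + K * Real.exp (-c * (t' - a)) := by
    intro a ha hat hbox
    have hm : MonotoneOn (fun x => (F x - η / c) * Real.exp (-c * (x - a))) (Icc a t') := by
      refine monotoneOn_Icc_of_hasDerivAt
        (f' := fun x => (F' x - (c * F x - η)) * Real.exp (-c * (x - a)))
        (fun x hx => ?_) (fun x hx => ?_)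
      · have e : HasDerivAt (fun t => Real.exp (-c * (t - a)))
            (Real.exp (-c * (x - a)) * (-c * 1)) x :=
          (((hasDerivAt_id x).sub_const a).const_mul (-c)).exp
        refine (((hF x (ha.trans_le hx.1)).sub_const (η / c)).mul e).congr_deriv ?_
        field_simp
        ring
      · refine mul_nonneg ?_ (Real.exp_pos _).le
        linarith [hgrow x (ha.trans_le hx.1) (hbox x hx).1 (hbox x hx).2]
    have h1 := hm (left_mem_Icc.2 hat) (right_mem_Icc.2 hat) hat
    simp only [sub_self, mul_zero, Real.exp_zero, mul_one] at h1
    have h2 : F t' - η / c ≤ K := by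
      have : 0 ≤ η / c := by positivity
      linarith
    have h3 := mul_le_mul_of_nonneg_right h2 (Real.exp_pos (-c * (t' - a))).le
    linarith
  have strict : ∀ a, t₀ < a → a ≤ t' → (∀ x ∈ Icc a t', |s x| ≤ R ∧ |φ x| ≤ R) →
      |s a| < R ∧ |φ a| < R := by
    intro a ha hat hbox
    have hb := hbox a (left_mem_Icc.2 hat)
    refine hexit a ha hb.1 hb.2 ((est a ha hat hbox).trans ?_)
    have : Real.exp (-c * (t' - a)) ≤ 1 := Real.exp_le_one_iff.2 (by nlinarith)
    nlinarith
  suffices hall : ∀ x ∈ Icc t t', |s x| ≤ R ∧ |φ x| ≤ R from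
    ⟨(hall t (left_mem_Icc.2 htt')).1, (hall t (left_mem_Icc.2 htt')).2, est t ht htt' hall⟩
  by_contra! hbad
  -- the last time at which the open box is left
  set g : ℝ → ℝ := fun x => max |s x| |φ x| with hg
  have hgc : ContinuousOn g (Icc t t') :=
    ((hs.abs.sup hφ.abs).mono fun x hx => ht.trans_le hx.1)
  set A := Icc t t' ∩ g ⁻¹' Ici R with hA
  have hAc : IsClosed A := hgc.preimage_isClosed_of_isClosed isClosed_Icc isClosed_Ici
  have hAn : A.Nonempty := by
    obtain ⟨x, hx, hx2⟩ := hbad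
    refine ⟨x, hx, ?_⟩
    rcases le_or_gt |s x| R with h1 | h1
    · exact le_max_of_le_right (hx2 h1).le
    · exact le_max_of_le_left h1.le
  have hAb : BddAbove A := ⟨t', fun x hx => hx.1.2⟩
  have hmem := hAc.csSup_mem hAn hAb
  set a := sSup A
  have hin : ∀ x, a < x → x ≤ t' → g x < R := by
    intro x h1 h2
    by_contra! h3
    exact absurd (le_csSup hAb ⟨⟨hmem.1.1.trans h1.le, h2⟩, h3⟩) (not_le.2 h1)
  have hga : g a ≤ R := by
    rcases hmem.1.2.eq_or_lt with h1 | h1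
    · rw [h1]; exact max_le hs' hφ'
    · have hcl : Icc a t' ⊆ closure (Ioc a t') := by rw [closure_Ioc h1.ne]
      have h2 : ContinuousWithinAt g (Ioc a t') a :=
        (hgc a hmem.1).mono fun x hx => ⟨hmem.1.1.trans hx.1.le, hx.2⟩
      have h3 : (𝓝[Ioc a t'] a).NeBot :=
        mem_closure_iff_nhdsWithin_neBot.1 (hcl (left_mem_Icc.2 h1.le))
      exact le_of_tendsto h2 (by
        filter_upwards [self_mem_nhdsWithin] with x hx using (hin x hx.1 hx.2).le)
  have hfin := strict a (ht.trans_le hmem.1.1) hmem.1.2 (fun x hx => by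
    have : g x ≤ R := by
      rcases hx.1.eq_or_lt with h1 | h1
      · rw [← h1]; exact hga
      · exact (hin x h1 hx.2).le
    exact max_le_iff.1 this)
  exact absurd (max_lt hfin.1 hfin.2) (not_lt.2 hmem.2)

/-- The regular and singular trajectories shadow the equilibrium: after discarding a fixed initial
range of `r`, every trajectory whose `y` gets large enough (depending on `t₁`) satisfies
`|s|, |φ| ≤ ν` up to time `t₁`. -/
theorem exists_forall_near_equilibrium {β δ κ : ℝ} (hβ : 0 < β) (hδ : 0 < δ) (hκ : 0 < κ)
    {ν : ℝ} (hν : 0 < ν) (Y : ℝ) :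
    ∃ (t₀ : ℝ) (B : ℝ → ℝ), 0 < t₀ ∧ ∀ y φ s, IsLogTrajectory β δ κ t₀ y φ s →
      ∀ t₁, t₀ < t₁ → (∃ t, t₀ < t ∧ B t₁ < y t) →
        ∀ t, t₀ < t → t ≤ t₁ → |s t| ≤ ν ∧ |φ t| ≤ ν ∧ Y ≤ y t := by
  set S := Real.log ((κ + δ) / δ) with hS
  set R₀ := Real.log 4 + |S| + (|S| + Real.log 2) / β with hR₀
  have hl2 : 0 < Real.log 2 := Real.log_pos (by norm_num)
  have hl4 : Real.log 2 < Real.log 4 := Real.log_lt_log (by norm_num) (by norm_num)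
  have hR₀0 : 0 < R₀ := by positivity
  obtain ⟨θ, R, K, c, C, D, hRR, hK, hc, hC, hD, hW1, hW2, hW3, hW4⟩ :=
    exists_balanceEnergy_estimates hβ hδ hκ hR₀0
  set τ := min 1 (D * ν ^ 2 / 2) with hτ
  have hτ0 : 0 < τ := lt_min one_pos (by positivity)
  set Y₀ := max (max (Real.exp 1) Y) (3 * C / (c * τ)) with hY₀
  have hY₀1 : Real.exp 1 ≤ Y₀ := (le_max_left _ _).trans (le_max_left _ _)
  have hY₀0 : 0 < Y₀ := (Real.exp_pos 1).trans_le hY₀1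
  set T := (Y₀ + β * Real.log Y₀ + 2 * β * Real.log (Real.log Y₀) + R + β * (R + |Real.log κ|)
      + |Real.log δ|) / κ with hT
  set L := |Real.log (K / τ)| / c with hL
  have hL0 : 0 ≤ L := by positivity
  refine ⟨max 1 T, fun t₁ => max (max (Real.exp 1) (3 * β))
      (κ * (t₁ + L) + Real.log ((κ + δ) / δ) + β * |Real.log κ| + |Real.log δ|) + β,
    lt_of_lt_of_le one_pos (le_max_left _ _), ?_⟩
  intro y φ s h t₁ ht₁ hbig t ht htt₁
  obtain ⟨t₂, h12, hφ2⟩ := h.exists_phi_ge hβ hκ hδ (t₁ := t₁ + L) (by linarith) hbig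
  obtain ⟨t', h2', hs1, hs2, hφ1, hφ2'⟩ := h.exists_mem_box hβ hκ hδ (by linarith) hφ2
  have hs' : |s t'| ≤ R₀ := by
    rw [abs_le]
    have : 0 ≤ (|S| + Real.log 2) / β := by positivity
    constructor <;> linarith [le_abs_self S, abs_nonneg S]
  have hφ' : |φ t'| ≤ R₀ := by
    rw [abs_le]
    have h1 : 0 ≤ (|S| + Real.log 2) / β := by positivity
    have h2 : (S + Real.log 2) / β ≤ (|S| + Real.log 2) / β := by gcongr; exact le_abs_self S
    constructor <;> linarith [abs_nonneg S]
  have hy : ∀ x, max 1 T < x → |s x| ≤ R → |φ x| ≤ R → Y₀ < y x := by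
    intro x hx h1 h2
    refine h.lt_y_of_abs_le hβ hx h1 h2 ?_
    have : T < x := (le_max_right _ _).trans_lt hx
    rw [hT, div_lt_iff₀ hκ] at this
    linarith
  have hdrift : ∀ x, max 1 T < x → |s x| ≤ R → |φ x| ≤ R →
      C * logDrift (y x) ≤ C * (3 / Y₀) := by
    intro x hx h1 h2
    have h3 := hy x hx h1 h2
    have := logDrift_le (hY₀1.trans h3.le)
    have : 3 / y x ≤ 3 / Y₀ := by gcongr
    gcongr; linarith
  have hηc : C * (3 / Y₀) / c ≤ τ := by
    have : 3 * C / (c * τ) ≤ Y₀ := le_max_right _ _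
    rw [div_le_iff₀ (by positivity)] at this
    rw [div_le_iff₀ hc, ← mul_div_assoc, div_le_iff₀ hY₀0]
    linarith
  obtain ⟨hb1, hb2, hb3⟩ := backward_trapping (t₀ := max 1 T) (t' := t') (R := R) (K := K) (c := c)
    (η := C * (3 / Y₀)) (s := s) (φ := φ) (F := fun t => balanceEnergy β δ κ θ (s t) (φ t)) hc hK
    (by positivity) (hηc.trans (min_le_left _ _)) h.continuousOn_s h.continuousOn_phi
    (fun x hx => h.hasDerivAt_balanceEnergy θ hx)
    (fun x hx h1 h2 => by
      have := hW4 (s x) (φ x) (logDrift (y x)) h1 h2 (logDrift_pos (h.one_lt x hx)).le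
      linarith [hdrift x hx h1 h2])
    (fun x hx h1 h2 h3 => hW2 _ _ h1 h2 h3) (hs'.trans hRR.le) (hφ'.trans hRR.le)
    (hW1 _ _ hs' hφ') ht (by linarith)
  have hsmall : K * Real.exp (-c * (t' - t)) ≤ τ := by
    have h1 : c * L = |Real.log (K / τ)| := by rw [hL]; field_simp
    have h2 : c * L ≤ c * (t' - t) := by gcongr; linarith
    have h3 : Real.exp (-c * (t' - t)) ≤ Real.exp (-Real.log (K / τ)) := by
      apply Real.exp_le_exp.2
      linarith [le_abs_self (Real.log (K / τ))]
    rw [Real.exp_neg, Real.exp_log (by positivity)] at h3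
    calc K * Real.exp (-c * (t' - t)) ≤ K * (K / τ)⁻¹ := by gcongr
      _ = τ := by field_simp
  have hτ2 : τ ≤ D * ν ^ 2 / 2 := min_le_right _ _
  have hfin := (hW3 _ _ hb1 hb2).trans hb3
  have hsq : s t ^ 2 + φ t ^ 2 ≤ ν ^ 2 := by
    have : D * (s t ^ 2 + φ t ^ 2) ≤ D * ν ^ 2 := by linarith
    exact le_of_mul_le_mul_left this hD
  refine ⟨abs_le_of_sq_le_sq (by linarith only [sq_nonneg (φ t), hsq]) hν.le,
    abs_le_of_sq_le_sq (by linarith only [sq_nonneg (s t), hsq]) hν.le, ?_⟩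
  exact (le_max_right _ _).trans ((le_max_left _ _).trans (hy t ht hb1 hb2).le)

/-! ### Differences of trajectories: contraction and oscillation -/

lemma abs_exp_sub_exp_sub_le {ν a b : ℝ} (ha : |a| ≤ ν) (hb : |b| ≤ ν) :
    |Real.exp a - Real.exp b - (a - b)| ≤ (Real.exp ν - 1) * |a - b| := by
  wlog hab : b ≤ a generalizing a b
  · have := this hb ha (le_of_not_ge hab)
    rw [abs_sub_comm a b, ← abs_neg]
    convert this using 2
    ring
  have h1 : (a - b) * Real.exp b ≤ Real.exp a - Real.exp b := by
    have h := mul_le_mul_of_nonneg_right (Real.add_one_le_exp (a - b)) (Real.exp_pos b).le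
    rw [← Real.exp_add, sub_add_cancel] at h
    linarith
  have h2 : Real.exp a - Real.exp b ≤ (a - b) * Real.exp a := by
    have h := mul_le_mul_of_nonneg_right (Real.add_one_le_exp (b - a)) (Real.exp_pos a).le
    rw [← Real.exp_add, sub_add_cancel] at h
    linarith
  have h3 : Real.exp a ≤ Real.exp ν := Real.exp_le_exp.2 (abs_le.1 ha).2
  have h4 : 2 - Real.exp ν ≤ Real.exp b := by
    have h5 : Real.exp (-ν) ≤ Real.exp b := Real.exp_le_exp.2 (abs_le.1 hb).1
    have h6 : Real.exp ν * Real.exp (-ν) = 1 := by rw [← Real.exp_add]; simp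
    have h7 : Real.exp ν * (2 - Real.exp ν) ≤ Real.exp ν * Real.exp (-ν) := by
      rw [h6]; linarith [sq_nonneg (Real.exp ν - 1)]
    exact (le_of_mul_le_mul_left h7 (Real.exp_pos ν)).trans h5
  have h0 : 0 ≤ a - b := by linarith
  rw [abs_of_nonneg h0, abs_le]
  constructor
  · have := mul_le_mul_of_nonneg_left h4 h0
    linarith
  · have := mul_le_mul_of_nonneg_left h3 h0
    linarith

lemma abs_log_sub_log_le {Y a b : ℝ} (hY : 0 < Y) (ha : Y ≤ a) (hb : Y ≤ b) :
    |Real.log a - Real.log b| ≤ |a - b| / Y := by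
  wlog hab : b ≤ a generalizing a b
  · have := this hb ha (le_of_not_ge hab)
    rwa [abs_sub_comm, abs_sub_comm a b]
  have ha0 : 0 < a := hY.trans_le ha
  have hb0 : 0 < b := hY.trans_le hb
  have h1 : 0 ≤ Real.log a - Real.log b := by linarith [Real.log_le_log hb0 hab]
  rw [abs_of_nonneg h1, abs_of_nonneg (by linarith : 0 ≤ a - b), ← Real.log_div ha0.ne' hb0.ne']
  calc Real.log (a / b) ≤ a / b - 1 := Real.log_le_sub_one_of_pos (by positivity)
    _ = (a - b) / b := by field_simp
    _ ≤ (a - b) / Y := div_le_div_of_nonneg_left (by linarith) hY hb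

lemma abs_logDrift_sub_le {Y a b : ℝ} (hY : Real.exp 1 ≤ Y) (ha : Y ≤ a) (hb : Y ≤ b) :
    |logDrift a - logDrift b| ≤ 5 * (|a - b| / Y) := by
  have he : 1 ≤ Real.exp 1 := Real.one_le_exp zero_le_one
  have hY0 : 0 < Y := by linarith
  have ha0 : 0 < a := by linarith
  have hb0 : 0 < b := by linarith
  have hla : 1 ≤ Real.log a := by rw [Real.le_log_iff_exp_le ha0]; linarith
  have hlb : 1 ≤ Real.log b := by rw [Real.le_log_iff_exp_le hb0]; linarith
  have hl := abs_log_sub_log_le hY0 ha hb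
  set l := Real.log a
  set k := Real.log b
  have e1 : logDrift a - logDrift b
      = -(a - b) * (1 / a / b) - (a - b) * (2 / (a * b * l)) - (l - k) * (2 / (b * l * k)) := by
    unfold logDrift
    change 1 / a + 2 / (a * l) - (1 / b + 2 / (b * k)) = _
    have : l ≠ 0 := by linarith
    have : k ≠ 0 := by linarith
    field_simp
    ring
  have h1 : 1 / a / b ≤ 1 / Y := by
    rw [div_div]
    exact div_le_div_of_nonneg_left zero_le_one hY0 (by nlinarith)
  have h2 : 2 / (a * b * l) ≤ 2 / Y := by
    refine div_le_div_of_nonneg_left zero_le_two hY0 ?_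
    have : Y ≤ a * b := by nlinarith
    nlinarith
  have h3 : 2 / (b * l * k) ≤ 2 := by
    rw [div_le_iff₀ (by positivity)]
    have : 1 ≤ b * l := by nlinarith
    nlinarith
  have p1 : 0 ≤ 1 / a / b := by positivity
  have p2 : 0 ≤ 2 / (a * b * l) := by positivity
  have p3 : 0 ≤ 2 / (b * l * k) := by positivity
  rw [e1]
  calc _ ≤ |-(a - b) * (1 / a / b)| + |(a - b) * (2 / (a * b * l))|
        + |(l - k) * (2 / (b * l * k))| := (abs_sub _ _).trans (by gcongr; exact abs_sub _ _)
    _ = |a - b| * (1 / a / b) + |a - b| * (2 / (a * b * l)) + |l - k| * (2 / (b * l * k)) := by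
        rw [abs_mul, abs_mul, abs_mul, abs_neg, abs_of_nonneg p1, abs_of_nonneg p2,
          abs_of_nonneg p3]
    _ ≤ |a - b| * (1 / Y) + |a - b| * (2 / Y) + |a - b| / Y * 2 := by gcongr
    _ = 5 * (|a - b| / Y) := by ring

/-- On `S`, the pair `(z, f)` solves, up to an error `μ (|z| + |f|)`, the linear system
`z' = κ f`, `f' = δ f - (δ/β) z`, the linearization of the trajectory system in `(y, φ)` at the
equilibrium. -/
structure IsNearLinear (β δ κ μ : ℝ) (S : Set ℝ) (z f z' f' : ℝ → ℝ) : Prop where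
  hasDerivAt_fst : ∀ t ∈ S, HasDerivAt z (z' t) t
  hasDerivAt_snd : ∀ t ∈ S, HasDerivAt f (f' t) t
  abs_fst_le : ∀ t ∈ S, |z' t - κ * f t| ≤ μ * (|z t| + |f t|)
  abs_snd_le : ∀ t ∈ S, |f' t - (δ * f t - δ / β * z t)| ≤ μ * (|z t| + |f t|)

lemma IsNearLinear.mono {β δ κ μ μ' : ℝ} {S T : Set ℝ} {z f z' f' : ℝ → ℝ}
    (h : IsNearLinear β δ κ μ S z f z' f') (hμ : μ ≤ μ') (hT : T ⊆ S) :
    IsNearLinear β δ κ μ' T z f z' f' where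
  hasDerivAt_fst t ht := h.hasDerivAt_fst t (hT ht)
  hasDerivAt_snd t ht := h.hasDerivAt_snd t (hT ht)
  abs_fst_le t ht := (h.abs_fst_le t (hT ht)).trans (by gcongr)
  abs_snd_le t ht := (h.abs_snd_le t (hT ht)).trans (by gcongr)

/-- The right-hand side of the equation for `φ`. -/
noncomputable def phiRate (β δ κ y φ s : ℝ) : ℝ :=
  δ / β * (1 - Real.exp s) + κ * Real.exp φ * logDrift y

lemma abs_sub_sub_le_of_rel {β Y y₁ y₂ φ₁ φ₂ s₁ s₂ : ℝ} (hβ : 0 < β) (hY : Real.exp 1 ≤ Y)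
    (hy₁ : Y ≤ y₁) (hy₂ : Y ≤ y₂)
    (hrel : s₁ - s₂ = (y₁ - y₂) - β * (φ₁ - φ₂) + β * (Real.log y₁ - Real.log y₂)
      + 2 * β * (Real.log (Real.log y₁) - Real.log (Real.log y₂))) :
    |(s₁ - s₂) - ((y₁ - y₂) - β * (φ₁ - φ₂))| ≤ 3 * β * (|y₁ - y₂| / Y) := by
  have hY0 : 0 < Y := (Real.exp_pos 1).trans_le hY
  have hl₁ : 1 ≤ Real.log y₁ := by
    rw [Real.le_log_iff_exp_le (hY0.trans_le hy₁)]; linarith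
  have hl₂ : 1 ≤ Real.log y₂ := by
    rw [Real.le_log_iff_exp_le (hY0.trans_le hy₂)]; linarith
  have h1 := abs_log_sub_log_le hY0 hy₁ hy₂
  have h2 := abs_log_sub_log_le one_pos hl₁ hl₂
  rw [div_one] at h2
  rw [hrel]
  calc _ = |β * (Real.log y₁ - Real.log y₂)
      + 2 * β * (Real.log (Real.log y₁) - Real.log (Real.log y₂))| := by congr 1; ring
    _ ≤ β * |Real.log y₁ - Real.log y₂|
      + 2 * β * |Real.log (Real.log y₁) - Real.log (Real.log y₂)| := by
        refine (abs_add_le _ _).trans_eq ?_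
        rw [abs_mul, abs_mul, abs_of_pos hβ, abs_of_pos (by positivity : 0 < 2 * β)]
    _ ≤ β * (|y₁ - y₂| / Y) + 2 * β * (|y₁ - y₂| / Y) := by gcongr; exact h2.trans h1
    _ = _ := by ring

/-- The difference of two states near the equilibrium with large `y` satisfies the linearized
equations up to a small relative error. -/
lemma exists_forall_abs_rate_sub_le {β δ κ : ℝ} (hβ : 0 < β) (hδ : 0 < δ) (hκ : 0 < κ)
    {μ : ℝ} (hμ : 0 < μ) : ∃ ν Y : ℝ, 0 < ν ∧ ν ≤ 1 ∧ Real.exp 1 ≤ Y ∧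
      ∀ y₁ y₂ φ₁ φ₂ s₁ s₂ : ℝ, |s₁| ≤ ν → |s₂| ≤ ν → |φ₁| ≤ ν → |φ₂| ≤ ν → Y ≤ y₁ → Y ≤ y₂ →
      s₁ - s₂ = (y₁ - y₂) - β * (φ₁ - φ₂) + β * (Real.log y₁ - Real.log y₂)
        + 2 * β * (Real.log (Real.log y₁) - Real.log (Real.log y₂)) →
      |κ * Real.exp φ₁ - κ * Real.exp φ₂ - κ * (φ₁ - φ₂)| ≤ μ * (|y₁ - y₂| + |φ₁ - φ₂|) ∧
      |phiRate β δ κ y₁ φ₁ s₁ - phiRate β δ κ y₂ φ₂ s₂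
        - (δ * (φ₁ - φ₂) - δ / β * (y₁ - y₂))| ≤ μ * (|y₁ - y₂| + |φ₁ - φ₂|) ∧
      |y₁ - y₂| ≤ 4 + 4 * β ∧
      |s₁ - s₂| ≤ (2 + β) * (|y₁ - y₂| + |φ₁ - φ₂|) := by
  have hdb : 0 < δ / β := by positivity
  set G := δ / β * (2 + 4 * β) + 16 * κ with hG
  have hG0 : 0 < G := by positivity
  set η := min 1 (μ / G) with hη
  have hη0 : 0 < η := lt_min one_pos (by positivity)
  have hη1 : η ≤ 1 := min_le_left _ _
  have hη2 : η * G ≤ μ := by rw [← le_div_iff₀ hG0]; exact min_le_right _ _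
  clear_value η
  refine ⟨Real.log (1 + η), max (Real.exp 1) (max (1 / η) (6 * β)), Real.log_pos (by linarith),
    (Real.log_le_sub_one_of_pos (by linarith)).trans (by linarith), le_max_left _ _, ?_⟩
  intro y₁ y₂ φ₁ φ₂ s₁ s₂ hs₁ hs₂ hφ₁ hφ₂ hy₁ hy₂ hrel
  set Y := max (Real.exp 1) (max (1 / η) (6 * β)) with hY
  have hYe : Real.exp 1 ≤ Y := le_max_left _ _
  have hY0 : 0 < Y := (Real.exp_pos 1).trans_le hYe
  have hYη : 1 / Y ≤ η := by
    have : 1 / η ≤ Y := (le_max_left _ _).trans (le_max_right _ _)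
    rw [div_le_iff₀ hη0] at this
    rw [div_le_iff₀ hY0]; linarith
  have hYβ : 3 * β / Y ≤ 1 / 2 := by
    have : 6 * β ≤ Y := (le_max_right _ _).trans (le_max_right _ _)
    rw [div_le_iff₀ hY0]; linarith
  have hν : Real.exp (Real.log (1 + η)) - 1 = η := by
    rw [Real.exp_log (by linarith)]; ring
  have hσ := abs_sub_sub_le_of_rel hβ hYe hy₁ hy₂ hrel
  have hes := abs_exp_sub_exp_sub_le hs₁ hs₂
  have heφ := abs_exp_sub_exp_sub_le hφ₁ hφ₂
  rw [hν] at hes heφ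
  have hd := abs_logDrift_sub_le hYe hy₁ hy₂
  have hd2 : logDrift y₂ ≤ 3 * η := by
    refine (logDrift_le (hYe.trans hy₂)).trans ?_
    calc 3 / y₂ ≤ 3 / Y := by gcongr
      _ = 3 * (1 / Y) := by ring
      _ ≤ 3 * η := by gcongr
  have hd2' : 0 < logDrift y₂ := by
    refine logDrift_pos ?_
    have := Real.add_one_lt_exp (one_ne_zero)
    linarith
  have hφe : Real.exp φ₁ ≤ 2 := by
    have h1 := Real.exp_le_exp.2 (abs_le.1 hφ₁).2
    linarith
  set z := y₁ - y₂ with hz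
  set f := φ₁ - φ₂ with hf
  have hzY : |z| / Y ≤ η * |z| := by
    calc |z| / Y = 1 / Y * |z| := by ring
      _ ≤ η * |z| := by gcongr
  have hz0 := abs_nonneg z
  have hf0 := abs_nonneg f
  have hσ2 : 3 * β * (|z| / Y) ≤ |z| / 2 := by
    calc 3 * β * (|z| / Y) = 3 * β / Y * |z| := by ring
      _ ≤ 1 / 2 * |z| := by gcongr
      _ = |z| / 2 := by ring
  have hzf : |z - β * f| ≤ |z| + β * |f| := by
    refine (abs_sub _ _).trans_eq ?_
    rw [abs_mul, abs_of_pos hβ]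
  have hσ3 : |s₁ - s₂| ≤ 2 * |z| + β * |f| := by
    have := abs_sub_abs_le_abs_sub (s₁ - s₂) (z - β * f)
    linarith
  refine ⟨?_, ?_, ?_, ?_⟩
  · rw [← mul_sub, ← mul_sub, abs_mul, abs_of_pos hκ]
    have h1 : κ * |Real.exp φ₁ - Real.exp φ₂ - f| ≤ κ * (η * |f|) := by gcongr
    have h2 : κ * (η * |f|) ≤ η * G * |f| := by
      have : κ ≤ G := by rw [hG]; nlinarith [mul_pos hdb hβ]
      calc κ * (η * |f|) = η * κ * |f| := by ring
        _ ≤ _ := by gcongr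
    have h3 : η * G * |f| ≤ μ * |f| := by gcongr
    have h4 : 0 ≤ μ * |z| := by positivity
    linarith
  · have key : phiRate β δ κ y₁ φ₁ s₁ - phiRate β δ κ y₂ φ₂ s₂ - (δ * f - δ / β * z)
        = -(δ / β) * (Real.exp s₁ - Real.exp s₂ - (s₁ - s₂))
          - δ / β * (s₁ - s₂ - (z - β * f))
          + κ * (Real.exp φ₁ * (logDrift y₁ - logDrift y₂))
          + κ * (logDrift y₂ * (Real.exp φ₁ - Real.exp φ₂)) := by
      have : δ * f = δ / β * (β * f) := by field_simp
      rw [this]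
      unfold phiRate
      ring
    have b1 : |-(δ / β) * (Real.exp s₁ - Real.exp s₂ - (s₁ - s₂))|
        ≤ δ / β * (η * (2 * |z| + β * |f|)) := by
      rw [abs_mul, abs_neg, abs_of_pos hdb]; gcongr; exact hes.trans (by gcongr)
    have b2 : |δ / β * (s₁ - s₂ - (z - β * f))| ≤ δ / β * (3 * β * (η * |z|)) := by
      rw [abs_mul, abs_of_pos hdb]; gcongr; exact hσ.trans (by gcongr)
    have b3 : |κ * (Real.exp φ₁ * (logDrift y₁ - logDrift y₂))| ≤ κ * (2 * (5 * (η * |z|))) := by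
      rw [abs_mul, abs_mul, abs_of_pos hκ, Real.abs_exp]
      gcongr; exact hd.trans (by gcongr)
    have b4 : |κ * (logDrift y₂ * (Real.exp φ₁ - Real.exp φ₂))| ≤ κ * (3 * η * (2 * |f|)) := by
      rw [abs_mul, abs_mul, abs_of_pos hκ, abs_of_pos hd2']
      have : |Real.exp φ₁ - Real.exp φ₂| ≤ 2 * |f| := by
        have h1 := abs_sub_abs_le_abs_sub (Real.exp φ₁ - Real.exp φ₂) f
        have h2 : η * |f| ≤ 1 * |f| := by gcongr
        linarith
      gcongr
    rw [key]
    refine (abs_add_le _ _).trans ?_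
    have t1 := abs_add_le (-(δ / β) * (Real.exp s₁ - Real.exp s₂ - (s₁ - s₂))
          - δ / β * (s₁ - s₂ - (z - β * f))) (κ * (Real.exp φ₁ * (logDrift y₁ - logDrift y₂)))
    have t2 := abs_sub (-(δ / β) * (Real.exp s₁ - Real.exp s₂ - (s₁ - s₂)))
          (δ / β * (s₁ - s₂ - (z - β * f)))
    have h3 : η * G * (|z| + |f|) ≤ μ * (|z| + |f|) := by gcongr
    have h4 : δ / β * (η * (2 * |z| + β * |f|)) + δ / β * (3 * β * (η * |z|))
        + κ * (2 * (5 * (η * |z|))) + κ * (3 * η * (2 * |f|)) ≤ η * G * (|z| + |f|) := by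
      have g1 : 0 ≤ δ / β * η * β * |z| := by positivity
      have g2 : 0 ≤ δ / β * η * β * |f| := by positivity
      have g3 : 0 ≤ δ / β * η * |f| := by positivity
      have g4 : 0 ≤ κ * η * |z| := by positivity
      have g5 : 0 ≤ κ * η * |f| := by positivity
      rw [hG]
      linarith
    linarith
  · have h1 : |z| ≤ |s₁ - s₂| + β * |f| + |z| / 2 := by
      have e : z = (s₁ - s₂) + β * f - (s₁ - s₂ - (z - β * f)) := by ring
      have a1 := abs_sub ((s₁ - s₂) + β * f) (s₁ - s₂ - (z - β * f))
      rw [← e] at a1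
      have a2 := abs_add_le (s₁ - s₂) (β * f)
      rw [abs_mul, abs_of_pos hβ] at a2
      linarith
    have hν1 : Real.log (1 + η) ≤ 1 / 2 + 1 / 2 :=
      (Real.log_le_sub_one_of_pos (by linarith)).trans (by linarith)
    have h2 : |s₁ - s₂| ≤ 2 := (abs_sub _ _).trans (by linarith)
    have h3 : |f| ≤ 2 := (abs_sub _ _).trans (by linarith)
    have h4 : β * |f| ≤ β * 2 := by gcongr
    linarith
  · have : 0 ≤ 2 * |f| := by positivity
    have : 0 ≤ β * |z| := by positivity
    linarith

namespace IsNearLinear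

/-- The origin of the limiting linear system is a source, so near-linear pairs decay exponentially
backwards in time. -/
lemma exists_forall_exp_decay {β δ κ : ℝ} (hβ : 0 < β) (hδ : 0 < δ) (hκ : 0 < κ) :
    ∃ μ c C : ℝ, 0 < μ ∧ 0 < c ∧ 0 < C ∧ ∀ (a b : ℝ) (z f z' f' : ℝ → ℝ), a ≤ b →
      IsNearLinear β δ κ μ (Icc a b) z f z' f' →
      z a ^ 2 + f a ^ 2 ≤ C * Real.exp (-c * (b - a)) * (z b ^ 2 + f b ^ 2) := by
  set q := δ / β with hq
  have hq0 : 0 < q := by positivity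
  set m := min κ q with hm
  have hm0 : 0 < m := lt_min hκ hq0
  set θ := min m (κ * δ / (κ + δ ^ 2 / (2 * q))) with hθ
  have hθ0 : 0 < θ := lt_min hm0 (by positivity)
  have hθm : θ ≤ m := min_le_left _ _
  have hθ2 : θ * (κ + δ ^ 2 / (2 * q)) ≤ κ * δ := by
    rw [← le_div_iff₀ (by positivity)]; exact min_le_right _ _
  set c₁ := min (κ * δ) (θ * q / 2) with hc₁
  have hc₁0 : 0 < c₁ := lt_min (by positivity) (by positivity)
  set G := 2 * κ + 2 * q + θ with hG
  have hG0 : 0 < G := by positivity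
  set E := κ + q + θ with hE
  have hE0 : 0 < E := by positivity
  have hmκ : m ≤ κ := min_le_left _ _
  have hmq : m ≤ q := min_le_right _ _
  have hcκ : c₁ ≤ κ * δ := min_le_left _ _
  have hcq : c₁ ≤ θ * q / 2 := min_le_right _ _
  clear_value q m θ c₁
  refine ⟨c₁ / (4 * G), c₁ / (2 * E), 2 * E / m, by positivity, by positivity, by positivity, ?_⟩
  intro a b z f z' f' hab h
  set V : ℝ → ℝ := fun t => κ * f t ^ 2 + q * z t ^ 2 - θ * (z t * f t) with hV
  have hVup : ∀ t, V t ≤ E * (z t ^ 2 + f t ^ 2) := by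
    intro t
    have h1 : 0 ≤ q * f t ^ 2 := by positivity
    have h2 : 0 ≤ κ * z t ^ 2 := by positivity
    have h3 : 0 ≤ θ * ((z t + f t) ^ 2 + z t ^ 2 + f t ^ 2) := by positivity
    simp only [hV, hE]
    linarith
  have hVlo : ∀ t, m / 2 * (z t ^ 2 + f t ^ 2) ≤ V t := by
    intro t
    have h1 := mul_le_mul_of_nonneg_right hmκ (sq_nonneg (f t))
    have h2 := mul_le_mul_of_nonneg_right hmq (sq_nonneg (z t))
    have h3 : 0 ≤ θ * (z t - f t) ^ 2 := by positivity
    have h4 := mul_le_mul_of_nonneg_right hθm (add_nonneg (sq_nonneg (z t)) (sq_nonneg (f t)))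
    simp only [hV]
    linarith
  have hVd : ∀ t ∈ Icc a b, HasDerivAt V (2 * κ * f t * f' t + 2 * q * z t * z' t
      - θ * (z' t * f t + z t * f' t)) t := by
    intro t ht
    have hz := h.hasDerivAt_fst t ht
    have hf := h.hasDerivAt_snd t ht
    refine ((((hf.pow 2).const_mul κ).add ((hz.pow 2).const_mul q)).sub
      ((hz.mul hf).const_mul θ)).congr_deriv ?_
    push_cast
    ring
  have hgrow : ∀ t ∈ Icc a b, c₁ / (2 * E) * V t ≤ 2 * κ * f t * f' t + 2 * q * z t * z' t
      - θ * (z' t * f t + z t * f' t) := by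
    intro t ht
    have h1 := h.abs_fst_le t ht
    have h2 := h.abs_snd_le t ht
    rw [← hq] at h2
    have hV1 : c₁ / (2 * E) * V t ≤ c₁ / 2 * (z t ^ 2 + f t ^ 2) := by
      calc c₁ / (2 * E) * V t ≤ c₁ / (2 * E) * (E * (z t ^ 2 + f t ^ 2)) := by
            gcongr; exact hVup t
        _ = _ := by field_simp
    set e₁ := z' t - κ * f t with he₁
    set e₂ := f' t - (δ * f t - q * z t) with he₂
    set x := z t
    set w := f t
    have r1 : z' t = κ * w + e₁ := by rw [he₁]; ring
    have r2 : f' t = δ * w - q * x + e₂ := by rw [he₂]; ring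
    set ε := c₁ / (4 * G) * (|x| + |w|) with hε
    have hε0 : 0 ≤ ε := by positivity
    have r3 : 2 * κ * w * f' t + 2 * q * x * z' t - θ * (z' t * w + x * f' t)
        = 2 * (κ * δ) * w ^ 2 - θ * κ * w ^ 2 - θ * δ * (x * w) + θ * q * x ^ 2
          + (2 * κ * w - θ * x) * e₂ + (2 * q * x - θ * w) * e₁ := by
      rw [r1, r2]; ring
    have p1 : |(2 * κ * w - θ * x) * e₂| ≤ (2 * κ * |w| + θ * |x|) * ε := by
      rw [abs_mul]
      gcongr
      refine (abs_sub _ _).trans_eq ?_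
      rw [abs_mul, abs_mul, abs_mul, abs_of_pos hκ, abs_of_pos hθ0, abs_two]
    have p2 : |(2 * q * x - θ * w) * e₁| ≤ (2 * q * |x| + θ * |w|) * ε := by
      rw [abs_mul]
      gcongr
      refine (abs_sub _ _).trans_eq ?_
      rw [abs_mul, abs_mul, abs_mul, abs_of_pos hq0, abs_of_pos hθ0, abs_two]
    have p3 : (2 * κ * |w| + θ * |x|) * ε + (2 * q * |x| + θ * |w|) * ε
        ≤ c₁ / 2 * (x ^ 2 + w ^ 2) := by
      have a1 : 2 * κ * |w| + θ * |x| + (2 * q * |x| + θ * |w|) ≤ G * (|x| + |w|) := by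
        have : 0 ≤ 2 * κ * |x| := by positivity
        have : 0 ≤ 2 * q * |w| := by positivity
        rw [hG]; linarith
      calc _ = (2 * κ * |w| + θ * |x| + (2 * q * |x| + θ * |w|)) * ε := by ring
        _ ≤ G * (|x| + |w|) * ε := by gcongr
        _ = c₁ / 4 * (|x| + |w|) ^ 2 := by rw [hε]; field_simp
        _ ≤ c₁ / 4 * (2 * (x ^ 2 + w ^ 2)) := by
            gcongr
            rw [← sq_abs x, ← sq_abs w]
            linarith [sq_nonneg (|x| - |w|)]
        _ = _ := by ring
    have p4 : θ * δ * (x * w) ≤ θ * q / 2 * x ^ 2 + θ * (δ ^ 2 / (2 * q)) * w ^ 2 := by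
      have a1 : θ * q / 2 * x ^ 2 + θ * (δ ^ 2 / (2 * q)) * w ^ 2 - θ * δ * (x * w)
          = θ * ((q * x - δ * w) ^ 2 / (2 * q)) := by field_simp; ring
      have : 0 ≤ θ * ((q * x - δ * w) ^ 2 / (2 * q)) := by positivity
      linarith
    have p5 := mul_le_mul_of_nonneg_right hθ2 (sq_nonneg w)
    have p6 := mul_le_mul_of_nonneg_right hcκ (sq_nonneg w)
    have p7 := mul_le_mul_of_nonneg_right hcq (sq_nonneg x)
    rw [r3]
    linarith [neg_le_of_abs_le p1, neg_le_of_abs_le p2]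
  set c := c₁ / (2 * E) with hc
  have hmono : MonotoneOn (fun t => V t * Real.exp (-c * (t - a))) (Icc a b) := by
    refine monotoneOn_Icc_of_hasDerivAt (f' := fun t => ((2 * κ * f t * f' t + 2 * q * z t * z' t
      - θ * (z' t * f t + z t * f' t)) - c * V t) * Real.exp (-c * (t - a)))
      (fun t ht => ?_) (fun t ht => ?_)
    · have e : HasDerivAt (fun t => Real.exp (-c * (t - a)))
          (Real.exp (-c * (t - a)) * (-c * 1)) t :=
        (((hasDerivAt_id t).sub_const a).const_mul (-c)).exp
      exact ((hVd t ht).mul e).congr_deriv (by ring)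
    · exact mul_nonneg (by linarith [hgrow t ht]) (Real.exp_pos _).le
  have h1 := hmono (left_mem_Icc.2 hab) (right_mem_Icc.2 hab) hab
  simp only [sub_self, mul_zero, Real.exp_zero, mul_one] at h1
  have h2 := hVlo a
  have h3 := mul_le_mul_of_nonneg_right (hVup b) (Real.exp_pos (-c * (b - a))).le
  have h4 : m / 2 * (z a ^ 2 + f a ^ 2)
      ≤ E * (z b ^ 2 + f b ^ 2) * Real.exp (-c * (b - a)) := by linarith
  calc z a ^ 2 + f a ^ 2 = 2 / m * (m / 2 * (z a ^ 2 + f a ^ 2)) := by field_simp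
    _ ≤ 2 / m * (E * (z b ^ 2 + f b ^ 2) * Real.exp (-c * (b - a))) := by gcongr
    _ = _ := by ring

/-- Oscillation: if the limiting linear system is a spiral, the first component of a near-linear
pair vanishes on every interval of a fixed length. The angle of `(z, f)` turns at a rate bounded
below; it is measured by `arctan (f / z)` as long as `z` does not vanish. -/
lemma exists_forall_exists_eq_zero {β δ κ : ℝ} (hβ : 0 < β) (hδ : 0 < δ) (hκ : 0 < κ)
    (hosc : δ ^ 2 < 4 * (κ * (δ / β))) :
    ∃ μ ℓ : ℝ, 0 < μ ∧ 0 < ℓ ∧ ∀ (a : ℝ) (z f z' f' : ℝ → ℝ),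
      IsNearLinear β δ κ μ (Icc a (a + ℓ)) z f z' f' → ∃ t ∈ Icc a (a + ℓ), z t = 0 := by
  set q := δ / β with hq
  have hq0 : 0 < q := by positivity
  set c := (κ * q - δ ^ 2 / 4) / (κ + q) with hc
  have hc0 : 0 < c := div_pos (by linarith) (by positivity)
  have hcdef : c * (κ + q) = κ * q - δ ^ 2 / 4 := by rw [hc]; field_simp
  have hcκ : c < κ := by
    rw [hc, div_lt_iff₀ (by positivity)]
    nlinarith [sq_pos_of_pos hδ, sq_pos_of_pos hκ]
  clear_value q c
  refine ⟨c / 4, 2 * Real.pi / c, by positivity, by positivity, ?_⟩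
  intro a z f z' f' h
  set b := a + 2 * Real.pi / c with hb
  have hab : a ≤ b := by
    have : 0 < 2 * Real.pi / c := by positivity
    linarith
  by_contra! hne
  set ρ : ℝ → ℝ := fun t => f t / z t with hρ
  have hd : ∀ t ∈ Icc a b, HasDerivAt (fun t => -Real.arctan (ρ t))
      (-(1 / (1 + ρ t ^ 2) * ((f' t * z t - f t * z' t) / z t ^ 2))) t := fun t ht =>
    (((h.hasDerivAt_snd t ht).div (h.hasDerivAt_fst t ht) (hne t ht)).arctan).neg
  have hrate : ∀ t ∈ Icc a b,
      c / 2 ≤ -(1 / (1 + ρ t ^ 2) * ((f' t * z t - f t * z' t) / z t ^ 2)) := by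
    intro t ht
    have hz := hne t ht
    have h1 := h.abs_fst_le t ht
    have h2 := h.abs_snd_le t ht
    rw [← hq] at h2
    set e₁ := z' t - κ * f t with he₁
    set e₂ := f' t - (δ * f t - q * z t) with he₂
    have r1 : z' t = κ * f t + e₁ := by rw [he₁]; ring
    have r2 : f' t = δ * f t - q * z t + e₂ := by rw [he₂]; ring
    have p1 : f' t * z t - f t * z' t ≤ -(c / 2) * (z t ^ 2 + f t ^ 2) := by
      rw [r1, r2]
      have a1 : e₂ * z t - f t * e₁ ≤ c / 4 * (|z t| + |f t|) ^ 2 := by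
        have b1 : e₂ * z t ≤ c / 4 * (|z t| + |f t|) * |z t| :=
          (le_abs_self _).trans (by rw [abs_mul]; gcongr)
        have b2 : -(f t * e₁) ≤ |f t| * (c / 4 * (|z t| + |f t|)) :=
          (neg_le_abs _).trans (by rw [abs_mul]; gcongr)
        linarith
      have a2 : c / 4 * (|z t| + |f t|) ^ 2 ≤ c / 4 * (2 * (z t ^ 2 + f t ^ 2)) := by
        gcongr
        rw [← sq_abs (z t), ← sq_abs (f t)]
        linarith [sq_nonneg (|z t| - |f t|)]
      -- `c` is at most the least eigenvalue of the form `κ f² - δ f z + q z²`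
      have a3 : c * (z t ^ 2 + f t ^ 2) ≤ κ * f t ^ 2 - δ * f t * z t + q * z t ^ 2 := by
        have b1 : 0 ≤ (κ - c) * (κ * f t ^ 2 - δ * f t * z t + q * z t ^ 2
            - c * (z t ^ 2 + f t ^ 2)) := by
          have : (κ - c) * (κ * f t ^ 2 - δ * f t * z t + q * z t ^ 2
              - c * (z t ^ 2 + f t ^ 2)) = ((κ - c) * f t - δ / 2 * z t) ^ 2
              + (κ * q - δ ^ 2 / 4 - c * (κ + q) + c ^ 2) * z t ^ 2 := by ring
          rw [this, hcdef]
          have : 0 ≤ (κ * q - δ ^ 2 / 4 - (κ * q - δ ^ 2 / 4) + c ^ 2) * z t ^ 2 := by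
            apply mul_nonneg _ (sq_nonneg _)
            linarith [sq_nonneg c]
          positivity
        have := nonneg_of_mul_nonneg_right b1 (by linarith)
        linarith
      linarith
    have hz2 : 0 < z t ^ 2 := by positivity
    have e : 1 / (1 + ρ t ^ 2) * ((f' t * z t - f t * z' t) / z t ^ 2)
        = (f' t * z t - f t * z' t) / (z t ^ 2 + f t ^ 2) := by
      simp only [hρ]
      have : z t ^ 2 + f t ^ 2 ≠ 0 := by positivity
      field_simp
    rw [e, ← neg_div, le_div_iff₀ (by positivity)]
    linarith
  have hmono : MonotoneOn (fun t => -Real.arctan (ρ t) - c / 2 * t) (Icc a b) :=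
    monotoneOn_Icc_of_hasDerivAt
      (fun t ht => ((hd t ht).sub ((hasDerivAt_id t).const_mul (c / 2))))
      (fun t ht => by linarith [hrate t ht])
  have h1 := hmono (left_mem_Icc.2 hab) (right_mem_Icc.2 hab) hab
  simp only [] at h1
  have h2 : c / 2 * b = c / 2 * a + Real.pi := by rw [hb]; field_simp
  linarith [Real.arctan_lt_pi_div_two (ρ a), Real.neg_pi_div_two_lt_arctan (ρ b),
    Real.neg_pi_div_two_lt_arctan (ρ a), Real.arctan_lt_pi_div_two (ρ b)]

end IsNearLinear

/-! ### The radial equation, the flux and the logarithmic variables -/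

/-- The radial equation with right-hand side `1 / f(u) = exp (e^{1/u})` as a first-order system
for `u` and the flux `w = r^α |u'|^{β-1} u'`, in the case of a positive flux. -/
structure IsFluxSystem (α β γ r₀ : ℝ) (u w : ℝ → ℝ) : Prop where
  u_pos : ∀ r ∈ Ioo 0 r₀, 0 < u r
  w_pos : ∀ r ∈ Ioo 0 r₀, 0 < w r
  hasDerivAt_u : ∀ r ∈ Ioo 0 r₀, HasDerivAt u ((r ^ (-α) * w r) ^ (1 / β)) r
  hasDerivAt_w : ∀ r ∈ Ioo 0 r₀,
    HasDerivAt w (r ^ (γ - 1) * Real.exp (Real.exp (1 / u r))) r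

lemma one_div_ruptureNonlinearity {u : ℝ} (hu : 0 < u) :
    1 / ruptureNonlinearity u = Real.exp (Real.exp (1 / u)) := by
  rw [ruptureNonlinearity, if_pos hu, Real.exp_neg]
  simp

/-- A function with `v' ≥ m / r`, `m > 0`, is unbounded near `0`. -/
lemma false_of_div_le_deriv {v v' : ℝ → ℝ} {r₁ m B : ℝ} (hr₁ : 0 < r₁) (hm : 0 < m)
    (hd : ∀ r ∈ Ioo 0 r₁, HasDerivAt v (v' r) r) (hv' : ∀ r ∈ Ioo 0 r₁, m / r ≤ v' r)
    (hB : ∀ r ∈ Ioo 0 r₁, |v r| ≤ B) : False := by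
  have hmono : MonotoneOn (fun t => -v (Real.exp (-t)) - m * t) (Ici (-Real.log (r₁ / 2))) := by
    have hin : ∀ t, -Real.log (r₁ / 2) ≤ t → Real.exp (-t) ∈ Ioo 0 r₁ := fun t ht => by
      refine ⟨Real.exp_pos _, ?_⟩
      have : Real.exp (-t) ≤ r₁ / 2 := by
        rw [← Real.le_log_iff_exp_le (by positivity)]; linarith
      linarith
    refine monotoneOn_Ici_of_hasDerivAt (f' := fun t => v' (Real.exp (-t)) * Real.exp (-t) - m)
      (fun t ht => ?_) (fun t ht => ?_)
    · have e : HasDerivAt (fun t => Real.exp (-t)) (Real.exp (-t) * (-1)) t :=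
        (hasDerivAt_id t).neg.exp
      exact (((hd _ (hin t ht)).comp t e).neg.sub
        ((hasDerivAt_id t).const_mul m)).congr_deriv (by ring)
    · have h1 := hv' _ (hin t ht)
      rw [div_le_iff₀ (Real.exp_pos _)] at h1
      linarith
  set a := -Real.log (r₁ / 2) with ha
  have hb : a ≤ a + (2 * |B| + 1) / m := by
    have : 0 < (2 * |B| + 1) / m := by positivity
    linarith
  have h1 := hmono (mem_Ici.2 le_rfl) (mem_Ici.2 hb) hb
  have hin : ∀ t, a ≤ t → |v (Real.exp (-t))| ≤ B := fun t ht => by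
    refine hB _ ⟨Real.exp_pos _, ?_⟩
    have : Real.exp (-t) ≤ r₁ / 2 := by
      rw [← Real.le_log_iff_exp_le (by positivity)]; linarith
    linarith
  have h2 := abs_le.1 (hin a le_rfl)
  have h3 := abs_le.1 (hin _ hb)
  have h4 : m * (a + (2 * |B| + 1) / m) = m * a + (2 * |B| + 1) := by field_simp
  simp only [h4] at h1
  linarith [le_abs_self B]

lemma rpow_div_le_of_flux {α β r k v : ℝ} (hβ : 0 < β) (hαβ : β ≤ α) (hr : 0 < r) (hr1 : r ≤ 1)
    (hk : 0 < k) (hv : 0 ≤ v) (h : k ≤ r ^ α * v ^ β) : k ^ (1 / β) / r ≤ v := by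
  rw [← Real.rpow_le_rpow_iff (by positivity) hv hβ, Real.div_rpow (by positivity) hr.le,
    ← Real.rpow_mul hk.le, one_div_mul_cancel hβ.ne', Real.rpow_one, div_le_iff₀ (by positivity)]
  refine h.trans ?_
  rw [mul_comm]
  gcongr ?_ * ?_
  exact Real.rpow_le_rpow_of_exponent_ge hr hr1 hαβ

namespace IsRadialSolution

variable {α β γ r₀ c : ℝ} {u : ℝ → ℝ}

lemma hasDerivAt_deriv (h : IsRadialSolution α β γ ruptureNonlinearity r₀ c u) {r : ℝ}
    (hr : r ∈ Ioo 0 r₀) : HasDerivAt u (deriv u r) r :=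
  ((h.contDiffOn.differentiableOn (by norm_num)).differentiableAt
    (isOpen_Ioo.mem_nhds hr)).hasDerivAt

lemma hasDerivAt_flux (h : IsRadialSolution α β γ ruptureNonlinearity r₀ c u) {r : ℝ}
    (hr : r ∈ Ioo 0 r₀) :
    HasDerivAt (fun s : ℝ => s ^ α * |deriv u s| ^ (β - 1) * deriv u s)
      (r ^ (γ - 1) * Real.exp (Real.exp (1 / u r))) r := by
  have h1 := (h.flux_differentiable r hr).hasDerivAt
  have h2 := h.equation r hr
  rw [one_div_ruptureNonlinearity (h.pos r hr)] at h2
  refine h1.congr_deriv ?_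
  rw [← h2, ← mul_assoc, ← Real.rpow_add hr.1]
  simp

lemma strictMonoOn_flux (h : IsRadialSolution α β γ ruptureNonlinearity r₀ c u) :
    StrictMonoOn (fun s : ℝ => s ^ α * |deriv u s| ^ (β - 1) * deriv u s) (Ioo 0 r₀) := by
  refine strictMonoOn_of_deriv_pos (convex_Ioo 0 r₀)
    (fun r hr => (h.hasDerivAt_flux hr).continuousAt.continuousWithinAt) (fun r hr => ?_)
  rw [interior_Ioo] at hr
  rw [(h.hasDerivAt_flux hr).deriv]
  have := hr.1
  positivity

lemma exists_bound (h : IsRadialSolution α β γ ruptureNonlinearity r₀ c u) (hr₀ : 0 < r₀) :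
    ∃ r₁ B, 0 < r₁ ∧ ∀ r ∈ Ioo 0 r₁, |u r| ≤ B := by
  have h1 : ContinuousWithinAt u (Ico 0 r₀) 0 := h.continuousOn 0 ⟨le_rfl, hr₀⟩
  have h2 : ∀ᶠ x in 𝓝[Ico 0 r₀] 0, |u x| < |u 0| + 1 :=
    h1.abs.eventually_lt_const (by linarith)
  have h3 : 𝓝[>] (0:ℝ) ≤ 𝓝[Ico 0 r₀] 0 := by
    rw [← nhdsWithin_Ioo_eq_nhdsGT hr₀]
    exact nhdsWithin_mono _ Ioo_subset_Ico_self
  obtain ⟨r₁, hr₁, h4⟩ := mem_nhdsGT_iff_exists_Ioo_subset.1 (h3 h2)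
  exact ⟨r₁, |u 0| + 1, hr₁, fun r hr => (show |u r| < _ from h4 hr).le⟩

lemma abs_flux {r v : ℝ} (hβ : 0 < β) (hr : 0 < r) :
    |r ^ α * |v| ^ (β - 1) * v| = r ^ α * |v| ^ β := by
  rw [abs_mul, abs_mul, abs_of_pos (Real.rpow_pos_of_pos hr α),
    abs_of_nonneg (Real.rpow_nonneg (abs_nonneg v) _), mul_assoc]
  congr 1
  rcases (abs_nonneg v).eq_or_lt with h | h
  · rw [← h, mul_zero, Real.zero_rpow hβ.ne']
  · rw [← Real.rpow_add_one h.ne', sub_add_cancel]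

/-- The flux is positive: if it were bounded away from `0` near the origin, then `|u'| ≥ m / r`
there, and `u` would be unbounded. -/
lemma flux_pos (h : IsRadialSolution α β γ ruptureNonlinearity r₀ c u) (hβ : 0 < β)
    (hαβ : β ≤ α) {r : ℝ} (hr : r ∈ Ioo 0 r₀) : 0 < r ^ α * |deriv u r| ^ (β - 1) * deriv u r := by
  set w : ℝ → ℝ := fun s => s ^ α * |deriv u s| ^ (β - 1) * deriv u s with hw
  have hmono := h.strictMonoOn_flux
  by_contra! hneg
  have hr2 : r / 2 ∈ Ioo 0 r₀ := ⟨by linarith [hr.1], by linarith [hr.1, hr.2]⟩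
  have hlt : w (r / 2) < 0 := (hmono hr2 hr (by linarith [hr.1])).trans_le hneg
  obtain ⟨r₁, B, hr₁, hB⟩ := h.exists_bound (hr.1.trans hr.2)
  set ρ := min r₁ (min (r / 2) 1)
  have hρ : 0 < ρ := lt_min hr₁ (lt_min hr2.1 one_pos)
  have hρ2 : ∀ x ∈ Ioo 0 ρ, x ∈ Ioo 0 r₀ ∧ x < r / 2 ∧ x ≤ 1 ∧ x ∈ Ioo 0 r₁ := by
    intro x hx
    have h1 : ρ ≤ r₁ := min_le_left _ _
    have h2 : ρ ≤ r / 2 := (min_le_right _ _).trans (min_le_left _ _)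
    have h3 : ρ ≤ 1 := (min_le_right _ _).trans (min_le_right _ _)
    exact ⟨⟨hx.1, by linarith [hx.2, hr2.2]⟩, by linarith [hx.2], by linarith [hx.2],
      ⟨hx.1, by linarith [hx.2]⟩⟩
  refine false_of_div_le_deriv (v := fun x => -u x) (v' := fun x => -deriv u x)
    (m := (-w (r / 2)) ^ (1 / β)) (B := B) hρ (Real.rpow_pos_of_pos (by linarith) _)
    (fun x hx => (h.hasDerivAt_deriv (hρ2 x hx).1).neg) (fun x hx => ?_)
    (fun x hx => by rw [abs_neg]; exact hB x (hρ2 x hx).2.2.2)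
  obtain ⟨hx0, hx2, hx1, -⟩ := hρ2 x hx
  have hwx : w x < w (r / 2) := hmono hx0 hr2 hx2
  have hdneg : deriv u x < 0 := by
    by_contra! hge
    have : 0 ≤ w x := by
      have := Real.rpow_nonneg hx.1.le α
      simp only [hw]; positivity
    linarith
  rw [← abs_of_neg hdneg]
  refine rpow_div_le_of_flux hβ hαβ hx.1 hx1 (by linarith) (abs_nonneg _) ?_
  rw [← abs_flux hβ hx.1]
  exact (by linarith : -w (r / 2) ≤ -w x).trans (neg_le_abs _)

lemma deriv_pos (h : IsRadialSolution α β γ ruptureNonlinearity r₀ c u) (hβ : 0 < β)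
    (hαβ : β ≤ α) {r : ℝ} (hr : r ∈ Ioo 0 r₀) : 0 < deriv u r := by
  have h1 := h.flux_pos hβ hαβ hr
  have : 0 ≤ r ^ α * |deriv u r| ^ (β - 1) :=
    mul_nonneg (Real.rpow_nonneg hr.1.le _) (Real.rpow_nonneg (abs_nonneg _) _)
  exact pos_of_mul_pos_right h1 this

lemma isFluxSystem (h : IsRadialSolution α β γ ruptureNonlinearity r₀ c u) (hβ : 0 < β)
    (hαβ : β ≤ α) :
    IsFluxSystem α β γ r₀ u (fun s : ℝ => s ^ α * |deriv u s| ^ (β - 1) * deriv u s) where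
  u_pos := h.pos
  w_pos r hr := h.flux_pos hβ hαβ hr
  hasDerivAt_w r hr := h.hasDerivAt_flux hr
  hasDerivAt_u r hr := by
    refine (h.hasDerivAt_deriv hr).congr_deriv ?_
    have h1 := h.deriv_pos hβ hαβ hr
    rw [abs_of_pos h1, mul_assoc, ← Real.rpow_add_one h1.ne', sub_add_cancel, ← mul_assoc,
      ← Real.rpow_add hr.1, neg_add_cancel, Real.rpow_zero, one_mul, ← Real.rpow_mul h1.le,
      mul_one_div_cancel hβ.ne', Real.rpow_one]

lemma tendsto_flux (h : IsRadialSolution α β γ ruptureNonlinearity r₀ c u) (hr₀ : 0 < r₀)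
    (hβ : 0 < β) (hαβ : β ≤ α) :
    Tendsto (fun s : ℝ => s ^ α * |deriv u s| ^ (β - 1) * deriv u s) (𝓝[>] 0) (𝓝 0) := by
  set w : ℝ → ℝ := fun s => s ^ α * |deriv u s| ^ (β - 1) * deriv u s with hw
  have hpos : ∀ᶠ x in 𝓝[>] (0 : ℝ), x ∈ Ioo 0 r₀ := Ioo_mem_nhdsGT hr₀
  refine tendsto_order.2 ⟨fun b hb => ?_, fun b hb => ?_⟩
  · filter_upwards [hpos] with x hx using hb.trans (h.flux_pos hβ hαβ hx)
  · suffices ∃ x ∈ Ioo 0 r₀, w x < b by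
      obtain ⟨x, hx, hxb⟩ := this
      filter_upwards [Ioo_mem_nhdsGT hx.1] with x' hx'
      exact (h.strictMonoOn_flux ⟨hx'.1, hx'.2.trans hx.2⟩ hx hx'.2).trans hxb
    by_contra! hge
    obtain ⟨r₁, B, hr₁, hB⟩ := h.exists_bound hr₀
    set ρ := min r₁ (min r₀ 1)
    have hρ : 0 < ρ := lt_min hr₁ (lt_min hr₀ one_pos)
    have hρ2 : ∀ x ∈ Ioo 0 ρ, x ∈ Ioo 0 r₀ ∧ x ≤ 1 ∧ x ∈ Ioo 0 r₁ := by
      intro x hx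
      have h1 : ρ ≤ r₁ := min_le_left _ _
      have h2 : ρ ≤ r₀ := (min_le_right _ _).trans (min_le_left _ _)
      have h3 : ρ ≤ 1 := (min_le_right _ _).trans (min_le_right _ _)
      exact ⟨⟨hx.1, by linarith [hx.2]⟩, by linarith [hx.2], ⟨hx.1, by linarith [hx.2]⟩⟩
    refine false_of_div_le_deriv (m := b ^ (1 / β)) (B := B) hρ (Real.rpow_pos_of_pos hb _)
      (fun x hx => h.hasDerivAt_deriv (hρ2 x hx).1) (fun x hx => ?_)
      (fun x hx => hB x (hρ2 x hx).2.2)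
    rw [← abs_of_pos (h.deriv_pos hβ hαβ (hρ2 x hx).1)]
    refine rpow_div_le_of_flux hβ hαβ hx.1 (hρ2 x hx).2.1 hb (abs_nonneg _) ?_
    rw [← abs_flux hβ hx.1]
    exact (hge x (hρ2 x hx).1).trans (le_abs_self _)

lemma monotoneOn (h : IsRadialSolution α β γ ruptureNonlinearity r₀ c u) (hβ : 0 < β)
    (hαβ : β ≤ α) : MonotoneOn u (Ico 0 r₀) := by
  refine monotoneOn_of_deriv_nonneg (convex_Ico 0 r₀) h.continuousOn ?_ ?_
  · rw [interior_Ico]; exact h.contDiffOn.differentiableOn (by norm_num)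
  · rw [interior_Ico]; exact fun r hr => (h.deriv_pos hβ hαβ hr).le

end IsRadialSolution

lemma IsFluxSystem.isRadialSolution {α β γ r₀ : ℝ} {u w : ℝ → ℝ}
    (h : IsFluxSystem α β γ r₀ u w) (hβ : 0 < β) (hc : ContinuousOn u (Ico 0 r₀)) :
    IsRadialSolution α β γ ruptureNonlinearity r₀ (u 0) u := by
  have hu' : ∀ r ∈ Ioo 0 r₀, 0 < r ^ (-α) * w r := fun r hr =>
    mul_pos (Real.rpow_pos_of_pos hr.1 _) (h.w_pos r hr)
  have hflux : ∀ r ∈ Ioo 0 r₀, r ^ α * |deriv u r| ^ (β - 1) * deriv u r = w r := by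
    intro r hr
    have h1 : 0 < (r ^ (-α) * w r) ^ (1 / β) := Real.rpow_pos_of_pos (hu' r hr) _
    rw [(h.hasDerivAt_u r hr).deriv, abs_of_pos h1, mul_assoc, ← Real.rpow_add_one h1.ne',
      sub_add_cancel, ← Real.rpow_mul (hu' r hr).le, one_div_mul_cancel hβ.ne', Real.rpow_one,
      ← mul_assoc, ← Real.rpow_add hr.1, add_neg_cancel, Real.rpow_zero, one_mul]
  have hev : ∀ r ∈ Ioo 0 r₀,
      (fun s : ℝ => s ^ α * |deriv u s| ^ (β - 1) * deriv u s) =ᶠ[𝓝 r] w := fun r hr => by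
    filter_upwards [isOpen_Ioo.mem_nhds hr] with s hs using hflux s hs
  have hud : DifferentiableOn ℝ u (Ioo 0 r₀) := fun r hr =>
    (h.hasDerivAt_u r hr).differentiableAt.differentiableWithinAt
  have hid : ∀ p : ℝ, ContDiffOn ℝ 1 (fun r : ℝ => r ^ p) (Ioo 0 r₀) := fun p =>
    contDiffOn_id.rpow_const_of_ne fun r hr => hr.1.ne'
  have hwC : ContDiffOn ℝ 1 w (Ioo 0 r₀) := by
    rw [show (1 : WithTop ℕ∞) = 0 + 1 by rfl, contDiffOn_succ_iff_deriv_of_isOpen isOpen_Ioo]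
    refine ⟨fun r hr => (h.hasDerivAt_w r hr).differentiableAt.differentiableWithinAt,
      by simp, ?_⟩
    rw [contDiffOn_zero]
    refine ContinuousOn.congr (f := fun r => r ^ (γ - 1) * Real.exp (Real.exp (1 / u r))) ?_
      fun r hr => (h.hasDerivAt_w r hr).deriv
    refine (hid _).continuousOn.mul (ContinuousOn.rexp (ContinuousOn.rexp ?_))
    exact continuousOn_const.div hud.continuousOn fun r hr => (h.u_pos r hr).ne'
  refine ⟨?_, hc, fun r hr => ?_, fun r hr => ?_, h.u_pos, rfl⟩
  · rw [show (2 : WithTop ℕ∞) = 1 + 1 by norm_num,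
      contDiffOn_succ_iff_deriv_of_isOpen isOpen_Ioo]
    refine ⟨hud, by simp, ?_⟩
    refine ContDiffOn.congr (f := fun r => (r ^ (-α) * w r) ^ (1 / β)) ?_
      fun r hr => (h.hasDerivAt_u r hr).deriv
    exact ((hid _).mul hwC).rpow_const_of_ne fun r hr => (hu' r hr).ne'
  · exact (hev r hr).differentiableAt_iff.2 (h.hasDerivAt_w r hr).differentiableAt
  · rw [(hev r hr).deriv_eq, (h.hasDerivAt_w r hr).deriv,
      one_div_ruptureNonlinearity (h.u_pos r hr), ← mul_assoc, ← Real.rpow_add hr.1]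
    simp

/-- `log (r u')` in the logarithmic variables. -/
noncomputable def logSpeed (κ : ℝ) (y φ : ℝ → ℝ) (t : ℝ) : ℝ :=
  φ t + Real.log κ - Real.log (y t) - 2 * Real.log (Real.log (y t))

namespace IsLogTrajectory

variable {β δ κ t₀ : ℝ} {y φ s : ℝ → ℝ}

lemma hasDerivAt_logSpeed (h : IsLogTrajectory β δ κ t₀ y φ s) {t : ℝ} (ht : t₀ < t) :
    HasDerivAt (logSpeed κ y φ) (δ / β * (1 - Real.exp (s t))) t := by
  have h1 := h.one_lt t ht
  have h2 := Real.log_pos h1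
  have hy := h.hasDerivAt_y t ht
  have hly := hy.log (by linarith)
  refine ((((h.hasDerivAt_phi t ht).add_const (Real.log κ)).sub hly).sub
    ((hly.log h2.ne').const_mul 2)).congr_deriv ?_
  unfold logDrift
  have : y t ≠ 0 := by linarith
  field_simp
  ring

lemma exp_logSpeed (h : IsLogTrajectory β δ κ t₀ y φ s) (hκ : 0 < κ) {t : ℝ} (ht : t₀ < t) :
    Real.exp (logSpeed κ y φ t) = κ * Real.exp (φ t) / (y t * Real.log (y t) ^ 2) := by
  have h1 := h.one_lt t ht
  have h2 := Real.log_pos h1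
  have h3 : 2 * Real.log (Real.log (y t)) = Real.log (Real.log (y t) ^ 2) := by
    rw [Real.log_pow]; norm_num
  unfold logSpeed
  rw [h3, Real.exp_sub, Real.exp_sub, Real.exp_add, Real.exp_log hκ, Real.exp_log (by linarith),
    Real.exp_log (by positivity)]
  field_simp

lemma lt_neg_log {r : ℝ} (hr : r ∈ Ioo 0 (Real.exp (-t₀))) : t₀ < -Real.log r := by
  have := Real.log_lt_log hr.1 hr.2
  rw [Real.log_exp] at this
  linarith

lemma hasDerivAt_inv_log (h : IsLogTrajectory β δ κ t₀ y φ s) (hκ : 0 < κ) {r : ℝ}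
    (hr : r ∈ Ioo 0 (Real.exp (-t₀))) :
    HasDerivAt (fun r => 1 / Real.log (y (-Real.log r)))
      (Real.exp (logSpeed κ y φ (-Real.log r)) / r) r := by
  have ht := lt_neg_log hr
  have hr0 := hr.1
  have h1 := h.one_lt _ ht
  have h2 := Real.log_pos h1
  have hl : HasDerivAt (fun r => -Real.log r) (-r⁻¹) r := (Real.hasDerivAt_log hr0.ne').neg
  have hy := (h.hasDerivAt_y _ ht).comp r hl
  have h3 := (hy.log (by simp only [Function.comp_apply]; linarith)).inv h2.ne'
  have h4 : (fun r => 1 / Real.log (y (-Real.log r)))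
      = (fun r => Real.log ((y ∘ fun r => -Real.log r) r))⁻¹ := by
    ext x; simp
  rw [h4]
  refine h3.congr_deriv ?_
  rw [h.exp_logSpeed hκ ht]
  simp only [Function.comp_apply]
  have : y (-Real.log r) ≠ 0 := by linarith
  field_simp

lemma hasDerivAt_exp_logSpeed_div (h : IsLogTrajectory β δ κ t₀ y φ s) {r : ℝ}
    (hr : r ∈ Ioo 0 (Real.exp (-t₀))) :
    HasDerivAt (fun r => Real.exp (logSpeed κ y φ (-Real.log r)) / r)
      (-(Real.exp (logSpeed κ y φ (-Real.log r)) / r ^ 2)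
        * (1 + δ / β * (1 - Real.exp (s (-Real.log r))))) r := by
  have ht := lt_neg_log hr
  have hr0 := hr.1
  have hl : HasDerivAt (fun r => -Real.log r) (-r⁻¹) r := (Real.hasDerivAt_log hr0.ne').neg
  have h1 := ((h.hasDerivAt_logSpeed ht).comp r hl).exp
  refine (h1.div (hasDerivAt_id r) hr0.ne').congr_deriv ?_
  simp only [Function.comp_apply, id]
  field_simp
  ring

lemma isFluxSystem {α γ : ℝ} (h : IsLogTrajectory β δ κ t₀ y φ s) (hβ : 0 < β) (hκ : 0 < κ)
    (hδ : 0 < δ) (hαδ : α = δ + β) (hγ : γ = κ + δ) :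
    IsFluxSystem α β γ (Real.exp (-t₀)) (fun r => 1 / Real.log (y (-Real.log r)))
      (fun r => Real.exp (β * logSpeed κ y φ (-Real.log r) + δ * Real.log r)) where
  u_pos r hr := one_div_pos.2 (Real.log_pos (h.one_lt _ (lt_neg_log hr)))
  w_pos r hr := Real.exp_pos _
  hasDerivAt_u r hr := by
    refine (h.hasDerivAt_inv_log hκ hr).congr_deriv ?_
    have hr0 := hr.1
    rw [Real.rpow_def_of_pos hr0, ← Real.exp_add, ← Real.exp_mul]
    nth_rewrite 2 [← Real.exp_log hr0]
    rw [← Real.exp_sub, hαδ]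
    congr 1
    field_simp
    ring
  hasDerivAt_w r hr := by
    have ht := lt_neg_log hr
    have hr0 := hr.1
    have hl : HasDerivAt (fun r => -Real.log r) (-r⁻¹) r := (Real.hasDerivAt_log hr0.ne').neg
    have h1 := h.one_lt _ ht
    refine ((((h.hasDerivAt_logSpeed ht).comp r hl).const_mul β).add
      ((Real.hasDerivAt_log hr0.ne').const_mul δ)).exp.congr_deriv ?_
    change Real.exp (β * logSpeed κ y φ (-Real.log r) + δ * Real.log r) * _ = _
    have e1 : β * (δ / β * (1 - Real.exp (s (-Real.log r))) * -r⁻¹) + δ * r⁻¹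
        = δ * Real.exp (s (-Real.log r)) / r := by field_simp; ring
    rw [e1, one_div_one_div, Real.exp_log (by linarith : 0 < y (-Real.log r)),
      Real.rpow_def_of_pos hr0]
    have e2 : δ * Real.exp (s (-Real.log r)) / r
        = Real.exp (Real.log δ + s (-Real.log r) - Real.log r) := by
      rw [Real.exp_sub, Real.exp_add, Real.exp_log hδ, Real.exp_log hr0]
    rw [e2, ← Real.exp_add, ← Real.exp_add, h.rel _ ht, hγ]
    congr 1
    unfold logSpeed
    ring

end IsLogTrajectory

lemma IsFluxSystem.exists_isLogTrajectory {α β γ δ κ t₀ : ℝ} {u w : ℝ → ℝ}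
    (h : IsFluxSystem α β γ (Real.exp (-t₀)) u w) (hβ : 0 < β) (hκ : 0 < κ) (hδ : 0 < δ)
    (hαδ : α = δ + β) (hγ : γ = κ + δ) :
    ∃ φ s, IsLogTrajectory β δ κ t₀ (fun t => Real.exp (1 / u (Real.exp (-t)))) φ s := by
  set y : ℝ → ℝ := fun t => Real.exp (1 / u (Real.exp (-t))) with hy
  set q : ℝ → ℝ := fun t => (Real.log (w (Real.exp (-t))) + δ * t) / β with hq
  set φ : ℝ → ℝ := fun t => q t + 1 / u (Real.exp (-t)) + 2 * Real.log (1 / u (Real.exp (-t)))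
    - Real.log κ with hφ
  set s : ℝ → ℝ := fun t => y t - κ * t - β * q t - Real.log δ with hs
  have hin : ∀ t, t₀ < t → Real.exp (-t) ∈ Ioo 0 (Real.exp (-t₀)) := fun t ht =>
    ⟨Real.exp_pos _, Real.exp_lt_exp.2 (by linarith)⟩
  have he : ∀ t : ℝ, HasDerivAt (fun t => Real.exp (-t)) (Real.exp (-t) * (-1)) t := fun t =>
    (hasDerivAt_id t).neg.exp
  have hlogy : ∀ t, Real.log (y t) = 1 / u (Real.exp (-t)) := fun t => Real.log_exp _
  have hexpφ : ∀ t, t₀ < t → κ * Real.exp (φ t)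
      = Real.exp (q t) * y t * (1 / u (Real.exp (-t))) ^ 2 := by
    intro t ht
    have hu := h.u_pos _ (hin t ht)
    have h3 : 2 * Real.log (1 / u (Real.exp (-t))) = Real.log ((1 / u (Real.exp (-t))) ^ 2) := by
      rw [Real.log_pow]; norm_num
    simp only [hφ]
    rw [h3, Real.exp_sub, Real.exp_add, Real.exp_add, Real.exp_log hκ,
      Real.exp_log (by positivity)]
    field_simp
    rfl
  have hU : ∀ t, t₀ < t →
      HasDerivAt (fun t => 1 / u (Real.exp (-t)))
        (Real.exp (q t) * (1 / u (Real.exp (-t))) ^ 2) t := by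
    intro t ht
    have hu := h.u_pos _ (hin t ht)
    have hw := h.w_pos _ (hin t ht)
    have h1 := (h.hasDerivAt_u _ (hin t ht)).comp t (he t)
    have h2 := h1.inv hu.ne'
    have e : (fun t => 1 / u (Real.exp (-t))) = (u ∘ fun t => Real.exp (-t))⁻¹ := by
      ext x; simp
    rw [e]
    refine h2.congr_deriv ?_
    have e2 : (Real.exp (-t) ^ (-α) * w (Real.exp (-t))) ^ (1 / β) * (Real.exp (-t) * -1)
        = -Real.exp (q t) := by
      rw [← Real.exp_mul]
      nth_rewrite 1 [← Real.exp_log hw]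
      rw [← Real.exp_add, ← Real.exp_mul, ← mul_assoc, mul_neg_one, ← Real.exp_add, hαδ]
      simp only [hq]
      congr 2
      field_simp
      ring
    rw [e2]
    simp only [Function.comp_apply]
    field_simp
  have hqd : ∀ t, t₀ < t → HasDerivAt q (δ / β * (1 - Real.exp (s t))) t := by
    intro t ht
    have hw := h.w_pos _ (hin t ht)
    have h1 := (h.hasDerivAt_w _ (hin t ht)).comp t (he t)
    refine (((h1.log hw.ne').add ((hasDerivAt_id t).const_mul δ)).div_const β).congr_deriv ?_
    have e1 : δ * Real.exp (s t) * w (Real.exp (-t))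
        = Real.exp (-t) ^ (γ - 1) * Real.exp (Real.exp (1 / u (Real.exp (-t))))
          * Real.exp (-t) := by
      nth_rewrite 1 [← Real.exp_log hδ]
      nth_rewrite 1 [← Real.exp_log hw]
      rw [← Real.exp_mul, ← Real.exp_add, ← Real.exp_add, ← Real.exp_add, ← Real.exp_add, hγ]
      simp only [hs, hq, hy]
      congr 1
      field_simp
      ring
    simp only [Function.comp_apply]
    rw [← mul_assoc, ← e1]
    field_simp
    ring
  have hyd : ∀ t, t₀ < t → HasDerivAt y (κ * Real.exp (φ t)) t := by
    intro t ht
    refine (hU t ht).exp.congr_deriv ?_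
    rw [hexpφ t ht]; ring
  refine ⟨φ, s, fun t ht => ?_, fun t ht => ?_, hyd, fun t ht => ?_, fun t ht => ?_⟩
  · exact Real.one_lt_exp_iff.2 (one_div_pos.2 (h.u_pos _ (hin t ht)))
  · rw [hlogy t]
    simp only [hs, hφ]
    ring
  · refine ((((hyd t ht).sub ((hasDerivAt_id t).const_mul κ)).sub
      ((hqd t ht).const_mul β)).sub_const (Real.log δ)).congr_deriv ?_
    field_simp
    ring
  · have hu := h.u_pos _ (hin t ht)
    refine ((((hqd t ht).add (hU t ht)).add
      (((hU t ht).log (by positivity)).const_mul 2)).sub_const (Real.log κ)).congr_deriv ?_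
    unfold logDrift
    rw [hlogy t, hexpφ t ht]
    have : y t ≠ 0 := (Real.exp_pos _).ne'
    field_simp
    ring

/-! ### The regular problem as a Volterra equation -/

lemma abs_exp_sub_exp_le {B p q : ℝ} (hp : p ≤ B) (hq : q ≤ B) :
    |Real.exp p - Real.exp q| ≤ Real.exp B * |p - q| := by
  wlog h : q ≤ p generalizing p q
  · have := this hq hp (le_of_not_ge h)
    rwa [abs_sub_comm, abs_sub_comm p q]
  have h1 := Real.exp_le_exp.2 h
  have h2 := Real.exp_le_exp.2 hp
  rw [abs_of_nonneg (by linarith), abs_of_nonneg (by linarith)]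
  have h3 := mul_le_mul_of_nonneg_right (Real.add_one_le_exp (q - p)) (Real.exp_pos p).le
  rw [← Real.exp_add, sub_add_cancel] at h3
  have h4 := mul_le_mul_of_nonneg_right h2 (sub_nonneg.2 h)
  linarith

lemma abs_rpow_sub_rpow_le {m p x y : ℝ} (hm : 0 < m) (hp0 : 0 ≤ p) (hp1 : p ≤ 1) (hx : m ≤ x)
    (hy : m ≤ y) : |x ^ p - y ^ p| ≤ m ^ (p - 1) * |x - y| := by
  wlog h : y ≤ x generalizing x y
  · have := this hy hx (le_of_not_ge h)
    rwa [abs_sub_comm, abs_sub_comm x y]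
  have hy0 : 0 < y := hm.trans_le hy
  have hx0 : 0 < x := hm.trans_le hx
  have h1 : y ^ p ≤ x ^ p := Real.rpow_le_rpow hy0.le h hp0
  rw [abs_of_nonneg (by linarith), abs_of_nonneg (by linarith)]
  have h2 : (x / y) ^ p ≤ x / y := by
    have : 1 ≤ x / y := by rwa [le_div_iff₀ hy0, one_mul]
    simpa using Real.rpow_le_rpow_of_exponent_le this hp1
  have h3 : x ^ p = y ^ p * (x / y) ^ p := by
    rw [← Real.mul_rpow hy0.le (by positivity)]; congr 1; field_simp
  have h4 : y ^ p = y ^ (p - 1) * y := by rw [← Real.rpow_add_one hy0.ne']; simp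
  calc x ^ p - y ^ p ≤ y ^ p * (x / y) - y ^ p := by rw [h3]; gcongr
    _ = y ^ (p - 1) * (x - y) := by rw [h4]; field_simp
    _ ≤ m ^ (p - 1) * (x - y) :=
        mul_le_mul_of_nonneg_right (Real.rpow_le_rpow_of_nonpos hm hy (by linarith))
          (by linarith)

/-- The source term `exp (e^{1/x})`, frozen below the level `a`. A regular solution starting at
`a` increases, so that the truncation does not affect it. -/
noncomputable def truncatedSource (a x : ℝ) : ℝ := Real.exp (Real.exp (1 / max a x))

lemma truncatedSource_of_le {a x : ℝ} (h : a ≤ x) :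
    truncatedSource a x = Real.exp (Real.exp (1 / x)) := by
  rw [truncatedSource, max_eq_right h]

lemma one_le_truncatedSource (a x : ℝ) : 1 ≤ truncatedSource a x :=
  Real.one_le_exp (Real.exp_pos _).le

lemma truncatedSource_le {a : ℝ} (ha : 0 < a) (x : ℝ) :
    truncatedSource a x ≤ Real.exp (Real.exp (1 / a)) := by
  unfold truncatedSource
  gcongr
  exact le_max_left _ _

lemma continuous_truncatedSource {a : ℝ} (ha : 0 < a) : Continuous (truncatedSource a) := by
  unfold truncatedSource
  refine Real.continuous_exp.comp (Real.continuous_exp.comp ?_)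
  exact continuous_const.div (continuous_const.max continuous_id)
    fun x => (ha.trans_le (le_max_left _ _)).ne'

lemma exists_lipschitz_truncatedSource {a : ℝ} (ha : 0 < a) :
    ∃ L, 0 < L ∧ ∀ x y, |truncatedSource a x - truncatedSource a y| ≤ L * |x - y| := by
  refine ⟨Real.exp (Real.exp (1 / a)) * (Real.exp (1 / a) * (1 / a ^ 2)), by positivity,
    fun x y => ?_⟩
  have hx := le_max_left a x
  have hy := le_max_left a y
  have h0 : |max a x - max a y| ≤ |x - y| := by
    have := abs_max_sub_max_le_max a x a y
    simpa using this
  unfold truncatedSource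
  set p := max a x
  set q := max a y
  have hp : 0 < p := ha.trans_le hx
  have hq : 0 < q := ha.trans_le hy
  have h1 : |1 / p - 1 / q| ≤ 1 / a ^ 2 * |p - q| := by
    have e : 1 / p - 1 / q = -((1 / (p * q)) * (p - q)) := by field_simp; ring
    rw [e, abs_neg, abs_mul, abs_of_pos (by positivity)]
    gcongr
    nlinarith
  have h2 : |Real.exp (1 / p) - Real.exp (1 / q)| ≤ Real.exp (1 / a) * |1 / p - 1 / q| :=
    abs_exp_sub_exp_le (by gcongr) (by gcongr)
  have h3 : |Real.exp (Real.exp (1 / p)) - Real.exp (Real.exp (1 / q))|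
      ≤ Real.exp (Real.exp (1 / a)) * |Real.exp (1 / p) - Real.exp (1 / q)| :=
    abs_exp_sub_exp_le (by gcongr) (by gcongr)
  calc _ ≤ _ := h3
    _ ≤ Real.exp (Real.exp (1 / a)) * (Real.exp (1 / a) * (1 / a ^ 2 * |x - y|)) := by
        gcongr; exact h2.trans (by gcongr; exact h1.trans (by gcongr))
    _ = _ := by ring

/-- The flux `∫₀^r s^{γ-1} exp (e^{1/U})` (with the truncated source) generated by `U`. -/
noncomputable def volterraFlux (γ a : ℝ) (U : ℝ → ℝ) (r : ℝ) : ℝ :=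
  ∫ s in (0 : ℝ)..r, s ^ (γ - 1) * truncatedSource a (U s)

/-- The slope `u'` computed from the flux generated by `U`. A regular solution is a fixed point
of `U ↦ a + ∫₀^r volterraSlope U`. -/
noncomputable def volterraSlope (α β γ a : ℝ) (U : ℝ → ℝ) (r : ℝ) : ℝ :=
  (r ^ (-α) * volterraFlux γ a U r) ^ (1 / β)

section Volterra

variable {α β γ a R : ℝ} {U U₁ U₂ : ℝ → ℝ}

lemma continuousOn_volterra_integrand (hγ : 1 < γ) (ha : 0 < a) (hU : ContinuousOn U (Icc 0 R)) :
    ContinuousOn (fun s => s ^ (γ - 1) * truncatedSource a (U s)) (Icc 0 R) :=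
  (continuousOn_id.rpow_const fun _ _ => Or.inr (by linarith)).mul
    ((continuous_truncatedSource ha).comp_continuousOn hU)

lemma intervalIntegrable_volterra (hγ : 1 < γ) (ha : 0 < a) (hU : ContinuousOn U (Icc 0 R))
    {r : ℝ} (hr : r ∈ Icc 0 R) : IntervalIntegrable
      (fun s => s ^ (γ - 1) * truncatedSource a (U s)) MeasureTheory.volume 0 r := by
  apply ContinuousOn.intervalIntegrable
  rw [uIcc_of_le hr.1]
  exact (continuousOn_volterra_integrand hγ ha hU).mono (Icc_subset_Icc_right hr.2)

lemma intervalIntegrable_rpow_sub_one (hγ : 1 < γ) (r : ℝ) :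
    IntervalIntegrable (fun s : ℝ => s ^ (γ - 1)) MeasureTheory.volume 0 r :=
  intervalIntegral.intervalIntegrable_rpow' (by linarith)

lemma integral_rpow_sub_one (hγ : 1 < γ) (r : ℝ) :
    ∫ s in (0 : ℝ)..r, s ^ (γ - 1) = r ^ γ / γ := by
  rw [integral_rpow (Or.inl (by linarith)), sub_add_cancel,
    Real.zero_rpow (by linarith), sub_zero]

lemma le_volterraFlux (hγ : 1 < γ) (ha : 0 < a) (hU : ContinuousOn U (Icc 0 R)) {r : ℝ}
    (hr : r ∈ Icc 0 R) : r ^ γ / γ ≤ volterraFlux γ a U r := by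
  rw [← integral_rpow_sub_one hγ r]
  refine intervalIntegral.integral_mono_on hr.1 (intervalIntegrable_rpow_sub_one hγ r)
    (intervalIntegrable_volterra hγ ha hU hr) fun s hs => ?_
  exact le_mul_of_one_le_right (Real.rpow_nonneg hs.1 _) (one_le_truncatedSource _ _)

lemma volterraFlux_le (hγ : 1 < γ) (ha : 0 < a) (hU : ContinuousOn U (Icc 0 R)) {r : ℝ}
    (hr : r ∈ Icc 0 R) :
    volterraFlux γ a U r ≤ r ^ γ / γ * Real.exp (Real.exp (1 / a)) := by
  rw [← integral_rpow_sub_one hγ r, ← intervalIntegral.integral_mul_const]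
  refine intervalIntegral.integral_mono_on hr.1 (intervalIntegrable_volterra hγ ha hU hr)
    ((intervalIntegrable_rpow_sub_one hγ r).mul_const _) fun s hs => ?_
  exact mul_le_mul_of_nonneg_left (truncatedSource_le ha _) (Real.rpow_nonneg hs.1 _)

lemma abs_volterraFlux_sub_le (hγ : 1 < γ) (ha : 0 < a) (hU₁ : ContinuousOn U₁ (Icc 0 R))
    (hU₂ : ContinuousOn U₂ (Icc 0 R)) {r d L : ℝ} (hr : r ∈ Icc 0 R) (hL : 0 ≤ L)
    (hlip : ∀ x y, |truncatedSource a x - truncatedSource a y| ≤ L * |x - y|)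
    (hd : ∀ s ∈ Icc 0 r, |U₁ s - U₂ s| ≤ d) :
    |volterraFlux γ a U₁ r - volterraFlux γ a U₂ r| ≤ r ^ γ / γ * (L * d) := by
  unfold volterraFlux
  rw [← intervalIntegral.integral_sub (intervalIntegrable_volterra hγ ha hU₁ hr)
    (intervalIntegrable_volterra hγ ha hU₂ hr), ← integral_rpow_sub_one hγ r,
    ← intervalIntegral.integral_mul_const, ← Real.norm_eq_abs]
  refine intervalIntegral.norm_integral_le_of_norm_le hr.1 (Eventually.of_forall fun s hs => ?_)
    ((intervalIntegrable_rpow_sub_one hγ r).mul_const _)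
  rw [← mul_sub, Real.norm_eq_abs, abs_mul, abs_of_nonneg (Real.rpow_nonneg hs.1.le _)]
  refine mul_le_mul_of_nonneg_left ?_ (Real.rpow_nonneg hs.1.le _)
  exact (hlip _ _).trans (mul_le_mul_of_nonneg_left (hd s ⟨hs.1.le, hs.2⟩) hL)

lemma volterraSlope_nonneg (hγ : 1 < γ) (ha : 0 < a) (hU : ContinuousOn U (Icc 0 R)) {r : ℝ}
    (hr : r ∈ Icc 0 R) : 0 ≤ volterraSlope α β γ a U r := by
  have h1 := le_volterraFlux hγ ha hU hr
  have h2 : 0 ≤ r ^ γ / γ := div_nonneg (Real.rpow_nonneg hr.1 _) (by linarith)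
  exact Real.rpow_nonneg (mul_nonneg (Real.rpow_nonneg hr.1 _) (h2.trans h1)) _

lemma continuousOn_volterraFlux (hγ : 1 < γ) (ha : 0 < a) (hU : ContinuousOn U (Icc 0 R))
    (hR : 0 ≤ R) : ContinuousOn (volterraFlux γ a U) (Icc 0 R) := by
  have h := intervalIntegral.continuousOn_primitive_interval (a := 0) (b := R)
    (f := fun s => s ^ (γ - 1) * truncatedSource a (U s)) (μ := MeasureTheory.volume) (by
      rw [uIcc_of_le hR]
      exact (continuousOn_volterra_integrand hγ ha hU).integrableOn_Icc)
  rwa [uIcc_of_le hR] at h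

lemma rpow_neg_mul_rpow_div {r : ℝ} (hr : 0 < r) : r ^ (-α) * (r ^ γ / γ) = r ^ (γ - α) / γ := by
  rw [← mul_div_assoc, ← Real.rpow_add hr]; congr 2; ring

lemma continuousOn_volterraSlope (hβ : 0 < β) (hα : 0 < α) (hαγ : α < γ) (hγ : 1 < γ) (ha : 0 < a)
    (hU : ContinuousOn U (Icc 0 R)) (hR : 0 ≤ R) :
    ContinuousOn (volterraSlope α β γ a U) (Icc 0 R) := by
  have hp : 0 < 1 / β := by positivity
  intro r hr
  rcases hr.1.eq_or_lt with h0 | h0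
  · subst h0
    have hz : volterraSlope α β γ a U 0 = 0 := by
      rw [volterraSlope, Real.zero_rpow (by linarith), zero_mul, Real.zero_rpow hp.ne']
    unfold ContinuousWithinAt
    rw [hz]
    have hlim : Tendsto (fun r : ℝ => (r ^ (γ - α) / γ * Real.exp (Real.exp (1 / a))) ^ (1 / β))
        (𝓝[Icc 0 R] 0) (𝓝 0) := by
      have hc : Continuous
          fun r : ℝ => (r ^ (γ - α) / γ * Real.exp (Real.exp (1 / a))) ^ (1 / β) := by
        refine Continuous.rpow_const ?_ fun _ => Or.inr hp.le
        exact ((Real.continuous_rpow_const (by linarith)).div_const _).mul_const _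
      have := (hc.tendsto 0).mono_left (nhdsWithin_le_nhds (s := Icc 0 R))
      simpa [Real.zero_rpow (by linarith : γ - α ≠ 0), Real.zero_rpow (inv_pos.2 hβ).ne'] using this
    refine squeeze_zero' ?_ ?_ hlim
    · filter_upwards [self_mem_nhdsWithin] with r hr using volterraSlope_nonneg hγ ha hU hr
    · filter_upwards [self_mem_nhdsWithin] with r hr
      rcases hr.1.eq_or_lt with h1 | h1
      · rw [← h1, hz]
        exact Real.rpow_nonneg (mul_nonneg (div_nonneg (Real.rpow_nonneg le_rfl _)
          (by linarith)) (Real.exp_pos _).le) _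
      · rw [volterraSlope]
        have h2 := le_volterraFlux hγ ha hU hr
        have h3 : 0 ≤ r ^ γ / γ := div_nonneg (Real.rpow_nonneg hr.1 _) (by linarith)
        refine Real.rpow_le_rpow (mul_nonneg (Real.rpow_nonneg hr.1 _) (h3.trans h2)) ?_ hp.le
        rw [← rpow_neg_mul_rpow_div h1, mul_assoc]
        exact mul_le_mul_of_nonneg_left (volterraFlux_le hγ ha hU hr) (Real.rpow_nonneg hr.1 _)
  · refine ContinuousWithinAt.rpow_const ?_ (Or.inr hp.le)
    exact (ContinuousWithinAt.rpow_const continuousWithinAt_id (Or.inl h0.ne')).mul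
      (continuousOn_volterraFlux hγ ha hU hR r hr)

/-- The slope is a Lipschitz functional of `U`: the flux is at least `r^γ / γ` because the source
is at least `1`, and this keeps the power `1/β` away from its singularity at `0`. -/
lemma abs_volterraSlope_sub_le (hβ : 1 ≤ β) (hα : 0 < α) (hαγ : α < γ) (hγ : 1 < γ) (ha : 0 < a)
    (hU₁ : ContinuousOn U₁ (Icc 0 R)) (hU₂ : ContinuousOn U₂ (Icc 0 R)) {r d L : ℝ}
    (hr : r ∈ Icc 0 R) (hL : 0 ≤ L)
    (hlip : ∀ x y, |truncatedSource a x - truncatedSource a y| ≤ L * |x - y|)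
    (hd : ∀ s ∈ Icc 0 r, |U₁ s - U₂ s| ≤ d) :
    |volterraSlope α β γ a U₁ r - volterraSlope α β γ a U₂ r|
      ≤ (R ^ (γ - α) / γ) ^ (1 / β) * L * d := by
  have hp : 0 < 1 / β := by positivity
  have hd0 : 0 ≤ d := (abs_nonneg _).trans (hd 0 ⟨le_rfl, hr.1⟩)
  have hR0 : 0 ≤ R := hr.1.trans hr.2
  have hγ0 : 0 < γ := by linarith
  rcases hr.1.eq_or_lt with h0 | h0
  · have hz : ∀ U, volterraSlope α β γ a U 0 = 0 := fun U => by
      rw [volterraSlope, Real.zero_rpow (by linarith), zero_mul, Real.zero_rpow hp.ne']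
    rw [← h0, hz, hz, sub_zero, abs_zero]
    positivity
  · have hm : 0 < r ^ (γ - α) / γ := by positivity
    have hle : ∀ U, ContinuousOn U (Icc 0 R) →
        r ^ (γ - α) / γ ≤ r ^ (-α) * volterraFlux γ a U r := fun U hU => by
      rw [← rpow_neg_mul_rpow_div h0]
      exact mul_le_mul_of_nonneg_left (le_volterraFlux hγ ha hU hr) (by positivity)
    have h1 := abs_rpow_sub_rpow_le hm hp.le (by rw [div_le_one (by linarith)]; exact hβ)
      (hle U₁ hU₁) (hle U₂ hU₂)
    rw [← mul_sub, abs_mul, abs_of_pos (Real.rpow_pos_of_pos h0 _)] at h1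
    have h2 := abs_volterraFlux_sub_le hγ ha hU₁ hU₂ hr hL hlip hd
    have h3 : (r ^ (γ - α) / γ) ^ (1 / β - 1) * (r ^ (γ - α) / γ)
        = (r ^ (γ - α) / γ) ^ (1 / β) := by
      rw [← Real.rpow_add_one hm.ne', sub_add_cancel]
    calc _ ≤ _ := h1
      _ ≤ (r ^ (γ - α) / γ) ^ (1 / β - 1) * (r ^ (-α) * (r ^ γ / γ * (L * d))) := by gcongr
      _ = (r ^ (γ - α) / γ) ^ (1 / β - 1) * (r ^ (-α) * (r ^ γ / γ)) * (L * d) := by ring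
      _ = (r ^ (γ - α) / γ) ^ (1 / β) * (L * d) := by rw [rpow_neg_mul_rpow_div h0, h3]
      _ ≤ (R ^ (γ - α) / γ) ^ (1 / β) * (L * d) := by
          gcongr
          exact hr.2
      _ = _ := by ring

/-- In the norm with weight `e^{-λ r}` and `λ` large, integrating the slope is a contraction. -/
lemma exists_volterra_contraction (hβ : 1 ≤ β) (hα : 0 < α) (hαγ : α < γ) (hγ : 1 < γ)
    (ha : 0 < a) (hR : 0 ≤ R) : ∃ l : ℝ, 0 < l ∧ ∀ U₁ U₂ : ℝ → ℝ, ContinuousOn U₁ (Icc 0 R) →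
      ContinuousOn U₂ (Icc 0 R) → ∀ N, 0 ≤ N →
      (∀ s ∈ Icc 0 R, |U₁ s - U₂ s| ≤ N * Real.exp (l * s)) → ∀ r ∈ Icc 0 R,
      |(∫ s in (0 : ℝ)..r, volterraSlope α β γ a U₁ s)
        - ∫ s in (0 : ℝ)..r, volterraSlope α β γ a U₂ s| ≤ N / 2 * Real.exp (l * r) := by
  obtain ⟨L, hL, hlip⟩ := exists_lipschitz_truncatedSource ha
  have hβ0 : 0 < β := by linarith
  have hγ0 : 0 < γ := by linarith
  set C := (R ^ (γ - α) / γ) ^ (1 / β) * L with hC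
  have hC0 : 0 ≤ C := by positivity
  refine ⟨2 * C + 1, by positivity, ?_⟩
  set l := 2 * C + 1 with hl
  have hl0 : 0 < l := by positivity
  intro U₁ U₂ hU₁ hU₂ N hN hd r hr
  have hint : ∀ U, ContinuousOn U (Icc 0 R) →
      IntervalIntegrable (volterraSlope α β γ a U) MeasureTheory.volume 0 r := fun U hU => by
    apply ContinuousOn.intervalIntegrable
    rw [uIcc_of_le hr.1]
    exact (continuousOn_volterraSlope hβ0 hα hαγ hγ ha hU hR).mono (Icc_subset_Icc_right hr.2)
  have hder : ∀ x : ℝ, HasDerivAt (fun s => C * N / l * Real.exp (l * s))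
      (C * N * Real.exp (l * x)) x := fun x => by
    refine (((hasDerivAt_id x).const_mul l).exp.const_mul (C * N / l)).congr_deriv ?_
    field_simp
    simp
  have hcont : Continuous fun x : ℝ => C * N * Real.exp (l * x) := by fun_prop
  rw [← intervalIntegral.integral_sub (hint U₁ hU₁) (hint U₂ hU₂), ← Real.norm_eq_abs]
  calc _ ≤ ∫ s in (0 : ℝ)..r, C * N * Real.exp (l * s) := by
        refine intervalIntegral.norm_integral_le_of_norm_le hr.1
          (Eventually.of_forall fun s hs => ?_) (hcont.intervalIntegrable _ _)
        rw [Real.norm_eq_abs]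
        refine (abs_volterraSlope_sub_le hβ hα hαγ hγ ha hU₁ hU₂ ⟨hs.1.le, hs.2.trans hr.2⟩
          hL.le hlip (d := N * Real.exp (l * s)) fun x hx => ?_).trans_eq (by rw [hC]; ring)
        refine (hd x ⟨hx.1, hx.2.trans (hs.2.trans hr.2)⟩).trans ?_
        gcongr
        exact hx.2
    _ = C * N / l * Real.exp (l * r) - C * N / l * Real.exp (l * 0) :=
        intervalIntegral.integral_eq_sub_of_hasDerivAt (fun x _ => hder x)
          (hcont.intervalIntegrable _ _)
    _ ≤ C * N / l * Real.exp (l * r) := by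
        have : 0 ≤ C * N / l * Real.exp (l * 0) := by positivity
        linarith
    _ ≤ N / 2 * Real.exp (l * r) := by
        gcongr ?_ * _
        rw [div_le_div_iff₀ hl0 two_pos, hl]
        nlinarith

lemma eqOn_of_volterra (hβ : 1 ≤ β) (hα : 0 < α) (hαγ : α < γ) (hγ : 1 < γ) (ha : 0 < a)
    (hR : 0 ≤ R) (hU₁ : ContinuousOn U₁ (Icc 0 R)) (hU₂ : ContinuousOn U₂ (Icc 0 R))
    (h₁ : ∀ r ∈ Icc 0 R, U₁ r = a + ∫ s in (0 : ℝ)..r, volterraSlope α β γ a U₁ s)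
    (h₂ : ∀ r ∈ Icc 0 R, U₂ r = a + ∫ s in (0 : ℝ)..r, volterraSlope α β γ a U₂ s) :
    EqOn U₁ U₂ (Icc 0 R) := by
  obtain ⟨l, hl, hcon⟩ := exists_volterra_contraction hβ hα hαγ hγ ha hR
  have hc : ContinuousOn (fun s => |U₁ s - U₂ s| * Real.exp (-(l * s))) (Icc 0 R) :=
    (hU₁.sub hU₂).abs.mul (by fun_prop)
  obtain ⟨x, hx, hmax⟩ := isCompact_Icc.exists_isMaxOn ⟨0, ⟨le_rfl, hR⟩⟩ hc
  set N := |U₁ x - U₂ x| * Real.exp (-(l * x)) with hN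
  have hN0 : 0 ≤ N := by positivity
  have hexp : ∀ s, Real.exp (-(l * s)) * Real.exp (l * s) = 1 := fun s => by
    rw [← Real.exp_add]; simp
  have hd : ∀ s ∈ Icc 0 R, |U₁ s - U₂ s| ≤ N * Real.exp (l * s) := fun s hs => by
    have h1 : |U₁ s - U₂ s| * Real.exp (-(l * s)) ≤ N := hmax hs
    calc |U₁ s - U₂ s| = |U₁ s - U₂ s| * Real.exp (-(l * s)) * Real.exp (l * s) := by
          rw [mul_assoc, hexp, mul_one]
      _ ≤ N * Real.exp (l * s) := by gcongr
  have h3 : |U₁ x - U₂ x| ≤ N / 2 * Real.exp (l * x) := by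
    have := hcon U₁ U₂ hU₁ hU₂ N hN0 hd x hx
    rw [h₁ x hx, h₂ x hx]
    convert this using 2
    ring
  have h4 : N ≤ N / 2 := by
    calc N ≤ N / 2 * Real.exp (l * x) * Real.exp (-(l * x)) := by rw [hN]; gcongr
      _ = N / 2 := by rw [mul_assoc, mul_comm (Real.exp (l * x)), hexp, mul_one]
  have h5 : N = 0 := by linarith
  intro s hs
  have := hd s hs
  rw [h5, zero_mul] at this
  exact sub_eq_zero.1 (abs_nonpos_iff.1 this)

lemma exists_volterra_fixedPoint (hβ : 1 ≤ β) (hα : 0 < α) (hαγ : α < γ) (hγ : 1 < γ)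
    (ha : 0 < a) (hR : 0 ≤ R) : ∃ U : ℝ → ℝ, ContinuousOn U (Icc 0 R) ∧
      ∀ r ∈ Icc 0 R, U r = a + ∫ s in (0 : ℝ)..r, volterraSlope α β γ a U s := by
  obtain ⟨l, hl, hcon⟩ := exists_volterra_contraction (R := R) hβ hα hαγ hγ ha hR
  have hβ0 : 0 < β := by linarith
  set lift : C(Icc (0 : ℝ) R, ℝ) → ℝ → ℝ := fun v s => Real.exp (l * s) * IccExtend hR v s
    with hlift
  have hliftc : ∀ v, ContinuousOn (lift v) (Icc 0 R) := fun v => by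
    refine Continuous.continuousOn ?_
    exact (by fun_prop : Continuous fun s : ℝ => Real.exp (l * s)).mul
      (v.continuous.Icc_extend' (h := hR))
  have hTc : ∀ v, ContinuousOn (fun r => Real.exp (-(l * r))
      * (a + ∫ s in (0 : ℝ)..r, volterraSlope α β γ a (lift v) s)) (Icc 0 R) := fun v => by
    refine ContinuousOn.mul (by fun_prop) (continuousOn_const.add ?_)
    have h := intervalIntegral.continuousOn_primitive_interval (a := 0) (b := R)
      (f := volterraSlope α β γ a (lift v)) (μ := MeasureTheory.volume) (by
        rw [uIcc_of_le hR]
        exact (continuousOn_volterraSlope hβ0 hα hαγ hγ ha (hliftc v) hR).integrableOn_Icc)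
    rwa [uIcc_of_le hR] at h
  set Φ : C(Icc (0 : ℝ) R, ℝ) → C(Icc (0 : ℝ) R, ℝ) := fun v => ⟨_, (hTc v).domRestrict⟩ with hΦ
  have hexp : ∀ s, Real.exp (-(l * s)) * Real.exp (l * s) = 1 := fun s => by
    rw [← Real.exp_add]; simp
  have hcontr : ContractingWith (1 / 2) Φ := by
    refine ⟨by rw [← NNReal.coe_lt_coe]; norm_num, LipschitzWith.of_dist_le_mul fun v₁ v₂ => ?_⟩
    rw [ContinuousMap.dist_le (by positivity)]
    intro r
    have hd : ∀ s ∈ Icc 0 R, |lift v₁ s - lift v₂ s| ≤ dist v₁ v₂ * Real.exp (l * s) := by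
      intro s hs
      simp only [hlift]
      rw [← mul_sub, abs_mul, Real.abs_exp, mul_comm, IccExtend_of_mem hR _ hs,
        IccExtend_of_mem hR _ hs, ← Real.dist_eq]
      gcongr
      exact ContinuousMap.dist_apply_le_dist _
    have h1 := hcon _ _ (hliftc v₁) (hliftc v₂) _ dist_nonneg hd r.1 r.2
    simp only [hΦ, ContinuousMap.coe_mk, domRestrict_apply, Real.dist_eq]
    rw [← mul_sub, add_sub_add_left_eq_sub, abs_mul, Real.abs_exp]
    calc _ ≤ Real.exp (-(l * r.1)) * (dist v₁ v₂ / 2 * Real.exp (l * r.1)) := by gcongr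
      _ = dist v₁ v₂ / 2 * (Real.exp (-(l * r.1)) * Real.exp (l * r.1)) := by ring
      _ = ((1 / 2 : NNReal) : ℝ) * dist v₁ v₂ := by rw [hexp]; push_cast; ring
  refine ⟨lift (hcontr.fixedPoint Φ), hliftc _, fun r hr => ?_⟩
  have h1 := congrArg (fun v : C(Icc (0 : ℝ) R, ℝ) => v ⟨r, hr⟩) (hcontr.fixedPoint_isFixedPt)
  simp only [hΦ, ContinuousMap.coe_mk, domRestrict_apply] at h1
  set v := hcontr.fixedPoint Φ
  calc lift v r = Real.exp (l * r) * v ⟨r, hr⟩ := by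
        simp only [hlift]; rw [IccExtend_of_mem hR _ hr]
    _ = Real.exp (-(l * r)) * Real.exp (l * r)
        * (a + ∫ s in (0 : ℝ)..r, volterraSlope α β γ a (lift v) s) := by rw [← h1]; ring
    _ = _ := by rw [hexp, one_mul]

lemma isRadialSolution_of_volterra (hβ : 1 ≤ β) (hα : 0 < α) (hαγ : α < γ) (hγ : 1 < γ)
    (ha : 0 < a) (hR : 0 ≤ R) (hU : ContinuousOn U (Icc 0 R))
    (h : ∀ r ∈ Icc 0 R, U r = a + ∫ s in (0 : ℝ)..r, volterraSlope α β γ a U s) :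
    IsRadialSolution α β γ ruptureNonlinearity R a U := by
  have hβ0 : 0 < β := by linarith
  have hle : ∀ r ∈ Icc 0 R, a ≤ U r := fun r hr => by
    rw [h r hr]
    have := intervalIntegral.integral_nonneg (μ := MeasureTheory.volume) hr.1
      fun s hs => volterraSlope_nonneg (α := α) (β := β) hγ ha hU (⟨hs.1, hs.2.trans hr.2⟩)
    linarith
  have h0 : U 0 = a := by rw [h 0 ⟨le_rfl, hR⟩]; simp
  have hsys : IsFluxSystem α β γ R U (volterraFlux γ a U) := by
    refine ⟨fun r hr => ha.trans_le (hle r (Ioo_subset_Icc_self hr)), fun r hr => ?_,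
      fun r hr => ?_, fun r hr => ?_⟩
    · refine lt_of_lt_of_le ?_ (le_volterraFlux hγ ha hU (Ioo_subset_Icc_self hr))
      have := hr.1
      positivity
    · have hc := continuousOn_volterraSlope hβ0 hα hαγ hγ ha hU hR
      have hnhds : Icc 0 R ∈ 𝓝 r := Icc_mem_nhds hr.1 hr.2
      have hi : IntervalIntegrable (volterraSlope α β γ a U) MeasureTheory.volume 0 r := by
        apply ContinuousOn.intervalIntegrable
        rw [uIcc_of_le hr.1.le]
        exact hc.mono (Icc_subset_Icc_right hr.2.le)
      have hd := (intervalIntegral.integral_hasDerivAt_right hi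
        (hc.mono Ioo_subset_Icc_self |>.stronglyMeasurableAtFilter isOpen_Ioo r hr)
        (hc.continuousAt hnhds)).const_add a
      refine hd.congr_of_eventuallyEq ?_
      filter_upwards [hnhds] with x hx using h x hx
    · have hc := continuousOn_volterra_integrand hγ ha hU
      have hd := intervalIntegral.integral_hasDerivAt_right
        (intervalIntegrable_volterra hγ ha hU (Ioo_subset_Icc_self hr))
        (hc.mono Ioo_subset_Icc_self |>.stronglyMeasurableAtFilter isOpen_Ioo r hr)
        (hc.continuousAt (Icc_mem_nhds hr.1 hr.2))
      rwa [truncatedSource_of_le (hle r (Ioo_subset_Icc_self hr))] at hd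
  have := hsys.isRadialSolution hβ0 (hU.mono Ico_subset_Icc_self)
  rwa [h0] at this

lemma IsRadialSolution.volterra {r₀ : ℝ} (hβ : 1 ≤ β) (hβα : β ≤ α) (hαγ : α < γ) (hγ : 1 < γ)
    (ha : 0 < a) (h : IsRadialSolution α β γ ruptureNonlinearity r₀ a U) (hR : R < r₀) :
    ∀ r ∈ Icc 0 R, U r = a + ∫ s in (0 : ℝ)..r, volterraSlope α β γ a U s := by
  intro r hr
  have hr₀ : 0 < r₀ := (hr.1.trans hr.2).trans_lt hR
  have hβ0 : 0 < β := by linarith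
  have hα : 0 < α := by linarith
  have hsub : Icc 0 R ⊆ Ico 0 r₀ := fun x hx => ⟨hx.1, hx.2.trans_lt hR⟩
  have hU : ContinuousOn U (Icc 0 R) := h.continuousOn.mono hsub
  have hle : ∀ x ∈ Icc 0 R, a ≤ U x := fun x hx => by
    have := h.monotoneOn hβ0 hβα (show (0:ℝ) ∈ Ico 0 r₀ from ⟨le_rfl, hr₀⟩) (hsub hx) hx.1
    rwa [h.initial] at this
  set w : ℝ → ℝ := fun s => s ^ α * |deriv U s| ^ (β - 1) * deriv U s with hw
  have hsys := h.isFluxSystem hβ0 hβα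
  have hw0 : w 0 = 0 := by simp [hw, Real.zero_rpow hα.ne']
  have hwc : ContinuousOn w (Icc 0 R) := by
    intro x hx
    rcases hx.1.eq_or_lt with h0 | h0
    · rw [← h0]
      have h1 : ContinuousWithinAt w (Ioi 0) 0 := by
        unfold ContinuousWithinAt
        rw [hw0]
        exact h.tendsto_flux hr₀ hβ0 hβα
      exact (continuousWithinAt_Ioi_iff_Ici.1 h1).mono Icc_subset_Ici_self
    · exact (hsys.hasDerivAt_w x ⟨h0, hx.2.trans_lt hR⟩).continuousAt.continuousWithinAt
  have hwV : ∀ x ∈ Icc 0 R, w x = volterraFlux γ a U x := by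
    intro x hx
    have h1 := intervalIntegral.integral_eq_sub_of_hasDerivAt_of_le hx.1
      (hwc.mono (Icc_subset_Icc_right hx.2))
      (f' := fun s => s ^ (γ - 1) * truncatedSource a (U s)) (fun s hs => by
        have hs' : s ∈ Icc 0 R := ⟨hs.1.le, hs.2.le.trans hx.2⟩
        rw [truncatedSource_of_le (hle s hs')]
        exact hsys.hasDerivAt_w s ⟨hs.1, hs'.2.trans_lt hR⟩)
      (intervalIntegrable_volterra hγ ha hU hx)
    rw [hw0, sub_zero] at h1
    exact h1.symm
  have h2 := intervalIntegral.integral_eq_sub_of_hasDerivAt_of_le hr.1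
    (hU.mono (Icc_subset_Icc_right hr.2))
    (f' := volterraSlope α β γ a U) (fun s hs => by
      have hs' : s ∈ Icc 0 R := ⟨hs.1.le, hs.2.le.trans hr.2⟩
      rw [volterraSlope, ← hwV s hs']
      exact hsys.hasDerivAt_u s ⟨hs.1, hs'.2.trans_lt hR⟩)
    (by
      apply ContinuousOn.intervalIntegrable
      rw [uIcc_of_le hr.1]
      exact (continuousOn_volterraSlope hβ0 hα hαγ hγ ha hU (hr.1.trans hr.2)).mono
        (Icc_subset_Icc_right hr.2))
  rw [h2, h.initial]
  ring

/-- The regular problem has exactly one solution, on every interval. -/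
theorem exists_isUniqueRadialSolution_of_pos {r₀ : ℝ} (hr₀ : 0 < r₀) (hβ : 1 ≤ β) (hβα : β < α)
    (hαγ : α < γ) (ha : 0 < a) :
    ∃ u, IsUniqueRadialSolution α β γ ruptureNonlinearity r₀ a u := by
  have hγ : 1 < γ := by linarith
  have hα : 0 < α := by linarith
  obtain ⟨U, hU, h⟩ := exists_volterra_fixedPoint (R := r₀) hβ hα hαγ hγ ha hr₀.le
  have hsol := isRadialSolution_of_volterra hβ hα hαγ hγ ha hr₀.le hU h
  refine ⟨U, hsol, fun v hv r hr => ?_⟩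
  have hsub : Icc 0 r ⊆ Ico 0 r₀ := fun x hx => ⟨hx.1, hx.2.trans_lt hr.2⟩
  exact eqOn_of_volterra hβ hα hαγ hγ ha hr.1 (hv.continuousOn.mono hsub)
    (hsol.continuousOn.mono hsub) (hv.volterra hβ hβα.le hαγ hγ ha hr.2)
    (hsol.volterra hβ hβα.le hαγ hγ ha hr.2) (right_mem_Icc.2 hr.1)

end Volterra

/-! ### Comparison of trajectories -/

/-- Near the equilibrium, the difference of two trajectories is a near-linear pair. -/
lemma IsLogTrajectory.isNearLinear_sub {β δ κ t₀ t₁ ν Y μ : ℝ} {y₁ φ₁ s₁ y₂ φ₂ s₂ : ℝ → ℝ}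
    (h₁ : IsLogTrajectory β δ κ t₀ y₁ φ₁ s₁) (h₂ : IsLogTrajectory β δ κ t₀ y₂ φ₂ s₂)
    (hrate : ∀ y₁ y₂ φ₁ φ₂ s₁ s₂ : ℝ, |s₁| ≤ ν → |s₂| ≤ ν → |φ₁| ≤ ν → |φ₂| ≤ ν → Y ≤ y₁ → Y ≤ y₂ →
      s₁ - s₂ = (y₁ - y₂) - β * (φ₁ - φ₂) + β * (Real.log y₁ - Real.log y₂)
        + 2 * β * (Real.log (Real.log y₁) - Real.log (Real.log y₂)) →
      |κ * Real.exp φ₁ - κ * Real.exp φ₂ - κ * (φ₁ - φ₂)| ≤ μ * (|y₁ - y₂| + |φ₁ - φ₂|) ∧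
      |phiRate β δ κ y₁ φ₁ s₁ - phiRate β δ κ y₂ φ₂ s₂
        - (δ * (φ₁ - φ₂) - δ / β * (y₁ - y₂))| ≤ μ * (|y₁ - y₂| + |φ₁ - φ₂|) ∧
      |y₁ - y₂| ≤ 4 + 4 * β ∧
      |s₁ - s₂| ≤ (2 + β) * (|y₁ - y₂| + |φ₁ - φ₂|))
    (hb₁ : ∀ t, t₀ < t → t ≤ t₁ → |s₁ t| ≤ ν ∧ |φ₁ t| ≤ ν ∧ Y ≤ y₁ t)
    (hb₂ : ∀ t, t₀ < t → t ≤ t₁ → |s₂ t| ≤ ν ∧ |φ₂ t| ≤ ν ∧ Y ≤ y₂ t) :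
    IsNearLinear β δ κ μ (Ioc t₀ t₁) (fun t => y₁ t - y₂ t) (fun t => φ₁ t - φ₂ t)
      (fun t => κ * Real.exp (φ₁ t) - κ * Real.exp (φ₂ t))
      (fun t => phiRate β δ κ (y₁ t) (φ₁ t) (s₁ t) - phiRate β δ κ (y₂ t) (φ₂ t) (s₂ t)) ∧
    ∀ t ∈ Ioc t₀ t₁, |y₁ t - y₂ t| ≤ 4 + 4 * β ∧
      |s₁ t - s₂ t| ≤ (2 + β) * (|y₁ t - y₂ t| + |φ₁ t - φ₂ t|) := by
  have key : ∀ t ∈ Ioc t₀ t₁, _ := fun t ht =>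
    hrate (y₁ t) (y₂ t) (φ₁ t) (φ₂ t) (s₁ t) (s₂ t) (hb₁ t ht.1 ht.2).1 (hb₂ t ht.1 ht.2).1
      (hb₁ t ht.1 ht.2).2.1 (hb₂ t ht.1 ht.2).2.1 (hb₁ t ht.1 ht.2).2.2 (hb₂ t ht.1 ht.2).2.2
      (by rw [h₁.rel t ht.1, h₂.rel t ht.1]; ring)
  refine ⟨⟨fun t ht => (h₁.hasDerivAt_y t ht.1).sub (h₂.hasDerivAt_y t ht.1),
    fun t ht => (h₁.hasDerivAt_phi t ht.1).sub (h₂.hasDerivAt_phi t ht.1),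
    fun t ht => (key t ht).1, fun t ht => (key t ht).2.1⟩,
    fun t ht => ⟨(key t ht).2.2.1, (key t ht).2.2.2⟩⟩

/-- Comparison of the trajectories on `(t₀, ∞)` whose `y` becomes large, in the sense that it
exceeds `B t₁`. Up to time `t₁` they stay near the equilibrium; two of them are exponentially
close, backwards in time, together with their derivatives; and if the equilibrium is a spiral they
meet in every interval of a fixed length. -/
structure TrajectoryComparison (β δ κ t₀ c K : ℝ) (B : ℝ → ℝ) : Prop where
  c_pos : 0 < c
  K_pos : 0 < K
  near : ∀ y φ s, IsLogTrajectory β δ κ t₀ y φ s → ∀ t₁, t₀ < t₁ → (∃ t, t₀ < t ∧ B t₁ < y t) →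
    ∀ t, t₀ < t → t ≤ t₁ → |s t| ≤ 1 ∧ |φ t| ≤ 1 ∧ Real.exp 1 ≤ y t
  close : ∀ y₁ φ₁ s₁ y₂ φ₂ s₂,
    IsLogTrajectory β δ κ t₀ y₁ φ₁ s₁ → IsLogTrajectory β δ κ t₀ y₂ φ₂ s₂ →
    ∀ t₁, t₀ < t₁ → (∃ t, t₀ < t ∧ B t₁ < y₁ t) → (∃ t, t₀ < t ∧ B t₁ < y₂ t) →
    ∀ t, t₀ < t → t ≤ t₁ →
      |y₁ t - y₂ t| ≤ K * Real.exp (-c * (t₁ - t)) ∧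
      |φ₁ t - φ₂ t| ≤ K * Real.exp (-c * (t₁ - t)) ∧
      |s₁ t - s₂ t| ≤ K * Real.exp (-c * (t₁ - t)) ∧
      |κ * Real.exp (φ₁ t) - κ * Real.exp (φ₂ t)| ≤ K * Real.exp (-c * (t₁ - t)) ∧
      |phiRate β δ κ (y₁ t) (φ₁ t) (s₁ t) - phiRate β δ κ (y₂ t) (φ₂ t) (s₂ t)|
        ≤ K * Real.exp (-c * (t₁ - t))
  meet : δ ^ 2 < 4 * (κ * (δ / β)) → ∃ ℓ, 0 < ℓ ∧ ∀ y₁ φ₁ s₁ y₂ φ₂ s₂,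
    IsLogTrajectory β δ κ t₀ y₁ φ₁ s₁ → IsLogTrajectory β δ κ t₀ y₂ φ₂ s₂ →
    ∀ t₁, t₀ < t₁ → (∃ t, t₀ < t ∧ B t₁ < y₁ t) → (∃ t, t₀ < t ∧ B t₁ < y₂ t) →
    ∀ a, t₀ < a → a + ℓ ≤ t₁ → ∃ t ∈ Icc a (a + ℓ), y₁ t = y₂ t

theorem exists_trajectoryComparison {β δ κ : ℝ} (hβ : 0 < β) (hδ : 0 < δ) (hκ : 0 < κ) :
    ∃ (t₀ c K : ℝ) (B : ℝ → ℝ), 0 < t₀ ∧ TrajectoryComparison β δ κ t₀ c K B := by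
  obtain ⟨μ₁, c, C, hμ₁, hc, hC, hdecay⟩ := IsNearLinear.exists_forall_exp_decay hβ hδ hκ
  obtain ⟨μ₂, hμ₂, hzero⟩ : ∃ μ₂, 0 < μ₂ ∧ (δ ^ 2 < 4 * (κ * (δ / β)) → ∃ ℓ : ℝ, 0 < ℓ ∧
      ∀ (a : ℝ) (z f z' f' : ℝ → ℝ), IsNearLinear β δ κ μ₂ (Icc a (a + ℓ)) z f z' f' →
        ∃ t ∈ Icc a (a + ℓ), z t = 0) := by
    by_cases hosc : δ ^ 2 < 4 * (κ * (δ / β))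
    · obtain ⟨μ₂, ℓ, h1, h2, h3⟩ := IsNearLinear.exists_forall_exists_eq_zero hβ hδ hκ hosc
      exact ⟨μ₂, h1, fun _ => ⟨ℓ, h2, h3⟩⟩
    · exact ⟨1, one_pos, fun h => absurd h hosc⟩
  set μ := min μ₁ μ₂ with hμ
  have hμ0 : 0 < μ := lt_min hμ₁ hμ₂
  obtain ⟨ν, Y, hν, hν1, hY, hrate⟩ := exists_forall_abs_rate_sub_le hβ hδ hκ hμ0
  obtain ⟨t₀, B, ht₀, hnear⟩ := exists_forall_near_equilibrium hβ hδ hκ hν Y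
  set D := Real.sqrt (2 * C * ((4 + 4 * β) ^ 2 + 2 ^ 2)) with hD
  have hD0 : 0 < D := by positivity
  set G := 1 + (2 + β) + (κ + μ) + (δ + δ / β + μ) with hG
  have hG0 : 0 < G := by positivity
  refine ⟨t₀, c / 2, G * D, B, ht₀, by positivity, by positivity, ?_, ?_, ?_⟩
  · intro y φ s h t₁ ht₁ hbig t ht htt
    obtain ⟨h1, h2, h3⟩ := hnear y φ s h t₁ ht₁ hbig t ht htt
    exact ⟨h1.trans hν1, h2.trans hν1, hY.trans h3⟩
  · intro y₁ φ₁ s₁ y₂ φ₂ s₂ h₁ h₂ t₁ ht₁ hbig₁ hbig₂ t ht htt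
    have hb₁ := hnear y₁ φ₁ s₁ h₁ t₁ ht₁ hbig₁
    have hb₂ := hnear y₂ φ₂ s₂ h₂ t₁ ht₁ hbig₂
    obtain ⟨hlin, hbd⟩ := h₁.isNearLinear_sub h₂ hrate hb₁ hb₂
    have hd := hdecay t t₁ _ _ _ _ htt (hlin.mono (min_le_left _ _)
      (fun x hx => ⟨ht.trans_le hx.1, hx.2⟩))
    have htm : t ∈ Ioc t₀ t₁ := ⟨ht, htt⟩
    have htm₁ : t₁ ∈ Ioc t₀ t₁ := ⟨ht₁, le_rfl⟩
    have hz₁ := (hbd t₁ htm₁).1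
    have hf₁ : |φ₁ t₁ - φ₂ t₁| ≤ 2 := (abs_sub _ _).trans (by
      linarith [(hb₁ t₁ ht₁ le_rfl).2.1, (hb₂ t₁ ht₁ le_rfl).2.1])
    have hs := (hbd t htm).2
    have hz' := hlin.abs_fst_le t htm
    have hf' := hlin.abs_snd_le t htm
    set z := y₁ t - y₂ t
    set f := φ₁ t - φ₂ t
    set E := Real.exp (-(c / 2) * (t₁ - t)) with hE
    have hE2 : Real.exp (-c * (t₁ - t)) = E ^ 2 := by
      rw [hE, ← Real.exp_nat_mul]; congr 1; push_cast; ring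
    have hzf : |z| + |f| ≤ D * E := by
      apply abs_le_of_sq_le_sq' _ (by positivity) |>.2
      have a1 : (y₁ t₁ - y₂ t₁) ^ 2 + (φ₁ t₁ - φ₂ t₁) ^ 2 ≤ (4 + 4 * β) ^ 2 + 2 ^ 2 := by
        rw [← sq_abs, ← sq_abs (φ₁ t₁ - φ₂ t₁)]; gcongr
      have a2 : (|z| + |f|) ^ 2 ≤ 2 * (z ^ 2 + f ^ 2) := by
        rw [← sq_abs z, ← sq_abs f]; linarith [sq_nonneg (|z| - |f|)]
      rw [mul_pow, hD, Real.sq_sqrt (by positivity), ← hE2]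
      calc (|z| + |f|) ^ 2 ≤ 2 * (z ^ 2 + f ^ 2) := a2
        _ ≤ 2 * (C * Real.exp (-c * (t₁ - t)) * ((4 + 4 * β) ^ 2 + 2 ^ 2)) := by
            gcongr; exact hd.trans (by gcongr)
        _ = _ := by ring
    have hz0 := abs_nonneg z
    have hf0 := abs_nonneg f
    have hdb : 0 < δ / β := by positivity
    have fin : ∀ x g : ℝ, |x| ≤ g * (|z| + |f|) → g ≤ G → |x| ≤ G * D * E := by
      intro x g hx hg
      calc |x| ≤ g * (|z| + |f|) := hx
        _ ≤ G * (|z| + |f|) := by gcongr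
        _ ≤ G * (D * E) := by gcongr
        _ = _ := by ring
    refine ⟨fin _ 1 (by linarith) ?_, fin _ 1 (by linarith) ?_, fin _ (2 + β) hs ?_,
      fin _ (κ + μ) ?_ ?_, fin _ (δ + δ / β + μ) ?_ ?_⟩
    · rw [hG]; linarith
    · rw [hG]; linarith
    · rw [hG]; linarith
    · have := abs_sub_abs_le_abs_sub (κ * Real.exp (φ₁ t) - κ * Real.exp (φ₂ t)) (κ * f)
      rw [abs_mul κ, abs_of_pos hκ] at this
      have : 0 ≤ κ * |z| := by positivity
      linarith
    · rw [hG]; linarith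
    · have a1 := abs_sub_abs_le_abs_sub
        (phiRate β δ κ (y₁ t) (φ₁ t) (s₁ t) - phiRate β δ κ (y₂ t) (φ₂ t) (s₂ t))
        (δ * f - δ / β * z)
      have a2 := abs_sub (δ * f) (δ / β * z)
      rw [abs_mul, abs_mul, abs_of_pos hδ, abs_of_pos hdb] at a2
      have : 0 ≤ δ * |z| := by positivity
      have : 0 ≤ δ / β * |f| := by positivity
      linarith
    · rw [hG]; linarith
  · intro hosc
    obtain ⟨ℓ, hℓ, hz⟩ := hzero hosc
    refine ⟨ℓ, hℓ, ?_⟩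
    intro y₁ φ₁ s₁ y₂ φ₂ s₂ h₁ h₂ t₁ ht₁ hbig₁ hbig₂ a ha hat
    obtain ⟨hlin, -⟩ := h₁.isNearLinear_sub h₂ hrate
      (hnear y₁ φ₁ s₁ h₁ t₁ ht₁ hbig₁) (hnear y₂ φ₂ s₂ h₂ t₁ ht₁ hbig₂)
    obtain ⟨t, ht, h0⟩ := hz a _ _ _ _ (hlin.mono (min_le_right _ _)
      (fun x hx => ⟨ha.trans_le hx.1, hx.2.trans hat⟩))
    exact ⟨t, ht, sub_eq_zero.1 h0⟩

/-- The equation for `s` follows from the relation and the other two equations. -/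
lemma IsLogTrajectory.of_rel {β δ κ t₀ : ℝ} {y φ s : ℝ → ℝ} (hβ : β ≠ 0)
    (hone : ∀ t, t₀ < t → 1 < y t)
    (hrel : ∀ t, s t = y t - κ * t - β * (φ t + Real.log κ) + β * Real.log (y t)
      + 2 * β * Real.log (Real.log (y t)) - Real.log δ)
    (hy : ∀ t, t₀ < t → HasDerivAt y (κ * Real.exp (φ t)) t)
    (hφ : ∀ t, t₀ < t → HasDerivAt φ (phiRate β δ κ (y t) (φ t) (s t)) t) :
    IsLogTrajectory β δ κ t₀ y φ s where
  one_lt := hone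
  rel t _ := hrel t
  hasDerivAt_y := hy
  hasDerivAt_phi := hφ
  hasDerivAt_s t ht := by
    have h1 := hone t ht
    have h2 := Real.log_pos h1
    have hl := (hy t ht).log (by linarith)
    have hd := ((((((hy t ht).sub ((hasDerivAt_id t).const_mul κ)).sub
      (((hφ t ht).add_const (Real.log κ)).const_mul β)).add (hl.const_mul β)).add
      ((hl.log h2.ne').const_mul (2 * β))).sub_const (Real.log δ))
    refine (hd.congr_of_eventuallyEq (Eventually.of_forall hrel)).congr_deriv ?_
    unfold phiRate logDrift
    have : y t ≠ 0 := by linarith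
    field_simp
    ring

/-- Along a trajectory that stays near the equilibrium for all time, `y → ∞`. -/
lemma IsLogTrajectory.tendsto_y {β δ κ t₀ : ℝ} {y φ s : ℝ → ℝ}
    (h : IsLogTrajectory β δ κ t₀ y φ s) (hβ : 0 < β) (hκ : 0 < κ)
    (hs : ∀ t, t₀ < t → |s t| ≤ 1) (hφ : ∀ t, t₀ < t → |φ t| ≤ 1) : Tendsto y atTop atTop := by
  refine tendsto_atTop.2 fun Y₀ => ?_
  set Y := max (Real.exp 1) Y₀ with hY
  filter_upwards [eventually_gt_atTop t₀, eventually_gt_atTop ((Y + β * Real.log Y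
    + 2 * β * Real.log (Real.log Y) + 1 + β * (1 + |Real.log κ|) + |Real.log δ|) / κ)] with t h1 h2
  rw [div_lt_iff₀ hκ] at h2
  exact (le_max_right _ _).trans
    (h.lt_y_of_abs_le (Y := Y) hβ h1 (hs t h1) (hφ t h1) (by linarith)).le

/-- Near the equilibrium `y` is comparable with `t`, so that `log y` is equivalent to `log t`. -/
lemma IsLogTrajectory.tendsto_log_div_log {β δ κ t₀ : ℝ} {y φ s : ℝ → ℝ}
    (h : IsLogTrajectory β δ κ t₀ y φ s) (hβ : 0 < β) (hκ : 0 < κ)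
    (hs : ∀ t, t₀ < t → |s t| ≤ 1) (hφ : ∀ t, t₀ < t → |φ t| ≤ 1)
    (hy : ∀ t, t₀ < t → Real.exp 1 ≤ y t) :
    Tendsto (fun t => Real.log t / Real.log (y t)) atTop (𝓝 1) := by
  set A := 1 + β * (1 + |Real.log κ|) + |Real.log δ| with hA
  have hA0 : 0 < A := by positivity
  have hbound : ∀ t, t₀ < t → κ * t - A ≤ (1 + 3 * β) * y t ∧ y t ≤ κ * t + A := by
    intro t ht
    have he := hy t ht
    have h0 : 0 < y t := (Real.exp_pos 1).trans_le he
    have h1 : 1 ≤ Real.log (y t) := by rwa [Real.le_log_iff_exp_le h0]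
    have h2 : Real.log (y t) ≤ y t := (Real.log_le_sub_one_of_pos h0).trans (by linarith)
    have h3 : 0 ≤ Real.log (Real.log (y t)) := Real.log_nonneg h1
    have h4 : Real.log (Real.log (y t)) ≤ y t :=
      (Real.log_le_sub_one_of_pos (by linarith)).trans (by linarith)
    have h5 := h.y_add_log_eq ht
    have h6 := abs_le.1 (hs t ht)
    have h7 := abs_le.1 (hφ t ht)
    have h8 : |β * (φ t + Real.log κ)| ≤ β * (1 + |Real.log κ|) := by
      rw [abs_mul, abs_of_pos hβ]
      gcongr
      exact (abs_add_le _ _).trans (by gcongr; exact hφ t ht)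
    have h9 := abs_le.1 h8
    have h10 := neg_abs_le (Real.log δ)
    have h11 := le_abs_self (Real.log δ)
    have h12 : β * Real.log (y t) ≤ β * y t := by gcongr
    have h13 : 2 * β * Real.log (Real.log (y t)) ≤ 2 * β * y t := by gcongr
    have h14 : 0 ≤ β * Real.log (y t) := by positivity
    have h15 : 0 ≤ 2 * β * Real.log (Real.log (y t)) := by positivity
    constructor <;> linarith
  set k := κ / (2 * (1 + 3 * β)) with hk
  have hk0 : 0 < k := by positivity
  set M := |Real.log k| + |Real.log (2 * κ)| with hM
  have hev : ∀ᶠ t in atTop, 1 < t ∧ t₀ < t ∧ |Real.log (y t) - Real.log t| ≤ M := by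
    filter_upwards [eventually_gt_atTop 1, eventually_gt_atTop t₀,
      eventually_gt_atTop (2 * A / κ)] with t h1 h2 h3
    refine ⟨h1, h2, ?_⟩
    rw [div_lt_iff₀ hκ] at h3
    have h0 : 0 < y t := (Real.exp_pos 1).trans_le (hy t h2)
    obtain ⟨h4, h5⟩ := hbound t h2
    have h6 : k * t ≤ y t := by
      rw [hk, div_mul_eq_mul_div, div_le_iff₀ (by positivity)]
      linarith
    have h7 : y t ≤ 2 * κ * t := by nlinarith
    have h8 := Real.log_le_log (by positivity) h6
    have h9 := Real.log_le_log h0 h7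
    rw [Real.log_mul hk0.ne' (by linarith)] at h8
    rw [Real.log_mul (by positivity) (by linarith)] at h9
    rw [abs_le]
    constructor
    · linarith [neg_abs_le (Real.log k), abs_nonneg (Real.log (2 * κ))]
    · linarith [le_abs_self (Real.log (2 * κ)), abs_nonneg (Real.log k)]
  have hlim : Tendsto (fun t => Real.log (y t) / Real.log t - 1) atTop (𝓝 0) := by
    refine squeeze_zero_norm' (a := fun t => M / Real.log t) ?_
      (tendsto_const_nhds.div_atTop Real.tendsto_log_atTop)
    filter_upwards [hev] with t ht
    have hl := Real.log_pos ht.1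
    rw [div_sub_one hl.ne', Real.norm_eq_abs, abs_div, abs_of_pos hl]
    exact div_le_div_of_nonneg_right ht.2.2 hl.le
  have h1 := (hlim.add_const 1).inv₀ (by norm_num)
  simpa using h1

/-! ### The limit trajectory -/

/-- Differences bounded by `K e^{-c (t₁ - t)}` for every `t₁` make a family uniformly Cauchy. -/
lemma uniformCauchySeqOn_of_exp {ι : Type*} {l : Filter ι} {t₀ c K τ : ℝ} {F : ι → ℝ → ℝ}
    (hc : 0 < c) (hK : 0 < K) (hF : ∀ t₁, t₀ < t₁ → ∀ᶠ p : ι × ι in l ×ˢ l, ∀ t, t₀ < t → t ≤ t₁ →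
      |F p.1 t - F p.2 t| ≤ K * Real.exp (-c * (t₁ - t))) :
    UniformCauchySeqOn F l (Ioc t₀ τ) := by
  intro V hV
  obtain ⟨ε, hε, hεV⟩ := Metric.mem_uniformity_dist.1 hV
  set t₁ := max (t₀ + 1) (τ + (|Real.log (K / ε)| + 1) / c) with ht₁
  filter_upwards [hF t₁ ((lt_add_one t₀).trans_le (le_max_left _ _))] with p hp t ht
  have h1 : τ ≤ t₁ := by
    have : 0 ≤ (|Real.log (K / ε)| + 1) / c := by positivity
    linarith [le_max_right (t₀ + 1) (τ + (|Real.log (K / ε)| + 1) / c)]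
  refine hεV ?_
  rw [Real.dist_eq]
  refine (hp t ht.1 (ht.2.trans h1)).trans_lt ?_
  have h2 : (|Real.log (K / ε)| + 1) / c ≤ t₁ - t := by
    linarith [le_max_right (t₀ + 1) (τ + (|Real.log (K / ε)| + 1) / c), ht.2]
  rw [div_le_iff₀ hc] at h2
  have h3 : Real.exp (-c * (t₁ - t)) < Real.exp (-Real.log (K / ε)) := by
    apply Real.exp_lt_exp.2
    linarith [le_abs_self (Real.log (K / ε))]
  rw [Real.exp_neg, Real.exp_log (by positivity)] at h3
  calc K * Real.exp (-c * (t₁ - t)) < K * (K / ε)⁻¹ := by gcongr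
    _ = ε := by field_simp

/-- A family of trajectories that become arbitrarily large converges, together with its
derivatives, to a trajectory that stays near the equilibrium for all time. -/
lemma TrajectoryComparison.exists_limit {ι : Type*} {l : Filter ι} [l.NeBot]
    {β δ κ t₀ c K : ℝ} {B : ℝ → ℝ} (hcmp : TrajectoryComparison β δ κ t₀ c K B) (hβ : 0 < β)
    {y φ s : ι → ℝ → ℝ} (htraj : ∀ᶠ i in l, IsLogTrajectory β δ κ t₀ (y i) (φ i) (s i))
    (hbig : ∀ t₁, t₀ < t₁ → ∀ᶠ i in l, ∃ t, t₀ < t ∧ B t₁ < y i t) :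
    ∃ y' φ' s', IsLogTrajectory β δ κ t₀ y' φ' s' ∧
      (∀ t, t₀ < t → |s' t| ≤ 1 ∧ |φ' t| ≤ 1 ∧ Real.exp 1 ≤ y' t) ∧
      (∀ τ, TendstoUniformlyOn y y' l (Ioc t₀ τ)) ∧
      (∀ τ, TendstoUniformlyOn φ φ' l (Ioc t₀ τ)) ∧
      (∀ τ, TendstoUniformlyOn s s' l (Ioc t₀ τ)) := by
  have hpair : ∀ t₁, t₀ < t₁ → ∀ᶠ p : ι × ι in l ×ˢ l, ∀ t, t₀ < t → t ≤ t₁ → _ := fun t₁ ht₁ => by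
    have h1 := htraj.and (hbig t₁ ht₁)
    filter_upwards [h1.prod_mk h1] with p hp t ht htt
    exact hcmp.close _ _ _ _ _ _ hp.1.1 hp.2.1 t₁ ht₁ hp.1.2 hp.2.2 t ht htt
  have cy : ∀ τ, UniformCauchySeqOn y l (Ioc t₀ τ) := fun τ =>
    uniformCauchySeqOn_of_exp hcmp.c_pos hcmp.K_pos fun t₁ h1 => by
      filter_upwards [hpair t₁ h1] with p hp t h2 h3 using (hp t h2 h3).1
  have cφ : ∀ τ, UniformCauchySeqOn φ l (Ioc t₀ τ) := fun τ =>
    uniformCauchySeqOn_of_exp hcmp.c_pos hcmp.K_pos fun t₁ h1 => by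
      filter_upwards [hpair t₁ h1] with p hp t h2 h3 using (hp t h2 h3).2.1
  have cs : ∀ τ, UniformCauchySeqOn s l (Ioc t₀ τ) := fun τ =>
    uniformCauchySeqOn_of_exp hcmp.c_pos hcmp.K_pos fun t₁ h1 => by
      filter_upwards [hpair t₁ h1] with p hp t h2 h3 using (hp t h2 h3).2.2.1
  have cy' : ∀ τ, UniformCauchySeqOn (fun i t => κ * Real.exp (φ i t)) l (Ioc t₀ τ) := fun τ =>
    uniformCauchySeqOn_of_exp hcmp.c_pos hcmp.K_pos fun t₁ h1 => by
      filter_upwards [hpair t₁ h1] with p hp t h2 h3 using (hp t h2 h3).2.2.2.1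
  have cφ' : ∀ τ, UniformCauchySeqOn (fun i t => phiRate β δ κ (y i t) (φ i t) (s i t)) l
      (Ioc t₀ τ) := fun τ =>
    uniformCauchySeqOn_of_exp hcmp.c_pos hcmp.K_pos fun t₁ h1 => by
      filter_upwards [hpair t₁ h1] with p hp t h2 h3 using (hp t h2 h3).2.2.2.2
  have ex : ∀ F : ι → ℝ → ℝ, (∀ τ, UniformCauchySeqOn F l (Ioc t₀ τ)) →
      ∃ F' : ℝ → ℝ, ∀ t, t₀ < t → Tendsto (fun i => F i t) l (𝓝 (F' t)) := fun F hF => by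
    have h1 : ∀ t, ∃ x, t₀ < t → Tendsto (fun i => F i t) l (𝓝 x) := fun t => by
      by_cases ht : t₀ < t
      · obtain ⟨x, hx⟩ := cauchy_map_iff_exists_tendsto.1 ((hF t).cauchy_map ⟨ht, le_rfl⟩)
        exact ⟨x, fun _ => hx⟩
      · exact ⟨0, fun h => absurd h ht⟩
    choose F' hF' using h1
    exact ⟨F', hF'⟩
  obtain ⟨y', hy'⟩ := ex y cy
  obtain ⟨φ', hφ'⟩ := ex φ cφ
  set s' : ℝ → ℝ := fun t => y' t - κ * t - β * (φ' t + Real.log κ) + β * Real.log (y' t)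
      + 2 * β * Real.log (Real.log (y' t)) - Real.log δ with hs'def
  have hnear : ∀ t, t₀ < t → ∀ᶠ i in l, |s i t| ≤ 1 ∧ |φ i t| ≤ 1 ∧ Real.exp 1 ≤ y i t := by
    intro t ht
    filter_upwards [htraj, hbig t ht] with i h1 h2 using hcmp.near _ _ _ h1 t ht h2 t ht le_rfl
  have hye : ∀ t, t₀ < t → Real.exp 1 ≤ y' t := fun t ht =>
    ge_of_tendsto (hy' t ht) ((hnear t ht).mono fun i h => h.2.2)
  have hy1 : ∀ t, t₀ < t → 1 < y' t := fun t ht =>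
    (Real.one_lt_exp_iff.2 one_pos).trans_le (hye t ht)
  have hs' : ∀ t, t₀ < t → Tendsto (fun i => s i t) l (𝓝 (s' t)) := by
    intro t ht
    have h1 := hy1 t ht
    have hl := (hy' t ht).log (by linarith)
    have h2 := ((((((hy' t ht).sub_const (κ * t)).sub (((hφ' t ht).add_const
      (Real.log κ)).const_mul β)).add (hl.const_mul β)).add
      ((hl.log (Real.log_pos h1).ne').const_mul (2 * β))).sub_const (Real.log δ))
    refine h2.congr' ?_
    filter_upwards [htraj] with i hi using (hi.rel t ht).symm
  have hrate : ∀ t, t₀ < t → Tendsto (fun i => phiRate β δ κ (y i t) (φ i t) (s i t)) l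
      (𝓝 (phiRate β δ κ (y' t) (φ' t) (s' t))) := by
    intro t ht
    have h1 := hy1 t ht
    have h2 := Real.log_pos h1
    have hl := (hy' t ht).log (by linarith)
    have h0 : y' t ≠ 0 := by linarith
    exact (((hs' t ht).rexp.const_sub 1).const_mul (δ / β)).add
      (((hφ' t ht).rexp.const_mul κ).mul ((tendsto_const_nhds.div (hy' t ht) h0).add
        (tendsto_const_nhds.div ((hy' t ht).mul hl) (mul_ne_zero h0 h2.ne'))))
  have hIoo : ∀ t : ℝ, t₀ < t → t ∈ Ioo t₀ (t + 1) := fun t ht => ⟨ht, lt_add_one t⟩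
  refine ⟨y', φ', s', IsLogTrajectory.of_rel hβ.ne' hy1 (fun _ => rfl) ?_ ?_, ?_, ?_, ?_, ?_⟩
  · intro t ht
    refine hasDerivAt_of_tendstoLocallyUniformlyOn (isOpen_Ioo (a := t₀) (b := t + 1))
      (g' := fun t => κ * Real.exp (φ' t)) (TendstoUniformlyOn.tendstoLocallyUniformlyOn
        (((cy' (t + 1)).tendstoUniformlyOn_of_tendsto ?_).mono Ioo_subset_Ioc_self)) ?_
      (fun x hx => hy' x hx.1) (hIoo t ht)
    · exact fun x hx => (hφ' x hx.1).rexp.const_mul κ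
    · filter_upwards [htraj] with i hi x hx using hi.hasDerivAt_y x hx.1
  · intro t ht
    refine hasDerivAt_of_tendstoLocallyUniformlyOn (isOpen_Ioo (a := t₀) (b := t + 1))
      (g' := fun t => phiRate β δ κ (y' t) (φ' t) (s' t))
      (TendstoUniformlyOn.tendstoLocallyUniformlyOn
        (((cφ' (t + 1)).tendstoUniformlyOn_of_tendsto ?_).mono Ioo_subset_Ioc_self)) ?_
      (fun x hx => hφ' x hx.1) (hIoo t ht)
    · exact fun x hx => hrate x hx.1
    · filter_upwards [htraj] with i hi x hx using hi.hasDerivAt_phi x hx.1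
  · intro t ht
    exact ⟨le_of_tendsto (hs' t ht).abs ((hnear t ht).mono fun i h => h.1),
      le_of_tendsto (hφ' t ht).abs ((hnear t ht).mono fun i h => h.2.1), hye t ht⟩
  · exact fun τ => (cy τ).tendstoUniformlyOn_of_tendsto fun t ht => hy' t ht.1
  · exact fun τ => (cφ τ).tendstoUniformlyOn_of_tendsto fun t ht => hφ' t ht.1
  · exact fun τ => (cs τ).tendstoUniformlyOn_of_tendsto fun t ht => hs' t ht.1

/-- Uniqueness: two trajectories that tend to infinity coincide. -/
lemma TrajectoryComparison.eq_of_tendsto {β δ κ t₀ c K : ℝ} {B : ℝ → ℝ}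
    (hcmp : TrajectoryComparison β δ κ t₀ c K B) {y₁ φ₁ s₁ y₂ φ₂ s₂ : ℝ → ℝ}
    (h₁ : IsLogTrajectory β δ κ t₀ y₁ φ₁ s₁) (h₂ : IsLogTrajectory β δ κ t₀ y₂ φ₂ s₂)
    (hy₁ : Tendsto y₁ atTop atTop) (hy₂ : Tendsto y₂ atTop atTop) {t : ℝ} (ht : t₀ < t) :
    y₁ t = y₂ t := by
  have hbig : ∀ y : ℝ → ℝ, Tendsto y atTop atTop → ∀ b, ∃ t, t₀ < t ∧ b < y t := fun y hy b =>
    ((eventually_gt_atTop t₀).and (hy.eventually_gt_atTop b)).exists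
  have hle : ∀ᶠ t₁ in atTop, |y₁ t - y₂ t| ≤ K * Real.exp (-c * (t₁ - t)) := by
    filter_upwards [eventually_ge_atTop t] with t₁ ht₁
    exact (hcmp.close _ _ _ _ _ _ h₁ h₂ t₁ (ht.trans_le ht₁) (hbig y₁ hy₁ _) (hbig y₂ hy₂ _)
      t ht ht₁).1
  have hlim : Tendsto (fun t₁ => K * Real.exp (-c * (t₁ - t))) atTop (𝓝 0) := by
    have h1 : Tendsto (fun t₁ => -c * (t₁ - t)) atTop atBot :=
      (tendsto_atTop_add_const_right atTop (-t) tendsto_id).const_mul_atTop_of_neg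
        (neg_neg_of_pos hcmp.c_pos)
    simpa using (Real.tendsto_exp_atBot.comp h1).const_mul K
  have := ge_of_tendsto hlim hle
  exact sub_eq_zero.1 (abs_nonpos_iff.1 this)

/-! ### Convergence of the radial solutions -/

/-- Continuous convergence on a compact set is uniform. -/
lemma tendstoUniformlyOn_of_forall_tendsto {ι : Type*} {l : Filter ι} {F : ι → ℝ → ℝ} {f : ℝ → ℝ}
    {S : Set ℝ} (hS : IsCompact S) (hf : ContinuousOn f S)
    (h : ∀ x ∈ S, Tendsto (fun q : ι × ℝ => F q.1 q.2) (l ×ˢ 𝓝[S] x) (𝓝 (f x))) :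
    TendstoUniformlyOn F f l S := by
  rw [← tendstoLocallyUniformlyOn_iff_tendstoUniformlyOn_of_compact hS,
    tendstoLocallyUniformlyOn_iff_forall_tendsto]
  intro x hx
  have h1 : Tendsto (fun q : ι × ℝ => f q.2) (l ×ˢ 𝓝[S] x) (𝓝 (f x)) :=
    (hf x hx).tendsto.comp tendsto_snd
  exact (h1.prodMk_nhds (h x hx)).mono_right (nhds_le_uniformity _)

/-- Uniform convergence on `(t₀, τ]` for all `τ`, seen in the variable `r = e^{-t}`. -/
lemma tendsto_comp_neg_log {ι : Type*} {l : Filter ι} {t₀ : ℝ} {F : ι → ℝ → ℝ} {f : ℝ → ℝ}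
    (hf : ContinuousOn f (Ioi t₀)) (h : ∀ τ, TendstoUniformlyOn F f l (Ioc t₀ τ)) {r : ℝ}
    (hr : r ∈ Ioo 0 (Real.exp (-t₀))) :
    Tendsto (fun q : ι × ℝ => F q.1 (-Real.log q.2)) (l ×ˢ 𝓝 r) (𝓝 (f (-Real.log r))) := by
  have ht := IsLogTrajectory.lt_neg_log hr
  set t := -Real.log r with htdef
  have hlog : Tendsto (fun x => -Real.log x) (𝓝 r) (𝓝 t) :=
    (Real.continuousAt_log hr.1.ne').neg
  suffices h' : Tendsto (fun q : ι × ℝ => F q.1 q.2) (l ×ˢ 𝓝 t) (𝓝 (f t)) from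
    h'.comp (tendsto_id.prodMap hlog)
  have hmem : Ioc t₀ (t + 1) ∈ 𝓝 t := Ioc_mem_nhds ht (lt_add_one t)
  have h1 : Tendsto (fun q : ι × ℝ => f q.2) (l ×ˢ 𝓝 t) (𝓝 (f t)) :=
    ((hf.continuousAt (Ioi_mem_nhds ht)).tendsto).comp tendsto_snd
  have h2 := (tendstoUniformlyOn_iff_tendsto.1 (h (t + 1))).mono_left
    (Filter.prod_mono le_rfl (le_principal_iff.2 hmem))
  exact h1.congr_uniformity h2

namespace IsLogTrajectory

variable {β δ κ t₀ : ℝ} {y φ s u : ℝ → ℝ}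

lemma eqOn_deriv (h : IsLogTrajectory β δ κ t₀ y φ s) (hκ : 0 < κ)
    (hu : EqOn u (fun r => 1 / Real.log (y (-Real.log r))) (Ioo 0 (Real.exp (-t₀)))) :
    EqOn (deriv u) (fun r => Real.exp (logSpeed κ y φ (-Real.log r)) / r)
      (Ioo 0 (Real.exp (-t₀))) := fun _ hr =>
  ((h.hasDerivAt_inv_log hκ hr).congr_of_eventuallyEq
    (hu.eventuallyEq_of_mem (isOpen_Ioo.mem_nhds hr))).deriv

lemma eqOn_deriv_deriv (h : IsLogTrajectory β δ κ t₀ y φ s) (hκ : 0 < κ)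
    (hu : EqOn u (fun r => 1 / Real.log (y (-Real.log r))) (Ioo 0 (Real.exp (-t₀)))) :
    EqOn (deriv (deriv u)) (fun r => -(Real.exp (logSpeed κ y φ (-Real.log r)) / r ^ 2)
        * (1 + δ / β * (1 - Real.exp (s (-Real.log r))))) (Ioo 0 (Real.exp (-t₀))) := fun _ hr =>
  ((h.hasDerivAt_exp_logSpeed_div hr).congr_of_eventuallyEq
    ((h.eqOn_deriv hκ hu).eventuallyEq_of_mem (isOpen_Ioo.mem_nhds hr))).deriv

end IsLogTrajectory

/-- Locally uniform convergence of trajectories gives `C²` convergence of the functions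
`u = 1 / log y` on compact subsets of the open interval. -/
lemma tendstoC2Loc_of_trajectories {β δ κ t₀ : ℝ} (hκ : 0 < κ) {u y φ s : ℝ → ℝ → ℝ}
    {u' y' φ' s' : ℝ → ℝ}
    (htraj : ∀ᶠ a in 𝓝[>] (0 : ℝ), IsLogTrajectory β δ κ t₀ (y a) (φ a) (s a))
    (hu : ∀ᶠ a in 𝓝[>] (0 : ℝ),
      EqOn (u a) (fun r => 1 / Real.log (y a (-Real.log r))) (Ioo 0 (Real.exp (-t₀))))
    (htraj' : IsLogTrajectory β δ κ t₀ y' φ' s')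
    (hu' : EqOn u' (fun r => 1 / Real.log (y' (-Real.log r))) (Ioo 0 (Real.exp (-t₀))))
    (hy : ∀ τ, TendstoUniformlyOn y y' (𝓝[>] 0) (Ioc t₀ τ))
    (hφ : ∀ τ, TendstoUniformlyOn φ φ' (𝓝[>] 0) (Ioc t₀ τ))
    (hs : ∀ τ, TendstoUniformlyOn s s' (𝓝[>] 0) (Ioc t₀ τ)) :
    (∀ r ∈ Ioo 0 (Real.exp (-t₀)), Tendsto (fun q : ℝ × ℝ => u q.1 q.2) (𝓝[>] 0 ×ˢ 𝓝 r)
      (𝓝 (u' r))) ∧ TendstoC2Loc (Ioo 0 (Real.exp (-t₀))) u u' := by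
  set I := Ioo 0 (Real.exp (-t₀)) with hI
  have hin : ∀ r ∈ I, ∀ᶠ q : ℝ × ℝ in 𝓝[>] 0 ×ˢ 𝓝 r, q.2 ∈ I := fun r hr =>
    tendsto_snd.eventually (isOpen_Ioo.mem_nhds hr)
  have htr : ∀ r, ∀ᶠ q : ℝ × ℝ in 𝓝[>] 0 ×ˢ 𝓝 r,
      IsLogTrajectory β δ κ t₀ (y q.1) (φ q.1) (s q.1) := fun r => tendsto_fst.eventually htraj
  have hue : ∀ r, ∀ᶠ q : ℝ × ℝ in 𝓝[>] 0 ×ˢ 𝓝 r,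
      EqOn (u q.1) (fun r => 1 / Real.log (y q.1 (-Real.log r))) I := fun r =>
    tendsto_fst.eventually hu
  have ly : ∀ r ∈ I, Tendsto (fun q : ℝ × ℝ => y q.1 (-Real.log q.2)) (𝓝[>] 0 ×ˢ 𝓝 r)
      (𝓝 (y' (-Real.log r))) := fun r hr => tendsto_comp_neg_log htraj'.continuousOn_y hy hr
  have lφ : ∀ r ∈ I, Tendsto (fun q : ℝ × ℝ => φ q.1 (-Real.log q.2)) (𝓝[>] 0 ×ˢ 𝓝 r)
      (𝓝 (φ' (-Real.log r))) := fun r hr => tendsto_comp_neg_log htraj'.continuousOn_phi hφ hr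
  have ls : ∀ r ∈ I, Tendsto (fun q : ℝ × ℝ => s q.1 (-Real.log q.2)) (𝓝[>] 0 ×ˢ 𝓝 r)
      (𝓝 (s' (-Real.log r))) := fun r hr => tendsto_comp_neg_log htraj'.continuousOn_s hs hr
  have lr : ∀ r : ℝ, Tendsto (fun q : ℝ × ℝ => q.2) (𝓝[>] (0 : ℝ) ×ˢ 𝓝 r) (𝓝 r) :=
    fun r => tendsto_snd
  have hy1 : ∀ r ∈ I, 1 < y' (-Real.log r) := fun r hr =>
    htraj'.one_lt _ (IsLogTrajectory.lt_neg_log hr)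
  have lly : ∀ r ∈ I, Tendsto (fun q : ℝ × ℝ => Real.log (y q.1 (-Real.log q.2)))
      (𝓝[>] 0 ×ˢ 𝓝 r) (𝓝 (Real.log (y' (-Real.log r)))) := fun r hr =>
    (ly r hr).log (by linarith [hy1 r hr])
  have lq : ∀ r ∈ I, Tendsto (fun q : ℝ × ℝ => Real.exp (logSpeed κ (y q.1) (φ q.1)
      (-Real.log q.2))) (𝓝[>] 0 ×ˢ 𝓝 r) (𝓝 (Real.exp (logSpeed κ y' φ' (-Real.log r)))) :=
    fun r hr => ((((lφ r hr).add_const _).sub (lly r hr)).sub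
      (((lly r hr).log (Real.log_pos (hy1 r hr)).ne').const_mul 2)).rexp
  have l0 : ∀ r ∈ I, Tendsto (fun q : ℝ × ℝ => u q.1 q.2) (𝓝[>] 0 ×ˢ 𝓝 r) (𝓝 (u' r)) := by
    intro r hr
    rw [hu' hr]
    refine (tendsto_const_nhds.div (lly r hr) (Real.log_pos (hy1 r hr)).ne').congr' ?_
    filter_upwards [hin r hr, hue r] with q h1 h2 using (h2 h1).symm
  have l1 : ∀ r ∈ I, Tendsto (fun q : ℝ × ℝ => deriv (u q.1) q.2) (𝓝[>] 0 ×ˢ 𝓝 r)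
      (𝓝 (deriv u' r)) := by
    intro r hr
    rw [htraj'.eqOn_deriv hκ hu' hr]
    refine ((lq r hr).div (lr r) hr.1.ne').congr' ?_
    filter_upwards [hin r hr, hue r, htr r] with q h1 h2 h3 using (h3.eqOn_deriv hκ h2 h1).symm
  have l2 : ∀ r ∈ I, Tendsto (fun q : ℝ × ℝ => deriv (deriv (u q.1)) q.2) (𝓝[>] 0 ×ˢ 𝓝 r)
      (𝓝 (deriv (deriv u') r)) := by
    intro r hr
    rw [htraj'.eqOn_deriv_deriv hκ hu' hr]
    refine ((((lq r hr).div ((lr r).pow 2) (pow_ne_zero 2 hr.1.ne')).neg).mul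
      ((((ls r hr).rexp.const_sub 1).const_mul (δ / β)).const_add 1)).congr' ?_
    filter_upwards [hin r hr, hue r, htr r] with q h1 h2 h3 using
      (h3.eqOn_deriv_deriv hκ h2 h1).symm
  -- continuous convergence to a function makes that function continuous
  have hcont : ∀ (F : ℝ → ℝ → ℝ) (f : ℝ → ℝ),
      (∀ r ∈ I, Tendsto (fun q : ℝ × ℝ => F q.1 q.2) (𝓝[>] 0 ×ˢ 𝓝 r) (𝓝 (f r))) →
      ContinuousOn f I := by
    intro F f hF r hr
    refine ContinuousAt.continuousWithinAt ?_
    rw [Metric.continuousAt_iff]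
    intro ε hε
    obtain ⟨pa, hpa, pb, hpb, hab⟩ :=
      eventually_prod_iff.1 ((hF r hr).eventually (Metric.ball_mem_nhds _ (half_pos hε)))
    obtain ⟨d, hd, hball⟩ := Metric.mem_nhds_iff.1 (inter_mem hpb (isOpen_Ioo.mem_nhds hr))
    refine ⟨d, hd, fun {x} hx => ?_⟩
    have hx2 := hball hx
    have hlim : Tendsto (fun a => F a x) (𝓝[>] 0) (𝓝 (f x)) :=
      (hF x hx2.2).comp (tendsto_id.prodMk (tendsto_const_nhds))
    have hle : dist (f x) (f r) ≤ ε / 2 := le_of_tendsto (hlim.dist tendsto_const_nhds)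
      (hpa.mono fun a ha => (Metric.mem_ball.1 (hab ha hx2.1)).le)
    linarith
  refine ⟨l0, fun k hk S hS hSc => ?_⟩
  have main : ∀ (F : ℝ → ℝ → ℝ) (f : ℝ → ℝ),
      (∀ r ∈ I, Tendsto (fun q : ℝ × ℝ => F q.1 q.2) (𝓝[>] 0 ×ˢ 𝓝 r) (𝓝 (f r))) →
      TendstoUniformlyOn F f (𝓝[>] 0) S := fun F f hF =>
    tendstoUniformlyOn_of_forall_tendsto hSc ((hcont F f hF).mono hS) fun x hx =>
      (hF x (hS hx)).mono_left (Filter.prod_mono le_rfl nhdsWithin_le_nhds)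
  interval_cases k
  · simpa only [iteratedDeriv_zero] using main _ _ l0
  · simpa only [iteratedDeriv_one] using main _ _ l1
  · simpa only [iteratedDeriv_succ, iteratedDeriv_zero] using main _ _ l2

/-! ### Solutions of the radial problem -/

lemma IsFluxSystem.congr {α β γ r₀ : ℝ} {u v w : ℝ → ℝ} (h : IsFluxSystem α β γ r₀ u w)
    (huv : EqOn v u (Ioo 0 r₀)) : IsFluxSystem α β γ r₀ v w where
  u_pos r hr := by rw [huv hr]; exact h.u_pos r hr
  w_pos := h.w_pos
  hasDerivAt_u r hr := (h.hasDerivAt_u r hr).congr_of_eventuallyEq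
    (huv.eventuallyEq_of_mem (isOpen_Ioo.mem_nhds hr))
  hasDerivAt_w r hr := by rw [huv hr]; exact h.hasDerivAt_w r hr

/-- A trajectory tending to infinity gives a solution of the singular problem. The value at `0` is
set by hand because `log 0` is a junk value. -/
lemma IsLogTrajectory.isRadialSolution_zero {α β γ δ κ t₀ : ℝ} {y φ s : ℝ → ℝ}
    (h : IsLogTrajectory β δ κ t₀ y φ s) (hβ : 0 < β) (hκ : 0 < κ) (hδ : 0 < δ)
    (hαδ : α = δ + β) (hγ : γ = κ + δ) (hy : Tendsto y atTop atTop) :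
    IsRadialSolution α β γ ruptureNonlinearity (Real.exp (-t₀)) 0
      (Function.update (fun r => 1 / Real.log (y (-Real.log r))) 0 0) := by
  set v := Function.update (fun r => 1 / Real.log (y (-Real.log r))) 0 0 with hv
  have heq : EqOn v (fun r => 1 / Real.log (y (-Real.log r))) (Ioo 0 (Real.exp (-t₀))) :=
    fun r hr => Function.update_of_ne hr.1.ne' _ _
  have hsys := (h.isFluxSystem hβ hκ hδ hαδ hγ).congr heq
  have hv0 : v 0 = 0 := Function.update_self _ _ _
  have hc : ContinuousOn v (Ico 0 (Real.exp (-t₀))) := by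
    intro r hr
    rcases hr.1.eq_or_lt with h0 | h0
    · rw [← h0]
      have h1 : ContinuousWithinAt v (Ioi 0) 0 := by
        have h2 : Tendsto (fun r => 1 / Real.log (y (-Real.log r))) (𝓝[>] 0) (𝓝 0) := by
          simp only [one_div]
          exact tendsto_inv_atTop_zero.comp (Real.tendsto_log_atTop.comp
            (hy.comp (tendsto_neg_atBot_atTop.comp Real.tendsto_log_nhdsGT_zero)))
        unfold ContinuousWithinAt
        rw [hv0]
        refine h2.congr' ?_
        filter_upwards [self_mem_nhdsWithin] with x hx
        rw [hv, Function.update_of_ne (mem_Ioi.1 hx).ne']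
      exact (continuousWithinAt_Ioi_iff_Ici.1 h1).mono fun x hx => hx.1
    · exact (hsys.hasDerivAt_u r ⟨h0, hr.2⟩).continuousAt.continuousWithinAt
  have := hsys.isRadialSolution hβ hc
  rwa [hv0] at this

namespace IsRadialSolution

variable {α β γ r₀ c : ℝ} {u : ℝ → ℝ}

lemma tendsto_exp_neg (h : IsRadialSolution α β γ ruptureNonlinearity r₀ c u) (hr₀ : 0 < r₀) :
    Tendsto (fun t => u (Real.exp (-t))) atTop (𝓝 c) := by
  have h1 : Tendsto u (𝓝[Ico 0 r₀] 0) (𝓝 c) := by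
    have := h.continuousOn 0 ⟨le_rfl, hr₀⟩
    rwa [ContinuousWithinAt, h.initial] at this
  have h2 : Tendsto (fun t => Real.exp (-t)) atTop (𝓝 0) := Real.tendsto_exp_neg_atTop_nhds_zero
  refine h1.comp (tendsto_nhdsWithin_iff.2 ⟨h2, ?_⟩)
  filter_upwards [h2.eventually_lt_const hr₀] with t ht using ⟨(Real.exp_pos _).le, ht⟩

/-- The variable `y = exp (1/u)` along a solution starting at `0` tends to infinity. -/
lemma tendsto_exp_inv {t₀ : ℝ}
    (h : IsRadialSolution α β γ ruptureNonlinearity (Real.exp (-t₀)) 0 u) :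
    Tendsto (fun t => Real.exp (1 / u (Real.exp (-t)))) atTop atTop := by
  refine Real.tendsto_exp_atTop.comp ?_
  simp only [one_div]
  refine tendsto_inv_nhdsGT_zero.comp (tendsto_nhdsWithin_iff.2
    ⟨h.tendsto_exp_neg (Real.exp_pos _), ?_⟩)
  filter_upwards [eventually_gt_atTop t₀] with t ht
  exact h.pos _ ⟨Real.exp_pos _, Real.exp_lt_exp.2 (by linarith)⟩

lemma nonneg (h : IsRadialSolution α β γ ruptureNonlinearity r₀ c u) (hc : 0 ≤ c) {r : ℝ}
    (hr : r ∈ Ico 0 r₀) : 0 ≤ u r := by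
  rcases hr.1.eq_or_lt with h0 | h0
  · rw [← h0, h.initial]; exact hc
  · exact (h.pos r ⟨h0, hr.2⟩).le

end IsRadialSolution

lemma eqOn_inv_log_exp_inv {u : ℝ → ℝ} (S : Set ℝ) (hS : S ⊆ Ioi 0) :
    EqOn u (fun r => 1 / Real.log (Real.exp (1 / u (Real.exp (-(-Real.log r)))))) S := by
  intro r hr
  simp only []
  rw [neg_neg, Real.exp_log (hS hr), Real.log_exp, one_div_one_div]

/-- Pointwise convergence on the open interval extends to uniform convergence up to the origin,
because all solutions are increasing. -/
lemma tendstoCLoc_of_monotone {α β γ r₀ : ℝ} (hβ : 0 < β) (hβα : β ≤ α) {u : ℝ → ℝ → ℝ}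
    {u' : ℝ → ℝ}
    (hu : ∀ a, 0 < a → IsRadialSolution α β γ ruptureNonlinearity r₀ a (u a))
    (hu' : IsRadialSolution α β γ ruptureNonlinearity r₀ 0 u')
    (hlim : ∀ r ∈ Ioo 0 r₀, Tendsto (fun q : ℝ × ℝ => u q.1 q.2) (𝓝[>] 0 ×ˢ 𝓝 r) (𝓝 (u' r))) :
    TendstoCLoc (Ico 0 r₀) u u' := by
  intro S hS hSc
  refine tendstoUniformlyOn_of_forall_tendsto hSc (hu'.continuousOn.mono hS) fun x hx => ?_
  have hx' := hS hx
  rcases hx'.1.eq_or_lt with h0 | h0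
  · rw [← h0, hu'.initial]
    have hr₀ : 0 < r₀ := hx'.1.trans_lt hx'.2
    have hfst : ∀ᶠ q : ℝ × ℝ in 𝓝[>] 0 ×ˢ 𝓝[S] (0 : ℝ), 0 < q.1 :=
      tendsto_fst.eventually self_mem_nhdsWithin
    have hsnd : ∀ᶠ q : ℝ × ℝ in 𝓝[>] (0 : ℝ) ×ˢ 𝓝[S] (0 : ℝ), q.2 ∈ S :=
      tendsto_snd.eventually self_mem_nhdsWithin
    refine tendsto_order.2 ⟨fun b hb => ?_, fun b hb => ?_⟩
    · filter_upwards [hfst, hsnd] with q h1 h2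
      exact hb.trans_le ((hu _ h1).nonneg h1.le (hS h2))
    · have h1 : ∀ᶠ t in atTop, u' (Real.exp (-t)) < b :=
        (hu'.tendsto_exp_neg hr₀).eventually_lt_const hb
      have h2 : ∀ᶠ t in atTop, Real.exp (-t) < r₀ :=
        Real.tendsto_exp_neg_atTop_nhds_zero.eventually_lt_const hr₀
      obtain ⟨t, ht1, ht2⟩ := (h1.and h2).exists
      set r := Real.exp (-t)
      have hr : r ∈ Ioo 0 r₀ := ⟨Real.exp_pos _, ht2⟩
      have h3 : ∀ᶠ a in 𝓝[>] 0, u a r < b :=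
        ((hlim r hr).comp (tendsto_id.prodMk tendsto_const_nhds)).eventually_lt_const ht1
      have h4 : ∀ᶠ q : ℝ × ℝ in 𝓝[>] (0 : ℝ) ×ˢ 𝓝[S] (0 : ℝ), q.2 < r :=
        tendsto_snd.eventually (nhdsWithin_le_nhds (gt_mem_nhds hr.1))
      filter_upwards [hfst, hsnd, tendsto_fst.eventually h3, h4] with q g1 g2 g3 g4
      exact ((hu _ g1).monotoneOn hβ hβα (hS g2) ⟨hr.1.le, hr.2⟩ g4.le).trans_lt g3
  · exact (hlim x ⟨h0, hx'.2⟩).mono_left (Filter.prod_mono le_rfl nhdsWithin_le_nhds)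

/-- If `g` has a zero in every interval of length `ℓ` of a long range of `t = -log r`, then the
zero number of the corresponding function of `r` is large. -/
lemma natCast_le_zeroNumber {g : ℝ → ℝ} {ρ ℓ : ℝ} (hρ : 0 < ρ) (n : ℕ)
    (hzero : ∀ k < n, ∃ t ∈ Icc (-Real.log ρ + 1 + k * (ℓ + 1))
      (-Real.log ρ + 1 + k * (ℓ + 1) + ℓ), g (Real.exp (-t)) = 0) (hℓ : 0 < ℓ) :
    (n : ℕ∞) ≤ zeroNumber (Ioo 0 ρ) g := by
  have h1 : ∀ k : Fin n, ∃ t ∈ Icc (-Real.log ρ + 1 + (k : ℕ) * (ℓ + 1))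
      (-Real.log ρ + 1 + (k : ℕ) * (ℓ + 1) + ℓ), g (Real.exp (-t)) = 0 :=
    fun k => hzero k k.2
  choose t ht hg using h1
  have hmono : StrictMono t := by
    intro i j hij
    have h2 : ((i : ℕ) : ℝ) + 1 ≤ (j : ℕ) := by exact_mod_cast hij
    have h3 : (((i : ℕ) : ℝ) + 1) * (ℓ + 1) ≤ (j : ℕ) * (ℓ + 1) := by gcongr
    linarith [(ht i).2, (ht j).1]
  have hinj : Function.Injective fun k => Real.exp (-t k) := fun i j hij =>
    hmono.injective (neg_injective (Real.exp_injective hij))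
  calc (n : ℕ∞) = ENat.card (Fin n) := by simp
    _ ≤ (range fun k => Real.exp (-t k)).encard := hinj.encard_range
    _ ≤ zeroNumber (Ioo 0 ρ) g := by
        refine encard_le_encard ?_
        rintro _ ⟨k, rfl⟩
        refine ⟨⟨Real.exp_pos _, ?_⟩, hg k⟩
        have h2 : 0 ≤ ((k : ℕ) : ℝ) * (ℓ + 1) := by positivity
        have h3 : -t k < Real.log ρ := by linarith [(ht k).1]
        calc Real.exp (-t k) < Real.exp (Real.log ρ) := Real.exp_lt_exp.2 h3
          _ = ρ := Real.exp_log hρ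

theorem proposition2p5 (α β γ : ℝ) (hβ : 1 ≤ β) (hαβ : β < α) (hγα : α < γ) :
    ∃ r₀ : ℝ, 0 < r₀ ∧ ∃ (ustar : ℝ → ℝ) (u : ℝ → ℝ → ℝ),
      IsUniqueRadialSolution α β γ ruptureNonlinearity r₀ 0 ustar ∧
      (∀ a : ℝ, 0 < a → IsUniqueRadialSolution α β γ ruptureNonlinearity r₀ a (u a)) ∧
      Asymptotics.IsEquivalent (𝓝[>] (0 : ℝ)) ustar
        (fun r : ℝ => 1 / Real.log |Real.log r|) ∧
      (TendstoC2Loc (Ioo 0 r₀) u ustar ∧ TendstoCLoc (Ico 0 r₀) u ustar) ∧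
      ((α - β) * (β + 4) < 4 * γ →
        ∀ ρ ∈ Ioo 0 r₀,
          Tendsto (fun a : ℝ => zeroNumber (Ioo 0 ρ) (fun r => u a r - ustar r))
            (𝓝[>] (0 : ℝ)) (𝓝 (⊤ : ℕ∞))) := by
  have hβ0 : 0 < β := by linarith
  set δ := α - β with hδdef
  set κ := γ - δ with hκdef
  have hδ : 0 < δ := by linarith
  have hκ : 0 < κ := by linarith
  have hαδ : α = δ + β := by linarith
  have hγκ : γ = κ + δ := by linarith
  obtain ⟨t₀, c, K, B, ht₀, hcmp⟩ := exists_trajectoryComparison hβ0 hδ hκ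
  have hr₀ : 0 < Real.exp (-t₀) := Real.exp_pos _
  have hex : ∀ a, ∃ u, 0 < a →
      IsUniqueRadialSolution α β γ ruptureNonlinearity (Real.exp (-t₀)) a u := fun a => by
    by_cases ha : 0 < a
    · obtain ⟨u, hu⟩ := exists_isUniqueRadialSolution_of_pos hr₀ hβ hαβ hγα ha
      exact ⟨u, fun _ => hu⟩
    · exact ⟨0, fun h => absurd h ha⟩
  choose u hu using hex
  have htr : ∀ a, ∃ φ s, 0 < a →
      IsLogTrajectory β δ κ t₀ (fun t => Real.exp (1 / u a (Real.exp (-t)))) φ s := fun a => by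
    by_cases ha : 0 < a
    · obtain ⟨φ, s, h⟩ := ((hu a ha).1.isFluxSystem hβ0 hαβ.le).exists_isLogTrajectory
        hβ0 hκ hδ hαδ hγκ
      exact ⟨φ, s, fun _ => h⟩
    · exact ⟨0, 0, fun h => absurd h ha⟩
  choose φ s htraj using htr
  set y : ℝ → ℝ → ℝ := fun a t => Real.exp (1 / u a (Real.exp (-t))) with hy
  have hpos : ∀ᶠ a in 𝓝[>] (0 : ℝ), 0 < a := self_mem_nhdsWithin
  have htraj' : ∀ᶠ a in 𝓝[>] (0 : ℝ), IsLogTrajectory β δ κ t₀ (y a) (φ a) (s a) :=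
    hpos.mono htraj
  have hbig : ∀ t₁, t₀ < t₁ → ∀ᶠ a in 𝓝[>] (0 : ℝ), ∃ t, t₀ < t ∧ B t₁ < y a t := by
    intro t₁ _
    have h1 : Tendsto (fun a : ℝ => Real.exp (1 / a)) (𝓝[>] 0) atTop := by
      simp only [one_div]
      exact Real.tendsto_exp_atTop.comp tendsto_inv_nhdsGT_zero
    filter_upwards [hpos, h1.eventually_gt_atTop (B t₁)] with a ha hB
    have h2 : Tendsto (y a) atTop (𝓝 (Real.exp (1 / a))) :=
      (tendsto_const_nhds.div ((hu a ha).1.tendsto_exp_neg hr₀) ha.ne').rexp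
    exact ((eventually_gt_atTop t₀).and (h2.eventually_const_lt hB)).exists
  obtain ⟨y', φ', s', hlim, hbd, ly, lφ, ls⟩ := hcmp.exists_limit hβ0 htraj' hbig
  have hy' : Tendsto y' atTop atTop := hlim.tendsto_y hβ0 hκ (fun t ht => (hbd t ht).1)
    fun t ht => (hbd t ht).2.1
  set ustar := Function.update (fun r => 1 / Real.log (y' (-Real.log r))) 0 0 with hustar
  have hstar : IsRadialSolution α β γ ruptureNonlinearity (Real.exp (-t₀)) 0 ustar :=
    hlim.isRadialSolution_zero hβ0 hκ hδ hαδ hγκ hy'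
  have hstar_eq : ∀ r, 0 < r → ustar r = 1 / Real.log (y' (-Real.log r)) := fun r hr =>
    Function.update_of_ne hr.ne' _ _
  have hIoo : Ioo 0 (Real.exp (-t₀)) ⊆ Ioi 0 := fun r hr => hr.1
  obtain ⟨hcc, hC2⟩ := tendstoC2Loc_of_trajectories hκ (u := u) (u' := ustar) htraj'
    (Eventually.of_forall fun a => eqOn_inv_log_exp_inv _ hIoo) hlim
    (fun r hr => hstar_eq r hr.1) ly lφ ls
  refine ⟨Real.exp (-t₀), hr₀, ustar, u, ⟨hstar, ?_⟩, hu, ?_, ⟨hC2, ?_⟩, ?_⟩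
  · intro v hv r hr
    rcases hr.1.eq_or_lt with h0 | h0
    · rw [← h0, hv.initial, hstar.initial]
    · obtain ⟨ψ, σ, hvt⟩ := (hv.isFluxSystem hβ0 hαβ.le).exists_isLogTrajectory
        hβ0 hκ hδ hαδ hγκ
      have hr' : r ∈ Ioo 0 (Real.exp (-t₀)) := ⟨h0, hr.2⟩
      have h1 := hcmp.eq_of_tendsto hvt hlim hv.tendsto_exp_inv hy'
        (IsLogTrajectory.lt_neg_log hr')
      rw [hstar_eq r h0, ← h1]
      exact eqOn_inv_log_exp_inv _ hIoo hr'
  · refine Asymptotics.isEquivalent_of_tendsto_one ?_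
    have h1 := (hlim.tendsto_log_div_log hβ0 hκ (fun t ht => (hbd t ht).1)
      (fun t ht => (hbd t ht).2.1) fun t ht => (hbd t ht).2.2).comp
      (tendsto_neg_atBot_atTop.comp Real.tendsto_log_nhdsGT_zero)
    refine h1.congr' ?_
    filter_upwards [self_mem_nhdsWithin] with r hr
    simp only [Function.comp_apply, Pi.div_apply]
    rw [hstar_eq r hr, Real.log_abs, Real.log_neg_eq_log]
    simp only [one_div, div_inv_eq_mul]
    ring
  · exact tendstoCLoc_of_monotone hβ0 hαβ.le (fun a ha => (hu a ha).1) hstar hcc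
  · intro hosc ρ hρ
    have hosc' : δ ^ 2 < 4 * (κ * (δ / β)) := by
      have h1 : δ * β < 4 * κ := by linarith
      have h2 : 4 * (κ * (δ / β)) = (4 * κ) * δ / β := by ring
      rw [h2, lt_div_iff₀ hβ0]
      nlinarith
    obtain ⟨ℓ, hℓ, hmeet⟩ := hcmp.meet hosc'
    rw [ENat.tendsto_nhds_top_iff_natCast_lt]
    intro n
    have hρt := IsLogTrajectory.lt_neg_log hρ
    set t₁ := -Real.log ρ + 1 + (n + 1) * (ℓ + 1) with ht₁
    have ht₁0 : t₀ < t₁ := by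
      have : 0 < ((n : ℝ) + 1) * (ℓ + 1) := by positivity
      linarith
    filter_upwards [hpos, hbig t₁ ht₁0] with a ha hb
    refine lt_of_lt_of_le (by exact_mod_cast Nat.lt_succ_self n)
      (natCast_le_zeroNumber hρ.1 (n + 1) (fun k hk => ?_) hℓ)
    have hk0 : 0 ≤ (k : ℝ) * (ℓ + 1) := by positivity
    have hk1 : (k : ℝ) * (ℓ + 1) ≤ n * (ℓ + 1) := by
      gcongr; exact Nat.lt_succ_iff.1 hk
    obtain ⟨t, ht, hyt⟩ := hmeet _ _ _ _ _ _ (htraj a ha) hlim t₁ ht₁0 hb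
      ((eventually_gt_atTop t₀).and (hy'.eventually_gt_atTop (B t₁))).exists
      (-Real.log ρ + 1 + k * (ℓ + 1)) (by linarith) (by linarith)
    refine ⟨t, ht, ?_⟩
    rw [hstar_eq _ (Real.exp_pos _), Real.log_exp, neg_neg, ← hyt, Real.log_exp, one_div_one_div,
      sub_self]
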